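/- Let $G$ be a compact Lie group, $K\subset G$ a closed subgroup with normaliser $N_GK$, and $k\geq 1$ an integer. Suppose that either - $W=\mathrm{U}(1)$ and $c=2k$, or - $W=\mathrm{SU}(2)$ and $c=4k-1$, and that $W$ is isomorphic, as a topological group, to a closed subgroup of $N_GK/K$. Then there is a compact smooth manifold $M$ (without boundary) with a smooth action of $G$ such that - the orbit space $G\backslash M$ is connected, and $K$ is a principal isotropy group of the action; - the kernel of the action is the largest normal subgroup of $G$ contained in $K$ (so the action is effective precisely when $K$ contains no non-trivial normal subgroup of $G$); - the action has cohomogeneity $c$, that is, the principal orbits have codimension $c$ in $M$; - exactly one orbit is non-principal. Here an orbit $Gx$ is called principal if it has the maximum orbit type: for every $y\in M$ the isotropy group $G_x$ is contained in a conjugate of $G_y$; a principal isotropy group is the isotropy group of a point on a principal orbit. -/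

import Mathlib

open scoped Manifold ContDiff

universe u

/-- The group `N_G K / K`, with its quotient topology. -/
abbrev WeylGroup {G : Type*} [Group G] (K : Subgroup G) : Type _ :=
  Subgroup.normalizer (K : Set G) ⧸ K.subgroupOf (Subgroup.normalizer (K : Set G))

/-- The topological group `W` is isomorphic to a closed subgroup of the topological group `Q`
(both groups being compact Hausdorff in all uses, a continuous injective homomorphism is
automatically a closed embedding). -/
def EmbedsIn (W Q : Type*) [Group W] [TopologicalSpace W] [Group Q] [TopologicalSpace Q] : Prop :=
  ∃ φ : W →* Q, Continuous φ ∧ Function.Injective φ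

/-- The orbit `O` is principal: it has the maximum orbit type, that is, every isotropy group of a
point of `O` is contained, up to conjugacy, in the isotropy group of every point of `M`.
(The isotropy group of `g • y` is the conjugate by `g` of the isotropy group of `y`.) -/
def IsPrincipalOrbit {G M : Type*} [Group G] [MulAction G M]
    (O : MulAction.orbitRel.Quotient G M) : Prop :=
  ∀ x ∈ O.orbit, ∀ y : M, ∃ g : G, MulAction.stabilizer G x ≤ MulAction.stabilizer G (g • y)

/-- `K` is a principal isotropy group: the isotropy group of a point on a principal orbit. -/
def IsPrincipalIsotropy {G : Type*} (M : Type*) [Group G] [MulAction G M] (K : Subgroup G) : Prop :=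
  ∃ O : MulAction.orbitRel.Quotient G M, IsPrincipalOrbit O ∧
    ∃ x ∈ O.orbit, MulAction.stabilizer G x = K

/-- The dimension of the orbit of `x` under a smooth action of a `d`-dimensional Lie group `G` on
an `n`-manifold: the rank at `1` of the orbit map `g ↦ g • x`, i.e. the dimension of the tangent
space of the orbit at `x`. -/
noncomputable def orbitDim (d n : ℕ) (G : Type*) {M : Type*} [Group G]
    [TopologicalSpace G] [ChartedSpace (EuclideanSpace ℝ (Fin d)) G]
    [TopologicalSpace M] [ChartedSpace (EuclideanSpace ℝ (Fin n)) M] [MulAction G M] (x : M) : ℕ :=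
  Module.finrank ℝ (LinearMap.range
    (mfderiv (𝓡 d) (𝓡 n) (fun g : G => g • x) 1).toLinearMap)

/-- The action of the `d`-dimensional Lie group `G` on the `n`-manifold `M` has cohomogeneity `c`:
there are principal orbits, and they have codimension `c` in `M`. -/
def HasCohomogeneity (d n : ℕ) (G M : Type*) [Group G]
    [TopologicalSpace G] [ChartedSpace (EuclideanSpace ℝ (Fin d)) G]
    [TopologicalSpace M] [ChartedSpace (EuclideanSpace ℝ (Fin n)) M] [MulAction G M]
    (c : ℕ) : Prop :=
  (∃ O : MulAction.orbitRel.Quotient G M, IsPrincipalOrbit O) ∧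
    ∀ O : MulAction.orbitRel.Quotient G M, IsPrincipalOrbit O →
      ∀ x ∈ O.orbit, orbitDim d n G x + c = n

/-!
Let `W` be `U(1)` or `SU(2)`, seen as the unit sphere of `D = ℂ` or `D = ℍ`, and let `L` be the
preimage in `N_G K` of the given copy of `W` in `N_G K / K`. Then `M = G ×_L S(V)`, where `W` acts
on `V = Dᵏ ⊕ T` by left multiplication on `Dᵏ` and on `T` by the weight two representation on `ℂ` or
by conjugation on `Im ℍ`. As `W` acts freely on `Dᵏ` off the origin, the points of `S(V)` outside
`S(T)` have isotropy group `K`, whereas `W` acts transitively on `S(T)`, and not freely because `-1`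
acts trivially on `T`. So `S(T)` gives the only non-principal orbit.

That `M` is a manifold needs local cross-sections of `G → G ⧸ L`, that is, the theorem that closed
subgroups are Lie subgroups: elements of `L` tending to the identity give one-parameter subgroups of
`L` as limits of powers along an ultrafilter, so `L` has no small elements transverse to its Lie
algebra. As `W` is only known as a topological group, the dimension of a principal orbit is read off
the image of the Lie algebra of `L` in `D`: it is a nonzero subspace of `Im D` invariant under
conjugation by `W`, hence all of `Im D`.
-/

open Filter Topology Set

section CenteredChart

variable {E : Type*} [NormedAddCommGroup E] [NormedSpace ℝ E]

theorem hasFDerivAt_coprod_of_comp_mk {F X : Type*} [NormedAddCommGroup F] [NormedSpace ℝ F]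
    [NormedAddCommGroup X] [NormedSpace ℝ X] {f : E × F → X} {x : E} {y : F} {A : E →L[ℝ] X}
    {B : F →L[ℝ] X} (hf : DifferentiableAt ℝ f (x, y))
    (hA : HasFDerivAt (fun u => f (u, y)) A x) (hB : HasFDerivAt (fun w => f (x, w)) B y) :
    HasFDerivAt f (A.coprod B) (x, y) := by
  have hA' := (hf.hasFDerivAt.comp x (hasFDerivAt_prodMk_left x y)).unique hA
  have hB' := (hf.hasFDerivAt.comp y (hasFDerivAt_prodMk_right x y)).unique hB
  rw [← hA', ← hB', ContinuousLinearMap.coprod_comp_inl_inr]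
  exact hf.hasFDerivAt

variable {G : Type*} [Group G] [TopologicalSpace G] [ChartedSpace E G]

/-- A smooth chart of a Lie group around the identity which sends the identity to `0`: the
coordinates in which all local computations in the group are carried out. -/
structure IsCenteredChart (φ : OpenPartialHomeomorph G E) : Prop where
  one_mem : (1 : G) ∈ φ.source
  map_one : φ 1 = 0
  contMDiffOn : ContMDiffOn 𝓘(ℝ, E) 𝓘(ℝ, E) ∞ φ φ.source
  contMDiffOn_symm : ContMDiffOn 𝓘(ℝ, E) 𝓘(ℝ, E) ∞ φ.symm φ.target

theorem exists_isCenteredChart [IsManifold 𝓘(ℝ, E) ∞ G] :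
    ∃ φ : OpenPartialHomeomorph G E, IsCenteredChart φ := by
  let c := chartAt E (1 : G)
  have translation (a : E) : ContMDiff 𝓘(ℝ, E) 𝓘(ℝ, E) ∞ (fun x : E => x + a) :=
    (contDiff_id.add contDiff_const).contMDiff
  refine ⟨c.transHomeomorph (Homeomorph.addRight (-c 1)), by simp [c], by simp, ?_, ?_⟩
  · exact (translation (-c 1)).comp_contMDiffOn contMDiffOn_chart
  · exact contMDiffOn_chart_symm.comp (translation (- -c 1)).contMDiffOn
      fun x hx => by simpa using hx

namespace IsCenteredChart

variable {φ : OpenPartialHomeomorph G E} (hφ : IsCenteredChart φ)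
include hφ

theorem source_mem_nhds : φ.source ∈ 𝓝 (1 : G) := φ.open_source.mem_nhds hφ.one_mem

theorem zero_mem : (0 : E) ∈ φ.target := hφ.map_one ▸ φ.map_source hφ.one_mem

theorem symm_zero : φ.symm 0 = 1 := by
  rw [← hφ.map_one, φ.left_inv hφ.one_mem]

theorem tendsto : Tendsto φ (𝓝 1) (𝓝 0) := by
  simpa only [ContinuousAt, hφ.map_one] using φ.continuousAt hφ.one_mem

theorem tendsto_symm : Tendsto φ.symm (𝓝 0) (𝓝 1) := by
  simpa only [ContinuousAt, hφ.symm_zero] using φ.symm.continuousAt (x := 0) hφ.zero_mem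

theorem contDiffAt_comp {X : Type*} [NormedAddCommGroup X] [NormedSpace ℝ X] {f : X → G} {x : X}
    (hf : ContMDiffAt 𝓘(ℝ, X) 𝓘(ℝ, E) ∞ f x) (hx : f x ∈ φ.source) :
    ContDiffAt ℝ ∞ (fun y => φ (f y)) x :=
  contMDiffAt_iff_contDiffAt.1
    ((hφ.contMDiffOn.contMDiffAt (φ.open_source.mem_nhds hx)).comp x hf)

theorem contMDiffAt_symm_comp {X : Type*} [NormedAddCommGroup X] [NormedSpace ℝ X] {f : X → E}
    {x : X} (hf : ContDiffAt ℝ ∞ f x) (hx : f x ∈ φ.target) :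
    ContMDiffAt 𝓘(ℝ, X) 𝓘(ℝ, E) ∞ (fun y => φ.symm (f y)) x :=
  (hφ.contMDiffOn_symm.contMDiffAt (φ.open_target.mem_nhds hx)).comp x hf.contMDiffAt

theorem contMDiffAt_symm : ContMDiffAt 𝓘(ℝ, E) 𝓘(ℝ, E) ∞ φ.symm 0 :=
  hφ.contMDiffAt_symm_comp contDiffAt_id hφ.zero_mem

theorem hasFDerivAt_symm : HasFDerivAt (fun u => φ (φ.symm u)) (ContinuousLinearMap.id ℝ E) 0 := by
  refine (hasFDerivAt_id (0 : E)).congr_of_eventuallyEq ?_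
  filter_upwards [φ.open_target.mem_nhds hφ.zero_mem] with u hu using φ.right_inv hu

variable [LieGroup 𝓘(ℝ, E) ∞ G]

theorem contDiffAt_mul {p : E × E} (hp₁ : p.1 ∈ φ.target) (hp₂ : p.2 ∈ φ.target)
    (hp : φ.symm p.1 * φ.symm p.2 ∈ φ.source) :
    ContDiffAt ℝ ∞ (fun p : E × E => φ (φ.symm p.1 * φ.symm p.2)) p :=
  hφ.contDiffAt_comp ((hφ.contMDiffAt_symm_comp contDiffAt_fst hp₁).mul
    (hφ.contMDiffAt_symm_comp contDiffAt_snd hp₂)) hp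

theorem hasStrictFDerivAt_mul :
    HasStrictFDerivAt (fun p : E × E => φ (φ.symm p.1 * φ.symm p.2))
      (ContinuousLinearMap.fst ℝ E E + ContinuousLinearMap.snd ℝ E E) 0 := by
  have hsmooth : ContDiffAt ℝ ∞ (fun p : E × E => φ (φ.symm p.1 * φ.symm p.2)) 0 :=
    hφ.contDiffAt_mul hφ.zero_mem hφ.zero_mem (by simp [hφ.symm_zero, hφ.one_mem])
  have hderiv := hasFDerivAt_coprod_of_comp_mk (hsmooth.differentiableAt (by simp))
    (by simpa [hφ.symm_zero] using hφ.hasFDerivAt_symm)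
    (by simpa [hφ.symm_zero] using hφ.hasFDerivAt_symm)
  refine (hsmooth.hasStrictFDerivAt' hderiv (by simp)).congr_fderiv ?_
  ext <;> simp

theorem hasFDerivAt_mul {X : Type*} [NormedAddCommGroup X] [NormedSpace ℝ X] {f g : X → G}
    {f' g' : X →L[ℝ] E} {x : X} (hfx : f x = 1) (hgx : g x = 1) (hfc : ContinuousAt f x)
    (hgc : ContinuousAt g x) (hf : HasFDerivAt (fun y => φ (f y)) f' x)
    (hg : HasFDerivAt (fun y => φ (g y)) g' x) :
    HasFDerivAt (fun y => φ (f y * g y)) (f' + g') x := by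
  have hmul : HasFDerivAt (fun p : E × E => φ (φ.symm p.1 * φ.symm p.2))
      (ContinuousLinearMap.fst ℝ E E + ContinuousLinearMap.snd ℝ E E) (φ (f x), φ (g x)) := by
    rw [hfx, hgx, hφ.map_one]; exact hφ.hasStrictFDerivAt_mul.hasFDerivAt
  refine ((hmul.comp x (hf.prodMk hg)).congr_fderiv (by ext; simp)).congr_of_eventuallyEq ?_
  filter_upwards [hfc.preimage_mem_nhds (hfx ▸ hφ.source_mem_nhds),
    hgc.preimage_mem_nhds (hgx ▸ hφ.source_mem_nhds)] with y hfy hgy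
  simp only [Function.comp_apply]
  rw [φ.left_inv hfy, φ.left_inv hgy]

theorem hasFDerivAt_inv :
    HasFDerivAt (fun u => φ (φ.symm u)⁻¹) (-ContinuousLinearMap.id ℝ E) 0 := by
  have hinv : ContMDiffAt 𝓘(ℝ, E) 𝓘(ℝ, E) ∞ (fun u => (φ.symm u)⁻¹) 0 := hφ.contMDiffAt_symm.inv
  have hd := ((hφ.contDiffAt_comp hinv (by simp [hφ.symm_zero, hφ.one_mem])).differentiableAt
    (by simp)).hasFDerivAt
  have hsum := hφ.hasFDerivAt_mul (by simp [hφ.symm_zero]) hφ.symm_zero hinv.continuousAt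
    hφ.contMDiffAt_symm.continuousAt hd hφ.hasFDerivAt_symm
  simp only [inv_mul_cancel] at hsum
  exact hd.congr_fderiv (eq_neg_of_add_eq_zero_left (hsum.unique (hasFDerivAt_const _ _)))

theorem hasStrictFDerivAt_inv_mul :
    HasStrictFDerivAt (fun p : E × E => φ ((φ.symm p.1)⁻¹ * φ.symm p.2))
      (ContinuousLinearMap.snd ℝ E E - ContinuousLinearMap.fst ℝ E E) 0 := by
  have hinv : ContMDiffAt 𝓘(ℝ, E × E) 𝓘(ℝ, E) ∞ (fun p => (φ.symm p.1)⁻¹) (0 : E × E) :=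
    (hφ.contMDiffAt_symm_comp contDiffAt_fst hφ.zero_mem).inv
  have hsnd : ContMDiffAt 𝓘(ℝ, E × E) 𝓘(ℝ, E) ∞ (fun p => φ.symm p.2) (0 : E × E) :=
    hφ.contMDiffAt_symm_comp contDiffAt_snd hφ.zero_mem
  have hinv' : HasFDerivAt (fun p : E × E => φ (φ.symm p.1)⁻¹)
      ((-ContinuousLinearMap.id ℝ E).comp (ContinuousLinearMap.fst ℝ E E)) 0 :=
    HasFDerivAt.comp (f := Prod.fst) (0 : E × E) hφ.hasFDerivAt_inv hasFDerivAt_fst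
  have hsnd' : HasFDerivAt (fun p : E × E => φ (φ.symm p.2))
      ((ContinuousLinearMap.id ℝ E).comp (ContinuousLinearMap.snd ℝ E E)) 0 :=
    HasFDerivAt.comp (f := Prod.snd) (0 : E × E) hφ.hasFDerivAt_symm hasFDerivAt_snd
  have hderiv := hφ.hasFDerivAt_mul (by simp [hφ.symm_zero]) (by simp [hφ.symm_zero])
    hinv.continuousAt hsnd.continuousAt hinv' hsnd'
  have hsmooth := hφ.contDiffAt_comp (hinv.mul hsnd) (by simp [hφ.symm_zero, hφ.one_mem])
  refine (hsmooth.hasStrictFDerivAt' hderiv (by simp)).congr_fderiv ?_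
  ext <;> simp

theorem exists_norm_mul_sub_le {ε : ℝ} (hε : 0 < ε) :
    ∃ r > 0, Metric.closedBall (0 : E) r ⊆ φ.target ∧ ∀ u w : E, ‖u‖ ≤ r → ‖w‖ ≤ r →
      φ.symm u * φ.symm w ∈ φ.source ∧ ‖φ (φ.symm u * φ.symm w) - u - w‖ ≤ ε * ‖w‖ := by
  have : IsTopologicalGroup G := topologicalGroup_of_lieGroup 𝓘(ℝ, E) ∞
  have hsource : ∀ᶠ p : E × E in 𝓝 0, φ.symm p.1 * φ.symm p.2 ∈ φ.source := by
    have hmul : Tendsto (fun p : E × E => φ.symm p.1 * φ.symm p.2) (𝓝 0) (𝓝 (1 * 1)) :=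
      (hφ.tendsto_symm.comp (continuous_fst.tendsto' _ _ rfl)).mul
        (hφ.tendsto_symm.comp (continuous_snd.tendsto' _ _ rfl))
    exact hmul (by simpa using hφ.source_mem_nhds)
  have htarget : ∀ᶠ p : E × E in 𝓝 0, p.1 ∈ φ.target :=
    (continuous_fst.tendsto' (0 : E × E) 0 rfl) (φ.open_target.mem_nhds hφ.zero_mem)
  have hcompare : Tendsto (fun p : E × E => (p, (p.1, (0 : E)))) (𝓝 0) (𝓝 (0, 0)) :=
    (by fun_prop : Continuous _).tendsto' _ _ rfl
  obtain ⟨r, hr, hball⟩ := Metric.nhds_basis_closedBall.eventually_iff.1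
    ((hsource.and htarget).and (hcompare.eventually (hφ.hasStrictFDerivAt_mul.isLittleO.def hε)))
  have mem (u w : E) (hu : ‖u‖ ≤ r) (hw : ‖w‖ ≤ r) : (u, w) ∈ Metric.closedBall (0 : E × E) r := by
    simpa [Prod.norm_def] using ⟨hu, hw⟩
  refine ⟨r, hr, fun u hu => (hball (mem u 0 (by simpa using hu) (by simpa using hr.le))).1.2,
    fun u w hu hw => ?_⟩
  obtain ⟨⟨hs, ht⟩, hle⟩ := hball (mem u w hu hw)
  exact ⟨hs, by simpa [hφ.symm_zero, φ.right_inv ht, Prod.norm_def] using hle⟩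

theorem exists_norm_pow_sub_le {ε : ℝ} (hε : 0 < ε) :
    ∃ δ > 0, ∃ r > 0, Metric.closedBall (0 : E) r ⊆ φ.target ∧
      ∀ x ∈ φ.source, ∀ j : ℕ, j * ‖φ x‖ ≤ δ →
        x ^ j ∈ φ.source ∧ ‖φ (x ^ j)‖ ≤ r ∧ ‖φ (x ^ j) - j • φ x‖ ≤ ε * (j * ‖φ x‖) := by
  obtain ⟨r, hr, hball, hmul⟩ := hφ.exists_norm_mul_sub_le hε
  refine ⟨r / (1 + ε), by positivity, r, hr, hball, fun x hx j => ?_⟩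
  induction j with
  | zero => intro _; simp [hφ.one_mem, hφ.map_one, hr.le]
  | succ j ih =>
    intro hj
    push_cast at hj
    obtain ⟨hpow, hpow_le, hpow_sub⟩ := ih (le_trans (by gcongr; linarith) hj)
    have hx_le : ‖φ x‖ ≤ r := calc
      ‖φ x‖ ≤ (j + 1) * ‖φ x‖ := le_mul_of_one_le_left (norm_nonneg _) (by simp)
      _ ≤ r / (1 + ε) := hj
      _ ≤ r := div_le_self hr.le (by linarith)
    obtain ⟨hsucc, hsucc_sub⟩ := hmul _ _ hpow_le hx_le
    rw [φ.left_inv hpow, φ.left_inv hx, ← pow_succ] at hsucc hsucc_sub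
    have hsub : ‖φ (x ^ (j + 1)) - (j + 1) • φ x‖ ≤ ε * ((j + 1) * ‖φ x‖) := calc
      ‖φ (x ^ (j + 1)) - (j + 1) • φ x‖
          = ‖(φ (x ^ (j + 1)) - φ (x ^ j) - φ x) + (φ (x ^ j) - j • φ x)‖ := by
            rw [add_smul, one_smul]; congr 1; abel
      _ ≤ ε * ‖φ x‖ + ε * (j * ‖φ x‖) := norm_add_le_of_le hsucc_sub hpow_sub
      _ = ε * ((j + 1) * ‖φ x‖) := by ring
    refine ⟨hsucc, ?_, by exact_mod_cast hsub⟩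
    calc ‖φ (x ^ (j + 1))‖
        = ‖(φ (x ^ (j + 1)) - (j + 1) • φ x) + (j + 1) • φ x‖ := by rw [sub_add_cancel]
      _ ≤ ε * ((j + 1) * ‖φ x‖) + (j + 1) * ‖φ x‖ := by
          refine norm_add_le_of_le hsub (norm_nsmul_le.trans_eq ?_)
          push_cast; rfl
      _ = (j + 1) * ‖φ x‖ * (1 + ε) := by ring
      _ ≤ r := (le_div_iff₀ (by positivity)).1 hj

end IsCenteredChart

end CenteredChart

section OneParameterSubgroup

/-- A continuous one-parameter subgroup `ℝ → H`. Monoids are allowed in order to include the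
multiplicative monoid of a Banach algebra; the values are then automatically units. -/
structure IsOneParameterSubgroup {H : Type*} [Monoid H] [TopologicalSpace H] (γ : ℝ → H) :
    Prop where
  continuous : Continuous γ
  map_zero : γ 0 = 1
  map_add : ∀ s t, γ (s + t) = γ s * γ t

theorem IsOneParameterSubgroup.comp {H H' : Type*} [Monoid H] [TopologicalSpace H] [Monoid H']
    [TopologicalSpace H'] {γ : ℝ → H} (hγ : IsOneParameterSubgroup γ) {f : H →* H'}
    (hf : Continuous f) : IsOneParameterSubgroup (fun t => f (γ t)) where
  continuous := hf.comp hγ.continuous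
  map_zero := by rw [hγ.map_zero, map_one]
  map_add s t := by rw [hγ.map_add, map_mul]

theorem map_zero_of_map_add_eq_mul {H : Type*} [Group H] {g : ℝ → H}
    (hadd : ∀ s t, g (s + t) = g s * g t) : g 0 = 1 := by
  simpa using hadd 0 0

theorem map_neg_of_map_add_eq_mul {H : Type*} [Group H] {g : ℝ → H}
    (hadd : ∀ s t, g (s + t) = g s * g t) (t : ℝ) : g (-t) = (g t)⁻¹ := by
  rw [eq_inv_iff_mul_eq_one, ← hadd, neg_add_cancel, map_zero_of_map_add_eq_mul hadd]

variable {ι : Type*} {F : Filter ι} {ρ : ι → ℝ}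

theorem map_add_of_tendsto_zpow_floor {H : Type*} [Group H] [TopologicalSpace H]
    [IsTopologicalGroup H] [T2Space H] [F.NeBot] {x : ι → H} (hx : Tendsto x F (𝓝 1)) {g : ℝ → H}
    (hg : ∀ t, Tendsto (fun i => x i ^ ⌊t * ρ i⌋) F (𝓝 (g t))) (s t : ℝ) :
    g (s + t) = g s * g t := by
  let defect (i : ι) : ℤ := ⌊(s + t) * ρ i⌋ - ⌊s * ρ i⌋ - ⌊t * ρ i⌋
  have defect_eq (i : ι) : defect i = 0 ∨ defect i = 1 := by
    have hle := Int.le_floor_add (s * ρ i) (t * ρ i)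
    have hge := Int.le_floor_add_floor (s * ρ i) (t * ρ i)
    rw [← add_mul] at hle hge
    lia
  have tendsto_defect : Tendsto (fun i => x i ^ defect i) F (𝓝 1) := by
    rw [tendsto_iff_forall_eventually_mem]
    intro U hU
    filter_upwards [hx hU] with i hi
    rcases defect_eq i with h | h <;> rw [h]
    · simpa using mem_of_mem_nhds hU
    · simpa using hi
  have hlim := ((hg s).mul (hg t)).mul tendsto_defect
  rw [mul_one] at hlim
  refine tendsto_nhds_unique (hg (s + t)) (hlim.congr fun i => ?_)
  rw [← zpow_add, ← zpow_add]
  congr 1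
  ring

variable {E : Type*} [NormedAddCommGroup E]

theorem mem_source_of_tendsto_of_norm_le {X : Type*} [TopologicalSpace X] [T2Space X]
    [ProperSpace E] [F.NeBot] (φ : OpenPartialHomeomorph X E) {r : ℝ}
    (hr : Metric.closedBall 0 r ⊆ φ.target) {y : ι → X} {x : X} (hy : Tendsto y F (𝓝 x))
    (h : ∀ᶠ i in F, y i ∈ φ.source ∧ ‖φ (y i)‖ ≤ r) : x ∈ φ.source := by
  have hclosed : IsClosed (φ.symm '' Metric.closedBall 0 r) :=
    ((isCompact_closedBall (0 : E) r).image_of_continuousOn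
      (φ.symm.continuousOn.mono hr)).isClosed
  obtain ⟨u, hu, rfl⟩ := hclosed.mem_of_tendsto hy
    (h.mono fun i hi => ⟨φ (y i), by simpa using hi.2, φ.left_inv hi.1⟩)
  exact φ.map_target (hr hu)

variable [NormedSpace ℝ E]

theorem tendsto_natFloor_smul {u : ι → E} {v : E} (hρ : Tendsto ρ F atTop)
    (hv : Tendsto (fun i => ρ i • u i) F (𝓝 v)) {t : ℝ} (ht : 0 ≤ t) :
    Tendsto (fun i => ⌊t * ρ i⌋₊ • u i) F (𝓝 (t • v)) := by
  refine (((tendsto_nat_floor_mul_div_atTop ht).comp hρ).smul hv).congr' ?_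
  filter_upwards [hρ.eventually_gt_atTop 0] with i hi
  rw [Function.comp_apply, smul_smul, div_mul_cancel₀ _ hi.ne', Nat.cast_smul_eq_nsmul]

variable {G : Type*} [Group G] [TopologicalSpace G] [ChartedSpace E G] [LieGroup 𝓘(ℝ, E) ∞ G]
  {φ : OpenPartialHomeomorph G E}

theorem IsCenteredChart.isOneParameterSubgroup_of_hasDerivAt (hφ : IsCenteredChart φ)
    {g : ℝ → G} (hadd : ∀ s t, g (s + t) = g s * g t) (hsource : ∀ᶠ t in 𝓝 0, g t ∈ φ.source)
    {v : E} (hg : HasDerivAt (fun t => φ (g t)) v 0) : IsOneParameterSubgroup g := by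
  have : IsTopologicalGroup G := topologicalGroup_of_lieGroup 𝓘(ℝ, E) ∞
  have g_zero := map_zero_of_map_add_eq_mul hadd
  have tendsto_zero : Tendsto g (𝓝 0) (𝓝 1) := by
    have hφg : Tendsto (fun t => φ (g t)) (𝓝 0) (𝓝 0) := by
      simpa only [ContinuousAt, g_zero, hφ.map_one] using hg.continuousAt
    refine (hφ.tendsto_symm.comp hφg).congr' ?_
    filter_upwards [hsource] with t ht using φ.left_inv ht
  refine ⟨continuous_iff_continuousAt.2 fun t₀ => ?_, g_zero, hadd⟩
  have hlim : Tendsto (fun t => g t₀ * g (t - t₀)) (𝓝 t₀) (𝓝 (g t₀ * 1)) :=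
    (tendsto_zero.comp ((continuous_sub_right t₀).tendsto' _ _ (sub_self _))).const_mul _
  rw [mul_one] at hlim
  refine hlim.congr fun t => ?_
  rw [← hadd, add_sub_cancel]

namespace IsCenteredChart

variable {x : ι → G} {v : E} (hφ : IsCenteredChart φ) (hx : Tendsto x F (𝓝 1))
  (hv : Tendsto (fun i => ρ i • φ (x i)) F (𝓝 v))
include hφ hx hv

theorem tendsto_smul_inv : Tendsto (fun i => ρ i • φ (x i)⁻¹) F (𝓝 (-v)) := by
  have hinv : HasFDerivAt (fun u => φ (φ.symm u)⁻¹) (-ContinuousLinearMap.id ℝ E) 0 :=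
    hφ.hasFDerivAt_inv
  have hlim := hinv.hasFDerivWithinAt.lim (hφ.tendsto.comp hx)
    (Eventually.of_forall fun _ => mem_univ _) hv
  refine Tendsto.congr' ?_ hlim
  filter_upwards [hx hφ.source_mem_nhds] with i hi
  simp [hφ.symm_zero, hφ.map_one, φ.left_inv hi]

variable [ProperSpace E] [T2Space G] [F.NeBot] (hρ : Tendsto ρ F atTop)
include hρ

theorem eventually_norm_sub_le_of_tendsto_pow {ε : ℝ} (hε : 0 < ε) :
    ∀ᶠ t in 𝓝[≥] (0 : ℝ), ∀ g, Tendsto (fun i => x i ^ ⌊t * ρ i⌋₊) F (𝓝 g) →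
      g ∈ φ.source ∧ ‖φ g - t • v‖ ≤ ε * |t| := by
  obtain ⟨δ, hδ, r, -, hball, hpow⟩ :=
    hφ.exists_norm_pow_sub_le (ε := ε / (‖v‖ + 1)) (by positivity)
  have small : ∀ᶠ t in 𝓝 (0 : ℝ), t * ‖v‖ < δ :=
    ((continuous_mul_const ‖v‖).tendsto' 0 0 (zero_mul _)).eventually_lt_const hδ
  filter_upwards [self_mem_nhdsWithin, mem_nhdsWithin_of_mem_nhds small] with t ht htδ g hg
  rw [mem_Ici] at ht
  have hsmul := tendsto_natFloor_smul hρ hv ht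
  have hnorm : Tendsto (fun i => (⌊t * ρ i⌋₊ : ℝ) * ‖φ (x i)‖) F (𝓝 (t * ‖v‖)) := by
    simpa [← Nat.cast_smul_eq_nsmul ℝ, norm_smul, abs_of_nonneg ht] using hsmul.norm
  have hev := (hnorm.eventually_lt_const htδ).and (hx hφ.source_mem_nhds)
    |>.mono fun i hi => hpow (x i) hi.2 _ hi.1.le
  have hgs : g ∈ φ.source :=
    mem_source_of_tendsto_of_norm_le φ hball hg (hev.mono fun i hi => ⟨hi.1, hi.2.1⟩)
  refine ⟨hgs, ?_⟩
  calc ‖φ g - t • v‖ ≤ ε / (‖v‖ + 1) * (t * ‖v‖) :=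
        le_of_tendsto_of_tendsto (((φ.continuousAt hgs).tendsto.comp hg).sub hsmul).norm
          (hnorm.const_mul _) (hev.mono fun i hi => hi.2.2)
    _ ≤ ε / (‖v‖ + 1) * (t * (‖v‖ + 1)) := by gcongr; linarith
    _ = ε * |t| := by rw [abs_of_nonneg ht]; field_simp

theorem eventually_norm_sub_le_of_tendsto_zpow {g : ℝ → G}
    (hg : ∀ t, Tendsto (fun i => x i ^ ⌊t * ρ i⌋) F (𝓝 (g t))) {ε : ℝ} (hε : 0 < ε) :
    ∀ᶠ t in 𝓝 (0 : ℝ), g t ∈ φ.source ∧ ‖φ (g t) - t • v‖ ≤ ε * |t| := by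
  have : IsTopologicalGroup G := topologicalGroup_of_lieGroup 𝓘(ℝ, E) ∞
  have g_neg := map_neg_of_map_add_eq_mul (map_add_of_tendsto_zpow_floor hx hg)
  have tendsto_pow (t : ℝ) (ht : 0 ≤ t) :
      Tendsto (fun i => x i ^ ⌊t * ρ i⌋₊) F (𝓝 (g t)) := by
    refine (hg t).congr' ?_
    filter_upwards [hρ.eventually_ge_atTop 0] with i hi
    rw [← Int.natCast_floor_eq_floor (mul_nonneg ht hi), zpow_natCast]
  have hx_inv : Tendsto (fun i => (x i)⁻¹) F (𝓝 1) := by simpa using hx.inv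
  have hpos := hφ.eventually_norm_sub_le_of_tendsto_pow hx hv hρ hε
  have hneg := hφ.eventually_norm_sub_le_of_tendsto_pow hx_inv (hφ.tendsto_smul_inv hx hv) hρ hε
  have neg_maps : Tendsto Neg.neg (𝓝[≤] (0 : ℝ)) (𝓝[≥] 0) := by
    simpa using tendsto_neg_nhdsLE (a := (0 : ℝ))
  rw [← nhdsLE_sup_nhdsGE, eventually_sup]
  constructor
  · filter_upwards [neg_maps.eventually hneg, self_mem_nhdsWithin] with t h ht
    have hinv := (tendsto_pow (-t) (neg_nonneg.2 ht)).inv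
    rw [g_neg, inv_inv] at hinv
    simpa using h (g t) (by simpa using hinv)
  · filter_upwards [hpos, self_mem_nhdsWithin] with t h ht using h (g t) (tendsto_pow t ht)

/-- The one-parameter subgroup is `t ↦ lim (x i) ^ ⌊t * ρ i⌋` along an ultrafilter, which exists
by compactness. -/
theorem exists_isOneParameterSubgroup_of_tendsto [CompactSpace G] {L : Subgroup G}
    (hL : IsClosed (L : Set G)) (hxL : ∀ i, x i ∈ L) :
    ∃ γ : ℝ → L, IsOneParameterSubgroup γ ∧ HasDerivAt (fun t => φ (γ t)) v 0 := by
  have : IsTopologicalGroup G := topologicalGroup_of_lieGroup 𝓘(ℝ, E) ∞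
  let 𝒰 := Ultrafilter.of F
  have h𝒰 : (𝒰 : Filter ι) ≤ F := Ultrafilter.of_le F
  have tendsto_lim (t : ℝ) : ∃ g : G, Tendsto (fun i => x i ^ ⌊t * ρ i⌋) 𝒰 (𝓝 g) :=
    ⟨_, (𝒰.map fun i => x i ^ ⌊t * ρ i⌋).le_nhds_lim⟩
  choose g hg using tendsto_lim
  have mem_L (t : ℝ) : g t ∈ L :=
    hL.mem_of_tendsto (hg t) (Eventually.of_forall fun i => L.zpow_mem (hxL i) _)
  have hadd := map_add_of_tendsto_zpow_floor (hx.mono_left h𝒰) hg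
  have estimate (ε : ℝ) (hε : 0 < ε) :=
    hφ.eventually_norm_sub_le_of_tendsto_zpow (hx.mono_left h𝒰) (hv.mono_left h𝒰)
      (hρ.mono_left h𝒰) hg hε
  have hderiv : HasDerivAt (fun t => φ (g t)) v 0 := by
    rw [hasDerivAt_iff_isLittleO, Asymptotics.isLittleO_iff]
    intro ε hε
    filter_upwards [estimate ε hε] with t ht
    simpa [map_zero_of_map_add_eq_mul hadd, hφ.map_one] using ht.2
  have hγ := hφ.isOneParameterSubgroup_of_hasDerivAt hadd
    ((estimate 1 one_pos).mono fun t ht => ht.1) hderiv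
  exact ⟨fun t => ⟨g t, mem_L t⟩,
    ⟨hγ.continuous.subtype_mk _, Subtype.ext hγ.map_zero, fun s t => Subtype.ext (hadd s t)⟩,
    hderiv⟩

end IsCenteredChart

end OneParameterSubgroup

section OneParameterSubgroupSmooth

variable {E : Type*} [NormedAddCommGroup E] [NormedSpace ℝ E]

theorem contDiffOn_of_hasDerivAt_comp {f : ℝ → E} {X : E → E} {U : Set ℝ} {T : Set E}
    (hU : IsOpen U) (hX : ContDiffOn ℝ ∞ X T) (hmaps : MapsTo f U T)
    (hf : ∀ t ∈ U, HasDerivAt f (X (f t)) t) : ContDiffOn ℝ ∞ f U := by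
  refine contDiffOn_infty.2 fun n => ?_
  induction n with
  | zero => exact contDiffOn_zero.2 fun t ht => (hf t ht).continuousAt.continuousWithinAt
  | succ n ih =>
    rw [Nat.cast_succ, contDiffOn_succ_iff_deriv_of_isOpen hU]
    refine ⟨fun t ht => (hf t ht).differentiableAt.differentiableWithinAt, by simp, ?_⟩
    exact ((hX.of_le (by exact_mod_cast le_top)).comp ih hmaps).congr fun t ht => (hf t ht).deriv

section LieGroup

variable {G : Type*} [Group G] [TopologicalSpace G] [ChartedSpace E G]
  {φ : OpenPartialHomeomorph G E}

/-- The left-invariant vector field with value `v` at the identity, read in the centered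
chart `φ`. -/
noncomputable def leftInvariantField (φ : OpenPartialHomeomorph G E) (v u : E) : E :=
  fderiv ℝ (fun p : E × E => φ (φ.symm p.1 * φ.symm p.2)) (u, 0) (0, v)

variable [LieGroup 𝓘(ℝ, E) ∞ G]

theorem IsCenteredChart.contDiffAt_mul_zero (hφ : IsCenteredChart φ) {u : E} (hu : u ∈ φ.target) :
    ContDiffAt ℝ ∞ (fun p : E × E => φ (φ.symm p.1 * φ.symm p.2)) (u, 0) :=
  hφ.contDiffAt_mul hu hφ.zero_mem (by simpa [hφ.symm_zero] using φ.map_target hu)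

theorem IsCenteredChart.contDiffOn_leftInvariantField (hφ : IsCenteredChart φ) (v : E) :
    ContDiffOn ℝ ∞ (leftInvariantField φ v) φ.target := fun u hu =>
  ((((hφ.contDiffAt_mul_zero hu).fderiv_right (m := ∞) (by simp)).comp
    (f := fun u : E => (u, (0 : E))) u (contDiffAt_id.prodMk contDiffAt_const)).clm_apply
      contDiffAt_const).contDiffWithinAt

namespace IsOneParameterSubgroup

variable {γ : ℝ → G} (hγ : IsOneParameterSubgroup γ)
include hγ

theorem hasDerivAt_chart (hφ : IsCenteredChart φ) {v : E}
    (hv : HasDerivAt (fun t => φ (γ t)) v 0) {t : ℝ} (ht : γ t ∈ φ.source) :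
    HasDerivAt (fun t => φ (γ t)) (leftInvariantField φ v (φ (γ t))) t := by
  have hmul := ((hφ.contDiffAt_mul_zero (φ.map_source ht)).differentiableAt (by simp)).hasFDerivAt
  have hpair : HasDerivAt (fun s => (φ (γ t), φ (γ s))) (0, v) 0 :=
    (hasDerivAt_const (0 : ℝ) (φ (γ t))).prodMk hv
  have hzero : (φ (γ t), (0 : E)) = (φ (γ t), φ (γ 0)) := by rw [hγ.map_zero, hφ.map_one]
  rw [hzero] at hmul
  have hshift : HasDerivAt (fun s => φ (γ (t + s))) (leftInvariantField φ v (φ (γ t))) (t - t) := by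
    rw [sub_self, leftInvariantField, hzero]
    refine (hmul.comp_hasDerivAt (0 : ℝ) hpair).congr_of_eventuallyEq ?_
    have hsource : ∀ᶠ s in 𝓝 0, γ s ∈ φ.source :=
      hγ.continuous.continuousAt.preimage_mem_nhds (by rw [hγ.map_zero]; exact hφ.source_mem_nhds)
    filter_upwards [hsource] with s hs
    simp only [Function.comp_apply]
    rw [φ.left_inv ht, φ.left_inv hs, hγ.map_add]
  simpa using hshift.comp_sub_const t t

theorem contMDiff_of_contMDiffAt_zero (h : ContMDiffAt 𝓘(ℝ, ℝ) 𝓘(ℝ, E) ∞ γ 0) :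
    ContMDiff 𝓘(ℝ, ℝ) 𝓘(ℝ, E) ∞ γ := by
  intro t₀
  have hshift : ContMDiffAt 𝓘(ℝ, ℝ) 𝓘(ℝ, E) ∞ (fun t => γ (t - t₀)) t₀ :=
    ContMDiffAt.comp t₀ (g := γ) (by simpa using h)
      (contDiffAt_id.sub contDiffAt_const).contMDiffAt
  have hγ_eq : γ = fun t => γ t₀ * γ (t - t₀) := by
    funext t; rw [← hγ.map_add, add_sub_cancel]
  rw [hγ_eq]
  exact contMDiffAt_const.mul hshift

theorem contMDiff (hφ : IsCenteredChart φ) {v : E} (hv : HasDerivAt (fun t => φ (γ t)) v 0) :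
    ContMDiff 𝓘(ℝ, ℝ) 𝓘(ℝ, E) ∞ γ := by
  have hopen : IsOpen (γ ⁻¹' φ.source) := φ.open_source.preimage hγ.continuous
  have hzero : (0 : ℝ) ∈ γ ⁻¹' φ.source := by simp [hγ.map_zero, hφ.one_mem]
  have hchart : ContDiffOn ℝ ∞ (fun t => φ (γ t)) (γ ⁻¹' φ.source) :=
    contDiffOn_of_hasDerivAt_comp hopen (hφ.contDiffOn_leftInvariantField v)
      (fun t ht => φ.map_source ht) fun t ht => hγ.hasDerivAt_chart hφ hv ht
  refine hγ.contMDiff_of_contMDiffAt_zero (ContMDiffAt.congr_of_eventuallyEq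
    (hφ.contMDiffAt_symm_comp (hchart.contDiffAt (hopen.mem_nhds hzero)) (φ.map_source hzero)) ?_)
  filter_upwards [hopen.mem_nhds hzero] with t ht using (φ.left_inv ht).symm

end IsOneParameterSubgroup

end LieGroup

section BanachAlgebra

variable {A : Type*} [NormedRing A] [NormedAlgebra ℝ A] [CompleteSpace A]

theorem exists_isUnit_integral {h : ℝ → A} (hc : Continuous h) (hzero : h 0 = 1) :
    ∃ ε : ℝ, IsUnit (∫ s in (0 : ℝ)..ε, h s) := by
  have hslope := hasDerivAt_iff_tendsto_slope_zero.1 (hc.integral_hasStrictDerivAt 0 0).hasDerivAt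
  simp only [hzero, zero_add, intervalIntegral.integral_same, sub_zero] at hslope
  have hunit : ∀ᶠ t in 𝓝[≠] (0 : ℝ), IsUnit (t⁻¹ • ∫ s in (0 : ℝ)..t, h s) :=
    hslope (Units.isOpen.mem_nhds isUnit_one)
  obtain ⟨t, ht, ht0⟩ := (hunit.and self_mem_nhdsWithin).exists
  exact ⟨t, (isUnit_smul_iff (Units.mk0 t ht0)⁻¹ _).1 ht⟩

theorem IsOneParameterSubgroup.integral_sub_integral {h : ℝ → A} (hh : IsOneParameterSubgroup h)
    (t ε : ℝ) :
    (∫ s in (0 : ℝ)..(t + ε), h s) - ∫ s in (0 : ℝ)..t, h s = h t * ∫ s in (0 : ℝ)..ε, h s := by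
  calc (∫ s in (0 : ℝ)..(t + ε), h s) - ∫ s in (0 : ℝ)..t, h s
      = ∫ s in t..(t + ε), h s := intervalIntegral.integral_interval_sub_left
        (hh.continuous.intervalIntegrable _ _) (hh.continuous.intervalIntegrable _ _)
    _ = ∫ s in (0 : ℝ)..ε, h (t + s) := by
        rw [intervalIntegral.integral_comp_add_left (fun s => h s) t, add_zero]
    _ = ∫ s in (0 : ℝ)..ε, h t * h s := by simp_rw [hh.map_add]
    _ = h t * ∫ s in (0 : ℝ)..ε, h s :=
        (ContinuousLinearMap.mul ℝ A (h t)).intervalIntegral_comp_comm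
          (hh.continuous.intervalIntegrable _ _)

/-- With `J` the primitive of `h`, the identity `J (t + ε) - J t = h t * J ε` expresses `h` through
`J` as soon as `J ε` is invertible, so `h` is as smooth as its primitive. -/
theorem IsOneParameterSubgroup.contDiff {h : ℝ → A} (hh : IsOneParameterSubgroup h) :
    ContDiff ℝ ∞ h := by
  let J (t : ℝ) : A := ∫ s in (0 : ℝ)..t, h s
  have hJ (t : ℝ) : HasDerivAt J (h t) t :=
    (hh.continuous.integral_hasStrictDerivAt 0 t).hasDerivAt
  obtain ⟨ε, u, hu⟩ := exists_isUnit_integral hh.continuous hh.map_zero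
  have h_eq : h = fun t => (J (t + ε) - J t) * ↑u⁻¹ := by
    funext t
    rw [hh.integral_sub_integral, ← hu, Units.mul_inv_cancel_right]
  refine contDiff_infty.2 fun n => ?_
  induction n with
  | zero => exact contDiff_zero.2 hh.continuous
  | succ n ih =>
    have hJn : ContDiff ℝ (n + 1) J := by
      rw [contDiff_succ_iff_deriv]
      refine ⟨fun t => (hJ t).differentiableAt, by simp, ?_⟩
      rwa [funext fun t => (hJ t).deriv]
    rw [h_eq, Nat.cast_succ]
    exact ((hJn.comp (contDiff_id.add contDiff_const)).sub hJn).mul contDiff_const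

end BanachAlgebra

end OneParameterSubgroupSmooth

section CurveProd

/-- The ordered product `γ₀ (a₀) * ⋯ * γₗ₋₁ (aₗ₋₁)` of curves in a monoid. For one-parameter
subgroups of a Lie group these are the coordinates of the second kind. -/
def curveProd {H : Type*} [Monoid H] {l : ℕ} (γ : Fin l → ℝ → H) (a : Fin l → ℝ) : H :=
  (List.ofFn fun i => γ i (a i)).prod

section Monoid

variable {H : Type*} [Monoid H] {l : ℕ}

theorem curveProd_succ (γ : Fin (l + 1) → ℝ → H) (a : Fin (l + 1) → ℝ) :
    curveProd γ a = γ 0 (a 0) * curveProd (fun i => γ i.succ) (fun i => a i.succ) := by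
  simp [curveProd, List.ofFn_succ]

theorem curveProd_of_isEmpty (γ : Fin 0 → ℝ → H) : curveProd γ = fun _ => 1 :=
  funext fun _ => by simp [curveProd]

theorem map_curveProd {H' : Type*} [Monoid H'] (f : H →* H') (γ : Fin l → ℝ → H)
    (a : Fin l → ℝ) : f (curveProd γ a) = curveProd (fun i t => f (γ i t)) a := by
  simp [curveProd, map_list_prod, List.map_ofFn, Function.comp_def]

theorem curveProd_zero {γ : Fin l → ℝ → H} (hγ : ∀ i, γ i 0 = 1) : curveProd γ 0 = 1 := by
  simp [curveProd, hγ]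

theorem curveProd_single {γ : Fin l → ℝ → H} (hγ : ∀ i, γ i 0 = 1) (i : Fin l) (t : ℝ) :
    curveProd γ (Pi.single i t) = γ i t := by
  induction l with
  | zero => exact i.elim0
  | succ l ih =>
    rw [curveProd_succ]
    cases i using Fin.cases with
    | zero =>
      have tail : (fun j : Fin l => (Pi.single 0 t : Fin (l + 1) → ℝ) j.succ) = 0 := by
        ext j; simp
      rw [tail, curveProd_zero fun j => hγ j.succ, Pi.single_eq_same, mul_one]
    | succ j =>
      have tail : (fun k : Fin l => (Pi.single j.succ t : Fin (l + 1) → ℝ) k.succ) =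
          Pi.single j t := by
        ext k; simp [Pi.single_apply]
      rw [tail, ih fun j => hγ j.succ]
      simp [hγ]

end Monoid

theorem contDiff_curveProd {A : Type*} [NormedRing A] [NormedAlgebra ℝ A] {l : ℕ}
    {γ : Fin l → ℝ → A} (hγ : ∀ i, ContDiff ℝ ∞ (γ i)) : ContDiff ℝ ∞ (curveProd γ) := by
  induction l with
  | zero => rw [curveProd_of_isEmpty]; exact contDiff_const
  | succ l ih =>
    rw [funext (curveProd_succ γ)]
    refine ((hγ 0).comp (contDiff_apply ℝ ℝ 0)).mul ((ih fun i => hγ i.succ).comp ?_)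
    exact contDiff_pi.2 fun i => contDiff_apply ℝ ℝ i.succ

variable {E : Type*} [NormedAddCommGroup E] [NormedSpace ℝ E]
  {G : Type*} [Group G] [TopologicalSpace G] [ChartedSpace E G] [LieGroup 𝓘(ℝ, E) ∞ G]
  {l : ℕ} {γ : Fin l → ℝ → G}

theorem contMDiff_curveProd (hγ : ∀ i, ContMDiff 𝓘(ℝ, ℝ) 𝓘(ℝ, E) ∞ (γ i)) :
    ContMDiff 𝓘(ℝ, Fin l → ℝ) 𝓘(ℝ, E) ∞ (curveProd γ) := by
  induction l with
  | zero => rw [curveProd_of_isEmpty]; exact contMDiff_const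
  | succ l ih =>
    rw [funext (curveProd_succ γ)]
    refine ((hγ 0).comp (contDiff_apply ℝ ℝ 0).contMDiff).mul
      ((ih fun i => hγ i.succ).comp (ContDiff.contMDiff ?_))
    exact contDiff_pi.2 fun i => contDiff_apply ℝ ℝ i.succ

theorem IsCenteredChart.hasFDerivAt_curveProd {φ : OpenPartialHomeomorph G E}
    (hφ : IsCenteredChart φ) (hγ : ∀ i, IsOneParameterSubgroup (γ i)) {v : Fin l → E}
    (hv : ∀ i, HasDerivAt (fun t => φ (γ i t)) (v i) 0) :
    HasFDerivAt (fun a => φ (curveProd γ a))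
      (∑ i, (ContinuousLinearMap.proj (R := ℝ) (φ := fun _ : Fin l => ℝ) i).smulRight (v i)) 0 := by
  induction l with
  | zero =>
    simpa [curveProd_of_isEmpty] using hasFDerivAt_const (φ 1) (0 : Fin 0 → ℝ)
  | succ l ih =>
    rw [funext fun a => congrArg φ (curveProd_succ γ a)]
    let head : (Fin (l + 1) → ℝ) →L[ℝ] ℝ := ContinuousLinearMap.proj 0
    let tail : (Fin (l + 1) → ℝ) →L[ℝ] (Fin l → ℝ) :=
      ContinuousLinearMap.pi fun i => ContinuousLinearMap.proj i.succ
    have hhead : HasFDerivAt (fun a => φ (γ 0 (head a))) (head.smulRight (v 0)) 0 := by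
      refine (HasFDerivAt.comp (0 : Fin (l + 1) → ℝ) (hv 0).hasFDerivAt
        head.hasFDerivAt).congr_fderiv ?_
      ext; simp
    have htail := HasFDerivAt.comp (0 : Fin (l + 1) → ℝ) (f := tail)
      (by rw [map_zero]; exact ih (fun i => hγ i.succ) (fun i => hv i.succ)) tail.hasFDerivAt
    have htail_cont : Continuous (curveProd fun i => γ i.succ) :=
      (contMDiff_curveProd fun i => (hγ i.succ).contMDiff hφ (hv i.succ)).continuous
    refine (hφ.hasFDerivAt_mul (f := fun a => γ 0 (head a))
      (g := fun a => curveProd (fun i => γ i.succ) (tail a)) (hγ 0).map_zero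
      (curveProd_zero fun i => (hγ i.succ).map_zero)
      ((hγ 0).continuous.comp head.continuous).continuousAt
      (htail_cont.comp tail.continuous).continuousAt hhead htail).congr_fderiv ?_
    ext a
    simp [Fin.sum_univ_succ, head, tail]

end CurveProd

section SubgroupSlice

theorem exists_openPartialHomeomorph_of_hasFDerivAt_equiv {X E : Type*} [NormedAddCommGroup X]
    [NormedSpace ℝ X] [CompleteSpace X] [NormedAddCommGroup E] [NormedSpace ℝ E] {f : X → E}
    {e : X ≃L[ℝ] E} {x : X} (hf : ∀ᶠ y in 𝓝 x, ContDiffAt ℝ ∞ f y)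
    (he : HasFDerivAt f (e : X →L[ℝ] E) x) {S : Set X} (hS : S ∈ 𝓝 x) :
    ∃ T : OpenPartialHomeomorph X E, (∀ y, T y = f y) ∧ x ∈ T.source ∧ T.source ⊆ S ∧
      ContDiffOn ℝ ∞ T.symm T.target := by
  have hfx := hf.self_of_nhds
  have hequiv : ∀ᶠ y in 𝓝 x, fderiv ℝ f y ∈ range ((↑) : (X ≃L[ℝ] E) → X →L[ℝ] E) := by
    refine (hfx.fderiv_right (m := ∞) (by simp)).continuousAt.preimage_mem_nhds ?_
    rw [he.fderiv]
    exact ContinuousLinearEquiv.nhds e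
  obtain ⟨O, hO, hOo, hxO⟩ := eventually_nhds_iff.1 (hf.and (hequiv.and hS))
  let T := (hfx.toOpenPartialHomeomorph f he (by simp)).restrOpen O hOo
  have hsource : T.source ⊆ O := fun y hy => by
    rw [OpenPartialHomeomorph.restrOpen_source] at hy; exact hy.2
  have hxT : x ∈ T.source := by
    rw [OpenPartialHomeomorph.restrOpen_source]
    exact ⟨hfx.mem_toOpenPartialHomeomorph_source he (by simp), hxO⟩
  refine ⟨T, fun y => rfl, hxT, fun y hy => (hO y (hsource hy)).2.2, fun z hz => ?_⟩
  obtain ⟨hsmooth, ⟨e', he'⟩, -⟩ := hO _ (hsource (T.map_target hz))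
  refine (T.contDiffAt_symm (f₀' := e') hz ?_ hsmooth).contDiffWithinAt
  rw [he']
  exact (hsmooth.differentiableAt (by simp)).hasFDerivAt

variable {E : Type*} [NormedAddCommGroup E] [NormedSpace ℝ E]
  {G : Type*} [Group G] [TopologicalSpace G] [ChartedSpace E G]

theorem IsCenteredChart.exists_openPartialHomeomorph {φ : OpenPartialHomeomorph G E}
    (hφ : IsCenteredChart φ) {X : Type*} [NormedAddCommGroup X] [NormedSpace ℝ X] [CompleteSpace X]
    {f : X → G} {e : X ≃L[ℝ] E} {x : X} (hfx : f x = 1)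
    (hf : ∀ᶠ y in 𝓝 x, ContMDiffAt 𝓘(ℝ, X) 𝓘(ℝ, E) ∞ f y)
    (he : HasFDerivAt (fun y => φ (f y)) (e : X →L[ℝ] E) x) :
    ∃ Θ : OpenPartialHomeomorph X G, x ∈ Θ.source ∧ (∀ y ∈ Θ.source, Θ y = f y) ∧
      ContMDiffOn 𝓘(ℝ, X) 𝓘(ℝ, E) ∞ Θ Θ.source ∧
      ContMDiffOn 𝓘(ℝ, E) 𝓘(ℝ, X) ∞ Θ.symm Θ.target := by
  have hsource : ∀ᶠ y in 𝓝 x, f y ∈ φ.source :=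
    hf.self_of_nhds.continuousAt.preimage_mem_nhds (hfx ▸ hφ.source_mem_nhds)
  obtain ⟨T, hTf, hxT, hTS, hTsymm⟩ := exists_openPartialHomeomorph_of_hasFDerivAt_equiv
    (f := fun y => φ (f y)) ((hf.and hsource).mono fun y hy => hφ.contDiffAt_comp hy.1 hy.2) he
    (hf.and hsource)
  have hΘ : (T.trans φ.symm).source ⊆ T.source := fun y hy => by
    rw [OpenPartialHomeomorph.trans_source] at hy; exact hy.1
  have hΘf (y) (hy : y ∈ (T.trans φ.symm).source) : T.trans φ.symm y = f y := by
    rw [OpenPartialHomeomorph.coe_trans, Function.comp_apply, hTf, φ.left_inv (hTS (hΘ hy)).2]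
  refine ⟨T.trans φ.symm, ?_, hΘf, fun y hy => ?_, fun g hg => ?_⟩
  · rw [OpenPartialHomeomorph.trans_source]
    refine ⟨hxT, ?_⟩
    rw [mem_preimage, hTf]
    exact φ.map_source hsource.self_of_nhds
  · exact (hTS (hΘ hy)).1.contMDiffWithinAt.congr hΘf (hΘf y hy)
  · rw [OpenPartialHomeomorph.trans_target] at hg
    exact (((hTsymm.contDiffAt (T.open_target.mem_nhds hg.2)).contMDiffAt).comp g
      (hφ.contMDiffOn.contMDiffAt (φ.open_source.mem_nhds hg.1))).contMDiffWithinAt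

/-- A local cross-section of the projection `G → G ⧸ L`: a smooth local parametrization
`Θ (b, a) = σ b * (γ₁ a₁ ⋯ γₗ aₗ)` of the Lie group `G` near the identity, with one-parameter
subgroups `γᵢ` of `L`, such that `σ` meets each coset of `L` at most once over `B`. -/
structure SubgroupSlice (L : Subgroup G) (p l : ℕ) where
  σ : EuclideanSpace ℝ (Fin p) → G
  γ : Fin l → ℝ → L
  Θ : OpenPartialHomeomorph (EuclideanSpace ℝ (Fin p) × (Fin l → ℝ)) G
  B : Set (EuclideanSpace ℝ (Fin p))
  isOneParameterSubgroup : ∀ i, IsOneParameterSubgroup (γ i)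
  contMDiff_curveProd :
    ContMDiff 𝓘(ℝ, Fin l → ℝ) 𝓘(ℝ, E) ∞ fun a => ((curveProd γ a : L) : G)
  Θ_apply : ∀ x ∈ Θ.source, Θ x = σ x.1 * (curveProd γ x.2 : L)
  contMDiffOn_Θ : ContMDiffOn 𝓘(ℝ, EuclideanSpace ℝ (Fin p) × (Fin l → ℝ)) 𝓘(ℝ, E) ∞ Θ Θ.source
  contMDiffOn_Θ_symm :
    ContMDiffOn 𝓘(ℝ, E) 𝓘(ℝ, EuclideanSpace ℝ (Fin p) × (Fin l → ℝ)) ∞ Θ.symm Θ.target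
  isOpen_B : IsOpen B
  zero_mem_B : 0 ∈ B
  mem_source : ∀ b ∈ B, (b, 0) ∈ Θ.source
  σ_zero : σ 0 = 1
  eq_of_mem : ∀ b ∈ B, ∀ b' ∈ B, (σ b)⁻¹ * σ b' ∈ L → b = b'

variable [LieGroup 𝓘(ℝ, E) ∞ G] {φ : OpenPartialHomeomorph G E}

namespace IsCenteredChart

variable (hφ : IsCenteredChart φ)
include hφ

theorem isLittleO_inv_mul_sub {ι : Type*} {F : Filter ι} {y z : ι → E} (hy : Tendsto y F (𝓝 0))
    (hz : Tendsto z F (𝓝 0)) :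
    (fun i => φ ((φ.symm (y i))⁻¹ * φ.symm (z i)) - (z i - y i)) =o[F] fun i => z i - y i := by
  have hpair : Tendsto (fun i => ((y i, z i), (y i, y i))) F (𝓝 ((0 : E × E), (0 : E × E))) :=
    (hy.prodMk_nhds hz).prodMk_nhds (hy.prodMk_nhds hy)
  refine ((hφ.hasStrictFDerivAt_inv_mul.isLittleO.comp_tendsto hpair).congr_left
    fun i => ?_).trans_isBigO ?_
  · simp [hφ.map_one]
  · exact Asymptotics.IsBigO.of_bound 1 (Eventually.of_forall fun i => by simp [Prod.norm_def])

theorem exists_openPartialHomeomorph_mul_curveProd {P : Type*} [NormedAddCommGroup P]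
    [NormedSpace ℝ P] [CompleteSpace P] (ι : P →L[ℝ] E) {l : ℕ} {γ : Fin l → ℝ → G}
    (hγ : ∀ i, IsOneParameterSubgroup (γ i)) {v : Fin l → E}
    (hv : ∀ i, HasDerivAt (fun t => φ (γ i t)) (v i) 0) (e : (P × (Fin l → ℝ)) ≃L[ℝ] E)
    (he : ∀ x, e x = ι x.1 + ∑ i, x.2 i • v i) :
    ∃ Θ : OpenPartialHomeomorph (P × (Fin l → ℝ)) G, 0 ∈ Θ.source ∧
      (∀ x ∈ Θ.source, Θ x = φ.symm (ι x.1) * curveProd γ x.2) ∧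
      ContMDiffOn 𝓘(ℝ, P × (Fin l → ℝ)) 𝓘(ℝ, E) ∞ Θ Θ.source ∧
      ContMDiffOn 𝓘(ℝ, E) 𝓘(ℝ, P × (Fin l → ℝ)) ∞ Θ.symm Θ.target := by
  have hcurve := contMDiff_curveProd fun i => (hγ i).contMDiff hφ (hv i)
  have hone : curveProd γ 0 = 1 := curveProd_zero fun i => (hγ i).map_zero
  have htarget : ∀ᶠ x : P × (Fin l → ℝ) in 𝓝 0, ι x.1 ∈ φ.target :=
    (ι.continuous.comp continuous_fst).continuousAt.preimage_mem_nhds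
      (φ.open_target.mem_nhds (by simpa using hφ.zero_mem))
  have hfst (x : P × (Fin l → ℝ)) (hx : ι x.1 ∈ φ.target) :
      ContMDiffAt 𝓘(ℝ, P × (Fin l → ℝ)) 𝓘(ℝ, E) ∞ (fun x => φ.symm (ι x.1)) x :=
    hφ.contMDiffAt_symm_comp (ι.contDiff.contDiffAt.comp x contDiffAt_fst) hx
  refine hφ.exists_openPartialHomeomorph (e := e) (by simp [hφ.symm_zero, hone])
    (htarget.mono fun x hx => (hfst x hx).mul
      (hcurve.contMDiffAt.comp x contDiffAt_snd.contMDiffAt)) ?_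
  refine (hφ.hasFDerivAt_mul (f := fun x : P × (Fin l → ℝ) => φ.symm (ι x.1))
    (g := fun x => curveProd γ x.2) (f' := ι ∘L ContinuousLinearMap.fst ℝ _ _)
    (by simp [hφ.symm_zero]) hone (hfst 0 htarget.self_of_nhds).continuousAt
    (hcurve.continuous.comp continuous_snd).continuousAt ?_ (HasFDerivAt.comp
      (0 : P × (Fin l → ℝ)) (f := Prod.snd) (g := fun a => φ (curveProd γ a))
      (hφ.hasFDerivAt_curveProd hγ hv) hasFDerivAt_snd)).congr_fderiv ?_
  · refine (ContinuousLinearMap.hasFDerivAt _).congr_of_eventuallyEq ?_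
    filter_upwards [htarget] with x hx
    simp [φ.right_inv hx]
  · refine ContinuousLinearMap.ext fun x => ?_
    simp [he]

variable [ProperSpace E] [CompactSpace G] [T2Space G] {L : Subgroup G}

theorem exists_isOneParameterSubgroup_add (hL : IsClosed (L : Set G)) {γ γ' : ℝ → L} {v v' : E}
    (hγ : IsOneParameterSubgroup γ) (hγ' : IsOneParameterSubgroup γ')
    (hv : HasDerivAt (fun t => φ (γ t)) v 0) (hv' : HasDerivAt (fun t => φ (γ' t)) v' 0) :
    ∃ γ'' : ℝ → L, IsOneParameterSubgroup γ'' ∧ HasDerivAt (fun t => φ (γ'' t)) (v + v') 0 := by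
  have : IsTopologicalGroup G := topologicalGroup_of_lieGroup 𝓘(ℝ, E) ∞
  have hc := continuous_subtype_val.comp hγ.continuous
  have hc' := continuous_subtype_val.comp hγ'.continuous
  have hprod : HasDerivAt (fun t => φ (γ t * γ' t : G)) (v + v') 0 := by
    simpa using (hφ.hasFDerivAt_mul (f := fun t => (γ t : G)) (g := fun t => (γ' t : G))
      (x := (0 : ℝ)) (by simp [hγ.map_zero]) (by simp [hγ'.map_zero]) hc.continuousAt
      hc'.continuousAt hv.hasFDerivAt hv'.hasFDerivAt).hasDerivAt
  have hρ : Tendsto (fun n : ℕ => (n : ℝ) + 1) atTop atTop :=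
    tendsto_atTop_add_const_right _ _ tendsto_natCast_atTop_atTop
  have hinv : Tendsto (fun n : ℕ => ((n : ℝ) + 1)⁻¹) atTop (𝓝[≠] 0) :=
    tendsto_nhdsWithin_iff.2 ⟨hρ.inv_tendsto_atTop,
      Eventually.of_forall fun n => inv_ne_zero n.cast_add_one_ne_zero⟩
  refine hφ.exists_isOneParameterSubgroup_of_tendsto
    (x := fun n : ℕ => (γ ((n : ℝ) + 1)⁻¹ * γ' ((n : ℝ) + 1)⁻¹ : G)) ?_ ?_ hρ hL
    (fun n => L.mul_mem (γ _).2 (γ' _).2)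
  · have hlim : Tendsto (fun t => (γ t * γ' t : G)) (𝓝 0) (𝓝 1) :=
      (hc.mul hc').tendsto' 0 1 (by simp [hγ.map_zero, hγ'.map_zero])
    exact hlim.comp hρ.inv_tendsto_atTop
  · simpa [Function.comp_def, hγ.map_zero, hγ'.map_zero, hφ.map_one] using
      (hasDerivAt_iff_tendsto_slope_zero.1 hprod).comp hinv

/-- The Lie algebra of a closed subgroup, read in a centered chart: the velocities at `0` of its
one-parameter subgroups. -/
def tangentSubmodule (hL : IsClosed (L : Set G)) : Submodule ℝ E where
  carrier := {v | ∃ γ : ℝ → L, IsOneParameterSubgroup γ ∧ HasDerivAt (fun t => φ (γ t)) v 0}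
  zero_mem' := ⟨fun _ => 1, ⟨continuous_const, rfl, by simp⟩, by
    simpa using hasDerivAt_const (0 : ℝ) (φ 1)⟩
  add_mem' := fun ⟨_, hγ, hv⟩ ⟨_, hγ', hv'⟩ =>
    hφ.exists_isOneParameterSubgroup_add hL hγ hγ' hv hv'
  smul_mem' := by
    rintro c v ⟨γ, hγ, hv⟩
    refine ⟨fun t => γ (c * t), ⟨hγ.continuous.comp (continuous_const_mul c),
      by rw [mul_zero, hγ.map_zero], fun s t => by rw [mul_add, hγ.map_add]⟩, ?_⟩
    have hscale : HasDerivAt (fun t : ℝ => c * t) c 0 := by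
      simpa using (hasDerivAt_id (0 : ℝ)).const_mul c
    exact HasDerivAt.scomp (0 : ℝ) (h := fun t : ℝ => c * t) (by simpa using hv) hscale

theorem eventually_eq_of_inv_mul_mem (hL : IsClosed (L : Set G)) {P : Type*}
    [NormedAddCommGroup P] [NormedSpace ℝ P] [ProperSpace P] (ι : P →L[ℝ] E)
    (hι : ∀ u, ι u ∈ hφ.tangentSubmodule hL → u = 0) :
    ∀ᶠ q : P × P in 𝓝 0, (φ.symm (ι q.1))⁻¹ * φ.symm (ι q.2) ∈ L → q.1 = q.2 := by
  have : IsTopologicalGroup G := topologicalGroup_of_lieGroup 𝓘(ℝ, E) ∞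
  by_contra hcon
  obtain ⟨q, hq, hqL⟩ := exists_seq_forall_of_frequently (not_eventually.1 hcon)
  simp only [Classical.not_imp] at hqL
  let d (n : ℕ) : P := (q n).2 - (q n).1
  have hd (n : ℕ) : d n ≠ 0 := sub_ne_zero.2 (Ne.symm (hqL n).2)
  obtain ⟨u, hu, hlim⟩ := (isCompact_sphere (0 : P) 1).ultrafilter_le_nhds'
    ((hyperfilter ℕ).map fun n => ‖d n‖⁻¹ • d n)
    (mem_map.2 (univ_mem' fun n => by simp [norm_smul, hd n]))
  replace hq : Tendsto q (hyperfilter ℕ) (𝓝 0) := hq.mono_left Nat.hyperfilter_le_atTop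
  have hq₁ : Tendsto (fun n => (q n).1) (hyperfilter ℕ) (𝓝 0) := hq.fst_nhds
  have hq₂ : Tendsto (fun n => (q n).2) (hyperfilter ℕ) (𝓝 0) := hq.snd_nhds
  have hι₁ : Tendsto (fun n => ι (q n).1) (hyperfilter ℕ) (𝓝 0) :=
    (ι.continuous.tendsto' 0 0 ι.map_zero).comp hq₁
  have hι₂ : Tendsto (fun n => ι (q n).2) (hyperfilter ℕ) (𝓝 0) :=
    (ι.continuous.tendsto' 0 0 ι.map_zero).comp hq₂
  have hρ : Tendsto (fun n => ‖d n‖⁻¹) (hyperfilter ℕ) atTop :=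
    (tendsto_nhdsWithin_iff.2 ⟨by simpa using (hq₂.sub hq₁).norm,
      Eventually.of_forall fun n => norm_pos_iff.2 (hd n)⟩).inv_tendsto_nhdsGT_zero
  have hx : Tendsto (fun n => (φ.symm (ι (q n).1))⁻¹ * φ.symm (ι (q n).2)) (hyperfilter ℕ)
      (𝓝 1) := by
    simpa using ((hφ.tendsto_symm.comp hι₁).inv).mul (hφ.tendsto_symm.comp hι₂)
  have herr := ((hφ.isLittleO_inv_mul_sub hι₁ hι₂).trans_isBigO <| by
    simpa only [← map_sub] using ι.isBigO_comp d _).norm_right.tendsto_inv_smul_nhds_zero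
  have hmain : Tendsto (fun n => ‖d n‖⁻¹ • ι (d n)) (hyperfilter ℕ) (𝓝 (ι u)) := by
    simpa [Function.comp_def] using (ι.continuous.tendsto u).comp hlim
  have hv := herr.add hmain
  obtain rfl : u = 0 := hι u (hφ.exists_isOneParameterSubgroup_of_tendsto hx
    (by simpa [d, ← smul_add] using hv) hρ hL fun n => (hqL n).1)
  simp at hu

theorem exists_isOpen_eq_of_inv_mul_mem (hL : IsClosed (L : Set G)) {P : Type*}
    [NormedAddCommGroup P] [NormedSpace ℝ P] [ProperSpace P] (ι : P →L[ℝ] E)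
    (hι : ∀ u, ι u ∈ hφ.tangentSubmodule hL → u = 0) {S : Set P} (hS : S ∈ 𝓝 0) :
    ∃ B ⊆ S, IsOpen B ∧ 0 ∈ B ∧
      ∀ b ∈ B, ∀ b' ∈ B, (φ.symm (ι b))⁻¹ * φ.symm (ι b') ∈ L → b = b' := by
  have hinj := hφ.eventually_eq_of_inv_mul_mem hL ι hι
  rw [← Prod.mk_zero_zero, nhds_prod_eq] at hinj
  obtain ⟨B', hB', hB'inj⟩ := eventually_prod_self_iff'.1 hinj
  obtain ⟨B, hB, hBo, h0B⟩ := mem_nhds_iff.1 (Filter.inter_mem hB' hS)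
  exact ⟨B, fun b hb => (hB hb).2, hBo, h0B,
    fun b hb b' hb' => hB'inj _ (hB hb).1 _ (hB hb').1⟩

end IsCenteredChart

theorem exists_subgroupSlice [FiniteDimensional ℝ E] [CompactSpace G] [T2Space G]
    {L : Subgroup G} (hL : IsClosed (L : Set G)) :
    ∃ p l : ℕ, Nonempty (SubgroupSlice (E := E) L p l) := by
  have : ProperSpace E := FiniteDimensional.proper ℝ E
  obtain ⟨φ, hφ⟩ := exists_isCenteredChart (G := G) (E := E)
  obtain ⟨Q, hQ⟩ := (hφ.tangentSubmodule hL).exists_isCompl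
  let eQ : EuclideanSpace ℝ (Fin (Module.finrank ℝ Q)) ≃L[ℝ] Q :=
    ContinuousLinearEquiv.ofFinrankEq (by simp)
  let ι := Q.subtypeL ∘L eQ.toContinuousLinearMap
  have hι (u) (hu : ι u ∈ hφ.tangentSubmodule hL) : u = 0 := by
    have := Submodule.disjoint_def.1 hQ.disjoint _ hu (eQ u).2
    simpa [ι] using this
  let basis := Module.finBasis ℝ (hφ.tangentSubmodule hL)
  choose γ hγ hγv using fun i => (basis i).2
  have hγG (i) : IsOneParameterSubgroup fun t => (γ i t : G) :=
    (hγ i).comp (f := L.subtype) continuous_subtype_val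
  have coe_curveProd (a) : ((curveProd γ a : L) : G) = curveProd (fun i t => (γ i t : G)) a :=
    map_curveProd L.subtype γ a
  obtain ⟨Θ, h0Θ, hΘ, hΘ_smooth, hΘ_symm⟩ :=
    hφ.exists_openPartialHomeomorph_mul_curveProd ι hγG hγv
      ((eQ.toLinearEquiv.prodCongr basis.equivFun.symm).trans
        (Submodule.prodEquivOfIsCompl Q _ hQ.symm)).toContinuousLinearEquiv
      (fun x => by simp [ι, Module.Basis.equivFun_symm_apply])
  simp_rw [← coe_curveProd] at hΘ
  obtain ⟨B, hB, hBo, h0B, hBinj⟩ := hφ.exists_isOpen_eq_of_inv_mul_mem hL ι hι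
    ((Continuous.prodMk_left 0).continuousAt.preimage_mem_nhds (Θ.open_source.mem_nhds h0Θ))
  refine ⟨Module.finrank ℝ Q, _, ⟨{
    σ := fun b => φ.symm (ι b)
    γ := γ
    Θ := Θ
    B := B
    isOneParameterSubgroup := hγ
    contMDiff_curveProd := ?_
    Θ_apply := hΘ
    contMDiffOn_Θ := hΘ_smooth
    contMDiffOn_Θ_symm := hΘ_symm
    isOpen_B := hBo
    zero_mem_B := h0B
    mem_source := fun b hb => hB hb
    σ_zero := by simp [hφ.symm_zero]
    eq_of_mem := hBinj }⟩⟩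
  simp_rw [coe_curveProd]
  exact contMDiff_curveProd fun i => (hγG i).contMDiff hφ (hγv i)

end SubgroupSlice

section SubmersionAtlas

variable {F : Type*} [NormedAddCommGroup F] [NormedSpace ℝ F] {HN : Type*} [TopologicalSpace HN]
  {J : ModelWithCorners ℝ F HN} {N : Type*} [TopologicalSpace N] [ChartedSpace HN N]

/-- Charts of a topological space `M`, together with a map `π : N → M` from a smooth manifold which
is a submersion in these charts: it is smooth and the inverse of each chart lifts to `N`. -/
structure SubmersionAtlas (J : ModelWithCorners ℝ F HN) (E : Type*) [NormedAddCommGroup E]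
    [NormedSpace ℝ E] {M : Type*} [TopologicalSpace M] (π : N → M) where
  chart : M → OpenPartialHomeomorph M E
  lift : M → E → N
  mem_source : ∀ x, x ∈ (chart x).source
  contMDiffOn_lift : ∀ x, ContMDiffOn 𝓘(ℝ, E) J ∞ (lift x) (chart x).target
  proj_lift : ∀ x, ∀ u ∈ (chart x).target, π (lift x u) = (chart x).symm u
  contMDiffOn_chart_proj : ∀ x, ContMDiffOn J 𝓘(ℝ, E) ∞ (fun y => chart x (π y))
    (π ⁻¹' (chart x).source)

namespace SubmersionAtlas

variable {E : Type*} [NormedAddCommGroup E] [NormedSpace ℝ E] {M : Type*} [TopologicalSpace M]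
  {π : N → M} (𝒜 : SubmersionAtlas J E π)

/-- The charted space structure given by the charts of a submersion atlas. -/
abbrev chartedSpace : ChartedSpace E M where
  atlas := range 𝒜.chart
  chartAt := 𝒜.chart
  mem_chart_source := 𝒜.mem_source
  chart_mem_atlas := mem_range_self

theorem isManifold : @IsManifold ℝ _ E _ _ E _ 𝓘(ℝ, E) ∞ M _ 𝒜.chartedSpace := by
  let _ := 𝒜.chartedSpace
  refine isManifold_of_contDiffOn 𝓘(ℝ, E) ∞ M ?_
  rintro _ _ ⟨x, rfl⟩ ⟨y, rfl⟩
  have hlift : ContMDiffOn 𝓘(ℝ, E) 𝓘(ℝ, E) ∞ (fun u => 𝒜.chart y (π (𝒜.lift x u)))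
      ((𝒜.chart x).symm.trans (𝒜.chart y)).source := by
    refine (𝒜.contMDiffOn_chart_proj y).comp ((𝒜.contMDiffOn_lift x).mono fun u hu => ?_)
      fun u hu => ?_
    · rw [OpenPartialHomeomorph.trans_source] at hu; exact hu.1
    · rw [OpenPartialHomeomorph.trans_source] at hu
      rw [mem_preimage, mem_preimage, 𝒜.proj_lift x u hu.1]
      exact hu.2
  have htransition : ContDiffOn ℝ ∞ (𝒜.chart y ∘ (𝒜.chart x).symm)
      ((𝒜.chart x).symm.trans (𝒜.chart y)).source := by
    refine (contMDiffOn_iff_contDiffOn.1 hlift).congr fun u hu => ?_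
    rw [OpenPartialHomeomorph.trans_source] at hu
    simp [𝒜.proj_lift x u hu.1]
  simpa using htransition

theorem contMDiff_proj [IsManifold J ∞ N] (hπ : Continuous π) :
    letI := 𝒜.chartedSpace
    ContMDiff J 𝓘(ℝ, E) ∞ π := by
  let _ := 𝒜.chartedSpace
  have := 𝒜.isManifold
  rw [contMDiff_iff_target]
  refine ⟨hπ, fun x => ?_⟩
  rw [extChartAt_source]
  exact 𝒜.contMDiffOn_chart_proj x

theorem exists_section (x : M) :
    letI := 𝒜.chartedSpace
    ∃ s : M → N, ContMDiffAt 𝓘(ℝ, E) J ∞ s x ∧ ∀ᶠ y in 𝓝 x, π (s y) = y := by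
  let _ := 𝒜.chartedSpace
  have := 𝒜.isManifold
  have hx := 𝒜.mem_source x
  refine ⟨fun y => 𝒜.lift x (𝒜.chart x y), ?_, ?_⟩
  · exact ((𝒜.contMDiffOn_lift x).contMDiffAt ((𝒜.chart x).open_target.mem_nhds
      ((𝒜.chart x).map_source hx))).comp x
      ((contMDiffOn_chart (x := x)).contMDiffAt ((𝒜.chart x).open_source.mem_nhds hx))
  · filter_upwards [(𝒜.chart x).open_source.mem_nhds hx] with y hy
    rw [𝒜.proj_lift x _ ((𝒜.chart x).map_source hy), (𝒜.chart x).left_inv hy]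

end SubmersionAtlas

end SubmersionAtlas

section Rank

variable {E₁ : Type*} [NormedAddCommGroup E₁] [NormedSpace ℝ E₁] {H₁ : Type*} [TopologicalSpace H₁]
  {I₁ : ModelWithCorners ℝ E₁ H₁} {X : Type*} [TopologicalSpace X] [ChartedSpace H₁ X]
  {E₂ : Type*} [NormedAddCommGroup E₂] [NormedSpace ℝ E₂] {H₂ : Type*} [TopologicalSpace H₂]
  {I₂ : ModelWithCorners ℝ E₂ H₂} {Y : Type*} [TopologicalSpace Y] [ChartedSpace H₂ Y]
  {E₃ : Type*} [NormedAddCommGroup E₃] [NormedSpace ℝ E₃] {H₃ : Type*} [TopologicalSpace H₃]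
  {I₃ : ModelWithCorners ℝ E₃ H₃} {Z : Type*} [TopologicalSpace Z] [ChartedSpace H₃ Z]
  {E₄ : Type*} [NormedAddCommGroup E₄] [NormedSpace ℝ E₄] {H₄ : Type*} [TopologicalSpace H₄]
  {I₄ : ModelWithCorners ℝ E₄ H₄} {T : Type*} [TopologicalSpace T] [ChartedSpace H₄ T]

theorem mfderiv_comp_eq_id_of_eventually {f : X → Y} {g : Y → X} {x : X}
    (hf : MDifferentiableAt I₁ I₂ f x) (hg : MDifferentiableAt I₂ I₁ g (f x))
    (h : ∀ᶠ y in 𝓝 x, g (f y) = y) (v : E₁) :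
    (mfderiv I₂ I₁ g (f x) : E₂ → E₁) ((mfderiv I₁ I₂ f x : E₁ → E₂) v) = v := by
  have hid : mfderiv I₁ I₁ (g ∘ f) x = mfderiv I₁ I₁ id x := Filter.EventuallyEq.mfderiv_eq h
  rw [mfderiv_comp x hg hf, mfderiv_id] at hid
  exact DFunLike.congr_fun hid v

theorem finrank_range_mfderiv_eq {c : X → Y} {f : Y → Z} {ψ : Z → T} {x : X} {y : Y} {z : Z}
    (hy : c x = y) (hz : f y = z)
    (hc : MDifferentiableAt I₁ I₂ c x) (hf : MDifferentiableAt I₂ I₃ f y)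
    (hψ : MDifferentiableAt I₃ I₄ ψ z)
    (hcs : Function.Surjective (mfderiv I₁ I₂ c x : E₁ → E₂))
    (hψi : Function.Injective (mfderiv I₃ I₄ ψ z : E₃ → E₄)) :
    Module.finrank ℝ (LinearMap.range (mfderiv I₂ I₃ f y : E₂ →L[ℝ] E₃).toLinearMap) =
      Module.finrank ℝ
        (LinearMap.range (mfderiv I₁ I₄ (fun w => ψ (f (c w))) x : E₁ →L[ℝ] E₄).toLinearMap) := by
  subst hy hz
  have chain_rule : (mfderiv I₁ I₄ (fun w => ψ (f (c w))) x : E₁ →L[ℝ] E₄) =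
      (mfderiv I₃ I₄ ψ (f (c x)) : E₃ →L[ℝ] E₄) ∘L ((mfderiv I₂ I₃ f (c x) : E₂ →L[ℝ] E₃) ∘L
        (mfderiv I₁ I₂ c x : E₁ →L[ℝ] E₂)) := by
    have hψfc := mfderiv_comp x (g := ψ) (f := f ∘ c) hψ (hf.comp x hc)
    rwa [mfderiv_comp x hf hc] at hψfc
  rw [chain_rule]
  change _ = Module.finrank ℝ (LinearMap.range
    ((mfderiv I₃ I₄ ψ (f (c x)) : E₃ →L[ℝ] E₄).toLinearMap ∘ₗ
      ((mfderiv I₂ I₃ f (c x) : E₂ →L[ℝ] E₃).toLinearMap ∘ₗ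
        (mfderiv I₁ I₂ c x : E₁ →L[ℝ] E₂).toLinearMap)))
  rw [LinearMap.range_comp, LinearMap.range_comp_of_range_eq_top _ (LinearMap.range_eq_top.2 hcs)]
  exact (LinearEquiv.finrank_eq (Submodule.equivMapOfInjective _ hψi _))

end Rank

section OrthogonalRep

/-- A continuous orthogonal representation of a topological group. -/
structure OrthogonalRep (H V : Type*) [Group H] [TopologicalSpace H] [NormedAddCommGroup V]
    [InnerProductSpace ℝ V] where
  toHom : H →* (V →L[ℝ] V)
  continuous : Continuous toHom
  norm_map : ∀ h x, ‖toHom h x‖ = ‖x‖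

namespace OrthogonalRep

variable {H V : Type*} [Group H] [TopologicalSpace H] [NormedAddCommGroup V]
  [InnerProductSpace ℝ V] (R : OrthogonalRep H V)

/-- The action of an orthogonal representation on the unit sphere `S(V)`. -/
def act (h : H) (s : Metric.sphere (0 : V) 1) : Metric.sphere (0 : V) 1 :=
  ⟨R.toHom h s, by simp [R.norm_map]⟩

@[simp] theorem coe_act (h : H) (s : Metric.sphere (0 : V) 1) : (R.act h s : V) = R.toHom h s := rfl

@[simp] theorem act_one (s : Metric.sphere (0 : V) 1) : R.act 1 s = s := by
  ext; simp

theorem act_mul (h h' : H) (s : Metric.sphere (0 : V) 1) :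
    R.act (h * h') s = R.act h (R.act h' s) := by
  ext; simp

@[simp] theorem act_inv_act (h : H) (s : Metric.sphere (0 : V) 1) :
    R.act h⁻¹ (R.act h s) = s := by
  rw [← act_mul, inv_mul_cancel, act_one]

@[simp] theorem act_act_inv (h : H) (s : Metric.sphere (0 : V) 1) :
    R.act h (R.act h⁻¹ s) = s := by
  rw [← act_mul, mul_inv_cancel, act_one]

theorem continuous_act : Continuous fun q : H × Metric.sphere (0 : V) 1 => R.act q.1 q.2 := by
  refine Continuous.subtype_mk ?_ _
  exact (R.continuous.comp continuous_fst).clm_apply (continuous_subtype_val.comp continuous_snd)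

/-- The restriction of a representation along a continuous homomorphism. -/
def comp {H' : Type*} [Group H'] [TopologicalSpace H'] (f : H' →* H) (hf : Continuous f) :
    OrthogonalRep H' V where
  toHom := R.toHom.comp f
  continuous := R.continuous.comp hf
  norm_map h x := R.norm_map (f h) x

end OrthogonalRep

end OrthogonalRep

section AssocSphere

variable {G : Type*} [Group G] {L : Subgroup G} [TopologicalSpace G]
  {V : Type*} [NormedAddCommGroup V] [InnerProductSpace ℝ V]

/-- The equivalence relation `(g * l, s) ∼ (g, l • s)` on `G × S(V)`, whose quotient is the
associated sphere bundle. -/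
def assocSetoid (R : OrthogonalRep L V) : Setoid (G × Metric.sphere (0 : V) 1) where
  r q q' := ∃ l : L, q.1 = q'.1 * l ∧ q'.2 = R.act l q.2
  iseqv :=
    { refl := fun q => ⟨1, by simp⟩
      symm := by
        rintro q q' ⟨l, h, h'⟩
        exact ⟨l⁻¹, by simp [h], by simp [h']⟩
      trans := by
        rintro q q' q'' ⟨l, h, h'⟩ ⟨k, j, j'⟩
        exact ⟨k * l, by simp [h, j, mul_assoc], by rw [j', h', R.act_mul]⟩ }

/-- The sphere bundle `G ×_L S(V)` over `G ⧸ L` associated with an orthogonal representation of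
`L`. -/
def AssocSphere (R : OrthogonalRep L V) : Type _ := Quotient (assocSetoid R)

namespace AssocSphere

variable (R : OrthogonalRep L V)

instance : TopologicalSpace (AssocSphere R) := inferInstanceAs (TopologicalSpace (Quotient _))

/-- The projection `G × S(V) → G ×_L S(V)`. -/
def mk (q : G × Metric.sphere (0 : V) 1) : AssocSphere R := Quotient.mk (assocSetoid R) q

variable {R}

theorem mk_eq_mk {q q' : G × Metric.sphere (0 : V) 1} :
    mk R q = mk R q' ↔ ∃ l : L, q.1 = q'.1 * l ∧ q'.2 = R.act l q.2 :=
  Quotient.eq (r := assocSetoid R)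

theorem mk_surjective : Function.Surjective (mk R) := Quotient.mk_surjective

theorem isQuotientMap_mk : IsQuotientMap (mk R) := isQuotientMap_quotient_mk'

theorem continuous_mk : Continuous (mk R) := isQuotientMap_mk.continuous

theorem mk_mul_left (g : G) (l : L) (s : Metric.sphere (0 : V) 1) :
    mk R (g * l, s) = mk R (g, R.act l s) := mk_eq_mk.2 ⟨l, rfl, rfl⟩

instance : MulAction G (AssocSphere R) where
  smul g := Quotient.map (fun q => (g * q.1, q.2)) (by
    rintro q q' ⟨l, h, h'⟩
    exact ⟨l, by simp [h, mul_assoc], h'⟩)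
  one_smul x := by
    obtain ⟨q, rfl⟩ := mk_surjective x
    exact congrArg (mk R) (Prod.ext (one_mul _) rfl)
  mul_smul g h x := by
    obtain ⟨q, rfl⟩ := mk_surjective x
    exact congrArg (mk R) (Prod.ext (mul_assoc _ _ _) rfl)

theorem smul_mk (g : G) (q : G × Metric.sphere (0 : V) 1) :
    g • mk R q = mk R (g * q.1, q.2) := rfl

variable [IsTopologicalGroup G]

theorem isOpenMap_mk : IsOpenMap (mk R) := by
  intro U hU
  rw [← isQuotientMap_mk.isOpen_preimage]
  have saturation : mk R ⁻¹' (mk R '' U) =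
      ⋃ l : L, (fun q : G × Metric.sphere (0 : V) 1 => (q.1 * (l : G), R.act l⁻¹ q.2)) ⁻¹' U := by
    ext q
    simp only [mem_preimage, mem_image, mem_iUnion]
    constructor
    · rintro ⟨q', hq', h⟩
      obtain ⟨l, hfst, hsnd⟩ := mk_eq_mk.1 h
      refine ⟨l, ?_⟩
      rwa [← hfst, hsnd, R.act_inv_act]
    · rintro ⟨l, hl⟩
      exact ⟨_, hl, by rw [mk_mul_left, R.act_act_inv]⟩
  rw [saturation]
  refine isOpen_iUnion fun l => hU.preimage ?_
  refine (continuous_fst.mul continuous_const).prodMk ?_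
  exact R.continuous_act.comp (continuous_const.prodMk continuous_snd)

instance [CompactSpace G] [FiniteDimensional ℝ V] : CompactSpace (AssocSphere R) := by
  have : ProperSpace V := FiniteDimensional.proper ℝ V
  exact inferInstanceAs (CompactSpace (Quotient _))

theorem t2Space [CompactSpace G] [T2Space G] [FiniteDimensional ℝ V] (hL : IsClosed (L : Set G)) :
    T2Space (AssocSphere R) := by
  have : ProperSpace V := FiniteDimensional.proper ℝ V
  have : CompactSpace L := isCompact_iff_compactSpace.1 hL.isCompact
  rw [t2Space_iff_of_isOpenQuotientMap ⟨mk_surjective, continuous_mk, isOpenMap_mk⟩]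
  have graph_eq_range : {q : (G × Metric.sphere (0 : V) 1) × (G × Metric.sphere (0 : V) 1) |
      mk R q.1 = mk R q.2} = range fun x : L × G × Metric.sphere (0 : V) 1 =>
        ((x.2.1 * (x.1 : G), x.2.2), (x.2.1, R.act x.1 x.2.2)) := by
    ext ⟨q, q'⟩
    simp only [mem_ofPred_eq, mem_range, mk_eq_mk]
    constructor
    · rintro ⟨l, h, h'⟩
      exact ⟨(l, q'.1, q.2), by rw [← h, ← h']⟩
    · rintro ⟨⟨l, g, s⟩, h⟩
      cases h
      exact ⟨l, rfl, rfl⟩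
  rw [graph_eq_range]
  refine (isCompact_range ?_).isClosed
  refine Continuous.prodMk (Continuous.prodMk ?_ ?_) (Continuous.prodMk ?_ ?_)
  · exact (continuous_fst.comp continuous_snd).mul (continuous_subtype_val.comp continuous_fst)
  · exact continuous_snd.comp continuous_snd
  · exact continuous_fst.comp continuous_snd
  · exact R.continuous_act.comp (continuous_fst.prodMk (continuous_snd.comp continuous_snd))

end AssocSphere

end AssocSphere

theorem nonempty_sphere (V : Type*) [NormedAddCommGroup V] [InnerProductSpace ℝ V] (m : ℕ)
    [hm : Fact (Module.finrank ℝ V = m + 1)] : Nonempty (Metric.sphere (0 : V) 1) :=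
  haveI : Nontrivial V := Module.nontrivial_of_finrank_pos (R := ℝ) (by rw [hm.out]; omega)
  (NormedSpace.sphere_nonempty.2 zero_le_one).to_subtype

section ProdChart

variable {p m : ℕ} {X : Type*} [TopologicalSpace X] [ChartedSpace (EuclideanSpace ℝ (Fin m)) X]

/-- The preferred chart at `x` times the identity, as a chart of `ℝᵖ × X` with values in
`ℝᵖ⁺ᵐ`. -/
noncomputable def prodChart (x : X) :
    OpenPartialHomeomorph (EuclideanSpace ℝ (Fin p) × X) (EuclideanSpace ℝ (Fin (p + m))) :=
  ((OpenPartialHomeomorph.refl (EuclideanSpace ℝ (Fin p))).prod (chartAt _ x)).trans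
    (ContinuousLinearEquiv.ofFinrankEq (𝕜 := ℝ) (E := EuclideanSpace ℝ (Fin p) ×
      EuclideanSpace ℝ (Fin m)) (by simp)).toHomeomorph.toOpenPartialHomeomorph

variable [IsManifold (𝓡 m) ∞ X] (x : X)

theorem contMDiffOn_prodChart :
    ContMDiffOn (𝓘(ℝ, EuclideanSpace ℝ (Fin p)).prod (𝓡 m)) (𝓡 (p + m)) ∞
      (prodChart (p := p) (m := m) x) (prodChart (p := p) (m := m) x).source := by
  have hchart : ContMDiffOn (𝓡 m) (𝓡 m) ∞ (chartAt _ x) (chartAt _ x).source := contMDiffOn_chart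
  refine (ContinuousLinearEquiv.contDiff _).contMDiff.comp_contMDiffOn ?_
  rw [modelWithCornersSelf_prod, ← chartedSpaceSelf_prod]
  exact contMDiffOn_fst.prodMk (hchart.comp contMDiffOn_snd fun y hy => hy.1.2)

theorem contMDiffOn_prodChart_symm :
    ContMDiffOn (𝓡 (p + m)) (𝓘(ℝ, EuclideanSpace ℝ (Fin p)).prod (𝓡 m)) ∞
      (prodChart (p := p) (m := m) x).symm (prodChart (p := p) (m := m) x).target := by
  have hchart : ContMDiffOn (𝓡 m) (𝓡 m) ∞ (chartAt _ x).symm (chartAt _ x).target :=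
    contMDiffOn_chart_symm
  let e : (EuclideanSpace ℝ (Fin p) × EuclideanSpace ℝ (Fin m)) ≃L[ℝ]
    EuclideanSpace ℝ (Fin (p + m)) := ContinuousLinearEquiv.ofFinrankEq (by simp)
  exact ((contDiff_fst (𝕜 := ℝ) (n := ∞)).contMDiff.contMDiffOn.prodMk
    (hchart.comp contDiff_snd.contMDiff.contMDiffOn fun y hy => hy.2)).comp
    e.symm.contDiff.contMDiff.contMDiffOn fun u hu => hu.2

end ProdChart

section Charts

variable {E : Type*} [NormedAddCommGroup E] [NormedSpace ℝ E]
  {G : Type*} [Group G] [TopologicalSpace G] [ChartedSpace E G]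
  {L : Subgroup G} {V : Type*} [NormedAddCommGroup V] [InnerProductSpace ℝ V]
  {p l m : ℕ}

namespace SubgroupSlice

variable (𝒮 : SubgroupSlice (E := E) L p l)

theorem Θ_zero_right {b : EuclideanSpace ℝ (Fin p)} (hb : b ∈ 𝒮.B) : 𝒮.Θ (b, 0) = 𝒮.σ b := by
  rw [𝒮.Θ_apply _ (𝒮.mem_source b hb)]
  simp [curveProd_zero fun i => (𝒮.isOneParameterSubgroup i).map_zero]

theorem Θ_symm_σ {b : EuclideanSpace ℝ (Fin p)} (hb : b ∈ 𝒮.B) : 𝒮.Θ.symm (𝒮.σ b) = (b, 0) := by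
  rw [← 𝒮.Θ_zero_right hb, 𝒮.Θ.left_inv (𝒮.mem_source b hb)]

theorem σ_mem_target {b : EuclideanSpace ℝ (Fin p)} (hb : b ∈ 𝒮.B) : 𝒮.σ b ∈ 𝒮.Θ.target := by
  rw [← 𝒮.Θ_zero_right hb]
  exact 𝒮.Θ.map_source (𝒮.mem_source b hb)

theorem contMDiffOn_σ :
    ContMDiffOn 𝓘(ℝ, EuclideanSpace ℝ (Fin p)) 𝓘(ℝ, E) ∞ 𝒮.σ 𝒮.B := by
  have h : ContMDiff 𝓘(ℝ, EuclideanSpace ℝ (Fin p))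
      𝓘(ℝ, EuclideanSpace ℝ (Fin p) × (Fin l → ℝ)) ∞
      (fun b : EuclideanSpace ℝ (Fin p) => (b, (0 : Fin l → ℝ))) :=
    (contDiff_id.prodMk contDiff_const).contMDiff
  exact (𝒮.contMDiffOn_Θ.comp h.contMDiffOn 𝒮.mem_source).congr
    fun b hb => (𝒮.Θ_zero_right hb).symm

theorem contDiff_rep [FiniteDimensional ℝ V] (R : OrthogonalRep L V) :
    ContDiff ℝ ∞ fun a => R.toHom (curveProd 𝒮.γ a) := by
  have : CompleteSpace V := FiniteDimensional.complete ℝ V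
  rw [funext fun a => map_curveProd R.toHom 𝒮.γ a]
  exact contDiff_curveProd fun i => ((𝒮.isOneParameterSubgroup i).comp R.continuous).contDiff

theorem contMDiff_act [Fact (Module.finrank ℝ V = m + 1)] (R : OrthogonalRep L V) (k : L) :
    ContMDiff (𝓘(ℝ, Fin l → ℝ).prod (𝓡 m)) (𝓡 m) ∞
      fun q : (Fin l → ℝ) × Metric.sphere (0 : V) 1 => R.act (curveProd 𝒮.γ q.1 * k) q.2 := by
  have : FiniteDimensional ℝ V := .of_fact_finrank_eq_succ m
  refine ContMDiff.codRestrict_sphere (f := fun q : (Fin l → ℝ) × Metric.sphere (0 : V) 1 =>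
    R.toHom (curveProd 𝒮.γ q.1 * k) q.2) ?_ _
  have hγ : ContMDiff (𝓘(ℝ, Fin l → ℝ).prod (𝓡 m)) 𝓘(ℝ, V →L[ℝ] V) ∞
      fun q : (Fin l → ℝ) × Metric.sphere (0 : V) 1 => R.toHom (curveProd 𝒮.γ q.1) :=
    (𝒮.contDiff_rep R).contMDiff.comp contMDiff_fst
  have hk : ContMDiff (𝓘(ℝ, Fin l → ℝ).prod (𝓡 m)) 𝓘(ℝ, V) ∞
      fun q : (Fin l → ℝ) × Metric.sphere (0 : V) 1 => R.toHom k q.2 :=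
    (R.toHom k).contDiff.contMDiff.comp (contMDiff_coe_sphere.comp contMDiff_snd)
  simpa using hγ.clm_apply hk

variable (R : OrthogonalRep L V)

/-- The local parametrization `(b, s) ↦ [g₀ σ(b), s]` of `G ×_L S(V)`. -/
def param (g₀ : G) (y : EuclideanSpace ℝ (Fin p) × Metric.sphere (0 : V) 1) : AssocSphere R :=
  AssocSphere.mk R (g₀ * 𝒮.σ y.1, y.2)

/-- A local lift to the parameters of the projection `G × S(V) → G ×_L S(V)`. -/
def slide (g₀ : G) (k : L) (q : G × Metric.sphere (0 : V) 1) :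
    EuclideanSpace ℝ (Fin p) × Metric.sphere (0 : V) 1 :=
  ((𝒮.Θ.symm (g₀⁻¹ * q.1 * (k : G)⁻¹)).1,
    R.act (curveProd 𝒮.γ (𝒮.Θ.symm (g₀⁻¹ * q.1 * (k : G)⁻¹)).2 * k) q.2)

variable {R}

theorem param_slide {g₀ : G} {k : L} {q : G × Metric.sphere (0 : V) 1}
    (hq : g₀⁻¹ * q.1 * (k : G)⁻¹ ∈ 𝒮.Θ.target) :
    𝒮.param R g₀ (𝒮.slide R g₀ k q) = AssocSphere.mk R q := by
  symm
  refine AssocSphere.mk_eq_mk.2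
    ⟨curveProd 𝒮.γ (𝒮.Θ.symm (g₀⁻¹ * q.1 * (k : G)⁻¹)).2 * k, ?_, rfl⟩
  have hΘ := 𝒮.Θ_apply _ (𝒮.Θ.map_target hq)
  rw [𝒮.Θ.right_inv hq] at hΘ
  simp only [slide, Subgroup.coe_mul]
  rw [mul_assoc g₀, ← mul_assoc (𝒮.σ _), ← hΘ]
  group

theorem exists_slide_eq {g₀ : G} {q : G × Metric.sphere (0 : V) 1}
    {y : EuclideanSpace ℝ (Fin p) × Metric.sphere (0 : V) 1} (hy : y.1 ∈ 𝒮.B)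
    (hqy : AssocSphere.mk R q = 𝒮.param R g₀ y) :
    ∃ k : L, g₀⁻¹ * q.1 * (k : G)⁻¹ ∈ 𝒮.Θ.target ∧ 𝒮.slide R g₀ k q = y := by
  obtain ⟨k, hfst, hsnd⟩ := AssocSphere.mk_eq_mk.1 hqy
  simp only at hfst hsnd
  have hσ : g₀⁻¹ * q.1 * (k : G)⁻¹ = 𝒮.σ y.1 := by rw [hfst]; group
  refine ⟨k, by rw [hσ]; exact 𝒮.σ_mem_target hy, ?_⟩
  have hone : curveProd 𝒮.γ 0 = 1 := curveProd_zero fun i => (𝒮.isOneParameterSubgroup i).map_zero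
  rw [slide, hσ, 𝒮.Θ_symm_σ hy, hone, one_mul, ← hsnd]

theorem injOn_param (g₀ : G) : InjOn (𝒮.param R g₀) (𝒮.B ×ˢ univ) := by
  rintro ⟨b, s⟩ ⟨hb, -⟩ ⟨b', s'⟩ ⟨hb', -⟩ h
  obtain ⟨k, hfst, hsnd⟩ := AssocSphere.mk_eq_mk.1 h
  simp only at hfst hsnd hb hb'
  rw [mul_assoc, mul_right_inj] at hfst
  obtain rfl : b' = b := 𝒮.eq_of_mem b' hb' b hb (by rw [hfst]; simp)
  obtain rfl : k = 1 := by
    ext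
    simpa using hfst
  rw [hsnd, R.act_one]

variable [LieGroup 𝓘(ℝ, E) ∞ G]

omit [InnerProductSpace ℝ V] in
theorem isOpen_slide_domain (g₀ : G) (k : L) :
    IsOpen {q : G × Metric.sphere (0 : V) 1 | g₀⁻¹ * q.1 * (k : G)⁻¹ ∈ 𝒮.Θ.target} := by
  have : IsTopologicalGroup G := topologicalGroup_of_lieGroup 𝓘(ℝ, E) ∞
  exact 𝒮.Θ.open_target.preimage ((continuous_const.mul continuous_fst).mul continuous_const)

theorem contMDiffOn_slide [Fact (Module.finrank ℝ V = m + 1)] (g₀ : G) (k : L) :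
    ContMDiffOn (𝓘(ℝ, E).prod (𝓡 m)) (𝓘(ℝ, EuclideanSpace ℝ (Fin p)).prod (𝓡 m)) ∞
      (𝒮.slide R g₀ k) {q | g₀⁻¹ * q.1 * (k : G)⁻¹ ∈ 𝒮.Θ.target} := by
  have htranslate : ContMDiff (𝓘(ℝ, E).prod (𝓡 m)) 𝓘(ℝ, E) ∞
      fun q : G × Metric.sphere (0 : V) 1 => g₀⁻¹ * q.1 * (k : G)⁻¹ :=
    (contMDiff_const.mul contMDiff_fst).mul contMDiff_const
  have hΘ : ContMDiffOn (𝓘(ℝ, E).prod (𝓡 m))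
      𝓘(ℝ, EuclideanSpace ℝ (Fin p) × (Fin l → ℝ)) ∞
      (fun q : G × Metric.sphere (0 : V) 1 => 𝒮.Θ.symm (g₀⁻¹ * q.1 * (k : G)⁻¹))
      {q | g₀⁻¹ * q.1 * (k : G)⁻¹ ∈ 𝒮.Θ.target} :=
    𝒮.contMDiffOn_Θ_symm.comp htranslate.contMDiffOn fun q hq => hq
  have hbase := (contDiff_fst (𝕜 := ℝ) (E := EuclideanSpace ℝ (Fin p)) (F := Fin l → ℝ)
    (n := ∞)).contMDiff.comp_contMDiffOn hΘ
  have hfibre := (contDiff_snd (𝕜 := ℝ) (E := EuclideanSpace ℝ (Fin p)) (F := Fin l → ℝ)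
    (n := ∞)).contMDiff.comp_contMDiffOn hΘ
  exact hbase.prodMk ((𝒮.contMDiff_act R k).comp_contMDiffOn (hfibre.prodMk contMDiffOn_snd))

theorem continuousOn_param (g₀ : G) : ContinuousOn (𝒮.param R g₀) (𝒮.B ×ˢ univ) := by
  have : IsTopologicalGroup G := topologicalGroup_of_lieGroup 𝓘(ℝ, E) ∞
  refine AssocSphere.continuous_mk.comp_continuousOn (ContinuousOn.prodMk ?_ continuousOn_snd)
  exact continuousOn_const.mul (𝒮.contMDiffOn_σ.continuousOn.comp continuousOn_fst fun y hy => hy.1)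

theorem isOpenMap_param [Fact (Module.finrank ℝ V = m + 1)] (g₀ : G) :
    IsOpenMap ((𝒮.B ×ˢ univ).domRestrict (𝒮.param R g₀)) := by
  have : IsTopologicalGroup G := topologicalGroup_of_lieGroup 𝓘(ℝ, E) ∞
  intro O hO
  obtain ⟨A, hA, rfl⟩ := isOpen_induced_iff.1 hO
  rw [isOpen_iff_mem_nhds]
  rintro _ ⟨⟨y, hy⟩, hyA, rfl⟩
  obtain ⟨k, hk, hky⟩ := 𝒮.exists_slide_eq (R := R) (g₀ := g₀) (q := (g₀ * 𝒮.σ y.1, y.2)) hy.1 rfl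
  have hpreimage := (𝒮.contMDiffOn_slide (R := R) (m := m) g₀ k).continuousOn.isOpen_inter_preimage
    (𝒮.isOpen_slide_domain g₀ k) (hA.inter (𝒮.isOpen_B.prod isOpen_univ))
  refine mem_of_superset ((AssocSphere.isOpenMap_mk (R := R) _ hpreimage).mem_nhds
    (mem_image_of_mem _ ⟨hk, by rw [mem_preimage, hky]; exact ⟨hyA, hy⟩⟩)) ?_
  rintro _ ⟨q, ⟨hq, hqA, hqB⟩, rfl⟩
  exact ⟨⟨𝒮.slide R g₀ k q, hqB⟩, hqA, 𝒮.param_slide hq⟩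

/-- The local parametrization as a partial homeomorphism. -/
noncomputable def paramHomeo [Fact (Module.finrank ℝ V = m + 1)] (R : OrthogonalRep L V) (g₀ : G) :
    OpenPartialHomeomorph (EuclideanSpace ℝ (Fin p) × Metric.sphere (0 : V) 1) (AssocSphere R) :=
  haveI := nonempty_sphere V m
  OpenPartialHomeomorph.ofContinuousOpenRestrict
    ((𝒮.injOn_param (R := R) g₀).toPartialEquiv (𝒮.param R g₀) (𝒮.B ×ˢ univ))
    (𝒮.continuousOn_param g₀) (𝒮.isOpenMap_param (m := m) g₀) (𝒮.isOpen_B.prod isOpen_univ)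

variable (R) in
@[simp] theorem coe_paramHomeo [Fact (Module.finrank ℝ V = m + 1)] (g₀ : G) :
    ⇑(𝒮.paramHomeo (m := m) R g₀) = 𝒮.param R g₀ := rfl

variable (R) in
theorem mk_mem_paramHomeo_target [Fact (Module.finrank ℝ V = m + 1)] (g₀ : G)
    (s : Metric.sphere (0 : V) 1) :
    AssocSphere.mk R (g₀, s) ∈ (𝒮.paramHomeo (m := m) R g₀).target ∧
      (𝒮.paramHomeo (m := m) R g₀).symm (AssocSphere.mk R (g₀, s)) = (0, s) := by
  have hsource : ((0, s) : EuclideanSpace ℝ (Fin p) × Metric.sphere (0 : V) 1) ∈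
    (𝒮.paramHomeo (m := m) R g₀).source := ⟨𝒮.zero_mem_B, mem_univ _⟩
  have hvalue : 𝒮.paramHomeo (m := m) R g₀ (0, s) = AssocSphere.mk R (g₀, s) := by
    simp [param, 𝒮.σ_zero]
  rw [← hvalue]
  exact ⟨OpenPartialHomeomorph.map_source _ hsource, OpenPartialHomeomorph.left_inv _ hsource⟩

variable (R) in
theorem contMDiffOn_paramHomeo_symm_mk [Fact (Module.finrank ℝ V = m + 1)] (g₀ : G) :
    ContMDiffOn (𝓘(ℝ, E).prod (𝓡 m)) (𝓘(ℝ, EuclideanSpace ℝ (Fin p)).prod (𝓡 m)) ∞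
      (fun q => (𝒮.paramHomeo (m := m) R g₀).symm (AssocSphere.mk R q))
      (AssocSphere.mk R ⁻¹' (𝒮.paramHomeo (m := m) R g₀).target) := by
  intro q hq
  set Q := 𝒮.paramHomeo (m := m) R g₀
  have hsource : Q.symm (AssocSphere.mk R q) ∈ Q.source := Q.map_target hq
  obtain ⟨k, hk, hkq⟩ := 𝒮.exists_slide_eq (R := R) (g₀ := g₀) (q := q)
    (y := Q.symm (AssocSphere.mk R q)) hsource.1 (Q.right_inv hq).symm
  have hdomain := (𝒮.isOpen_slide_domain g₀ k).mem_nhds hk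
  have hslide := (𝒮.contMDiffOn_slide (R := R) (m := m) g₀ k).contMDiffAt hdomain
  refine (hslide.congr_of_eventuallyEq ?_).contMDiffWithinAt
  have hslide_source : 𝒮.slide R g₀ k ⁻¹' Q.source ∈ 𝓝 q :=
    hslide.continuousAt.preimage_mem_nhds (Q.open_source.mem_nhds (by rwa [hkq]))
  filter_upwards [hslide_source, hdomain] with q' hq'_source hq'_domain
  rw [← 𝒮.param_slide hq'_domain]
  exact Q.left_inv hq'_source

/-- The charts of `G ×_L S(V)` obtained from the local parametrizations; their lifts to `G × S(V)`
are the maps `(b, s) ↦ (g₀ σ(b), s)`. -/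
noncomputable def atlas [Fact (Module.finrank ℝ V = m + 1)] (R : OrthogonalRep L V) :
    SubmersionAtlas (𝓘(ℝ, E).prod (𝓡 m)) (EuclideanSpace ℝ (Fin (p + m)))
      (AssocSphere.mk R) where
  chart x := (𝒮.paramHomeo (m := m) R (Quotient.out x).1).symm.trans (prodChart (Quotient.out x).2)
  lift x u := ((Quotient.out x).1 * 𝒮.σ ((prodChart (Quotient.out x).2).symm u).1,
    ((prodChart (Quotient.out x).2).symm u).2)
  mem_source x := by
    have hx : AssocSphere.mk R (Quotient.out x) = x := Quotient.out_eq x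
    have htarget := 𝒮.mk_mem_paramHomeo_target (m := m) R (Quotient.out x).1 (Quotient.out x).2
    rw [Prod.mk.eta, hx] at htarget
    simp [htarget.1, htarget.2, prodChart]
  contMDiffOn_lift x := by
    have hchart := (contMDiffOn_prodChart_symm (p := p) (m := m) (Quotient.out x).2).mono
      fun u (hu : u ∈ ((𝒮.paramHomeo (m := m) R (Quotient.out x).1).symm.trans
        (prodChart (Quotient.out x).2)).target) => hu.1
    exact (contMDiffOn_const.mul (𝒮.contMDiffOn_σ.comp (contMDiff_fst.comp_contMDiffOn hchart)
      fun u hu => hu.2.1)).prodMk (contMDiff_snd.comp_contMDiffOn hchart)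
  proj_lift x u _ := rfl
  contMDiffOn_chart_proj x := (contMDiffOn_prodChart (Quotient.out x).2).comp
    ((𝒮.contMDiffOn_paramHomeo_symm_mk (m := m) R _).mono fun _ hq => hq.1) fun _ hq => hq.2

end SubgroupSlice

end Charts

theorem finrank_range_prodMap_id {𝕜 P A B : Type*} [Field 𝕜] [AddCommGroup P] [Module 𝕜 P]
    [AddCommGroup A] [Module 𝕜 A] [AddCommGroup B] [Module 𝕜 B] [FiniteDimensional 𝕜 P]
    [FiniteDimensional 𝕜 A] (f : A →ₗ[𝕜] B) :
    Module.finrank 𝕜 (LinearMap.range ((LinearMap.id : P →ₗ[𝕜] P).prodMap f)) =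
      Module.finrank 𝕜 P + Module.finrank 𝕜 (LinearMap.range f) := by
  have factorization : (LinearMap.id : P →ₗ[𝕜] P).prodMap f =
      ((LinearMap.id : P →ₗ[𝕜] P).prodMap (LinearMap.range f).subtype) ∘ₗ
        ((LinearMap.id : P →ₗ[𝕜] P).prodMap f.rangeRestrict) := by
    ext <;> simp
  rw [factorization, LinearMap.range_comp_of_range_eq_top, LinearMap.finrank_range_of_inj,
    Module.finrank_prod]
  · exact Function.Injective.prodMap Function.injective_id Subtype.val_injective
  · exact LinearMap.range_eq_top.2
      (Function.Surjective.prodMap Function.surjective_id f.surjective_rangeRestrict)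

section SphereInclusion

variable {P : Type*} [NormedAddCommGroup P] [NormedSpace ℝ P]
  {V : Type*} [NormedAddCommGroup V] [InnerProductSpace ℝ V] {m : ℕ}
  [Fact (Module.finrank ℝ V = m + 1)] (q : P × Metric.sphere (0 : V) 1)

theorem mdifferentiableAt_prodMap_id_coe_sphere :
    MDifferentiableAt (𝓘(ℝ, P).prod (𝓡 m)) (𝓘(ℝ, P).prod 𝓘(ℝ, V))
      (Prod.map id Subtype.val : P × Metric.sphere (0 : V) 1 → P × V) q :=
  mdifferentiableAt_id.prodMap ((contMDiff_coe_sphere (m := ∞)).mdifferentiable (by simp) _)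

theorem injective_mfderiv_prodMap_id_coe_sphere :
    Function.Injective (mfderiv (𝓘(ℝ, P).prod (𝓡 m)) (𝓘(ℝ, P).prod 𝓘(ℝ, V))
      (Prod.map id Subtype.val : P × Metric.sphere (0 : V) 1 → P × V) q :
      P × EuclideanSpace ℝ (Fin m) → P × V) := by
  have hcoe : MDifferentiableAt (𝓡 m) 𝓘(ℝ, V) (Subtype.val : Metric.sphere (0 : V) 1 → V) q.2 :=
    (contMDiff_coe_sphere (m := ∞)).mdifferentiable (by simp) q.2
  have hcoe_injective : Function.Injective (mfderiv (𝓡 m) 𝓘(ℝ, V)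
      (Subtype.val : Metric.sphere (0 : V) 1 → V) q.2) := by
    convert! injective_mvfderiv_subtypeVal_sphere q.2
  rw [mfderiv_prodMap mdifferentiableAt_id hcoe, mfderiv_id]
  exact Function.Injective.prodMap Function.injective_id hcoe_injective

end SphereInclusion

namespace SubgroupSlice

variable {E : Type*} [NormedAddCommGroup E] [NormedSpace ℝ E]
  {G : Type*} [Group G] [TopologicalSpace G] [ChartedSpace E G]
  {L : Subgroup G} {V : Type*} [NormedAddCommGroup V] [InnerProductSpace ℝ V]
  {p l m : ℕ} (𝒮 : SubgroupSlice (E := E) L p l) (R : OrthogonalRep L V)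

theorem Θ_zero : 𝒮.Θ 0 = 1 := (𝒮.Θ_zero_right 𝒮.zero_mem_B).trans 𝒮.σ_zero

theorem zero_mem_source : 0 ∈ 𝒮.Θ.source := 𝒮.mem_source 0 𝒮.zero_mem_B

theorem one_mem_target : (1 : G) ∈ 𝒮.Θ.target := 𝒮.Θ_zero ▸ 𝒮.Θ.map_source 𝒮.zero_mem_source

theorem Θ_symm_one : 𝒮.Θ.symm 1 = 0 := by
  rw [← 𝒮.Θ_zero, 𝒮.Θ.left_inv 𝒮.zero_mem_source]

/-- The differential at the identity of an orthogonal representation of the subgroup `L`, in the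
coordinates of `L` given by products of one-parameter subgroups. -/
noncomputable def tangentRep : (Fin l → ℝ) →L[ℝ] V →L[ℝ] V :=
  fderiv ℝ (fun a => R.toHom (curveProd 𝒮.γ a)) 0

theorem hasFDerivAt_rep [FiniteDimensional ℝ V] :
    HasFDerivAt (fun a => R.toHom (curveProd 𝒮.γ a)) (𝒮.tangentRep R) 0 :=
  ((𝒮.contDiff_rep R).differentiable (by simp) 0).hasFDerivAt

/-- The image of the Lie algebra of the subgroup `L` under the differential of an orthogonal
representation. -/
noncomputable def tangentImage : Submodule ℝ (V →L[ℝ] V) :=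
  LinearMap.range (𝒮.tangentRep R).toLinearMap

theorem hasMFDerivAt_fst_rep_snd [FiniteDimensional ℝ V] (v : V) : HasMFDerivAt
    𝓘(ℝ, EuclideanSpace ℝ (Fin p) × (Fin l → ℝ)) (𝓘(ℝ, EuclideanSpace ℝ (Fin p)).prod 𝓘(ℝ, V))
    (fun x : EuclideanSpace ℝ (Fin p) × (Fin l → ℝ) => (x.1, R.toHom (curveProd 𝒮.γ x.2) v)) 0
    ((ContinuousLinearMap.fst ℝ (EuclideanSpace ℝ (Fin p)) (Fin l → ℝ)).prod
      (ContinuousLinearMap.apply ℝ V v ∘L 𝒮.tangentRep R ∘L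
        ContinuousLinearMap.snd ℝ (EuclideanSpace ℝ (Fin p)) (Fin l → ℝ))) := by
  have hfst : HasFDerivAt Prod.fst
    (ContinuousLinearMap.fst ℝ (EuclideanSpace ℝ (Fin p)) (Fin l → ℝ)) 0 := hasFDerivAt_fst
  have hsnd : HasFDerivAt
      (fun x : EuclideanSpace ℝ (Fin p) × (Fin l → ℝ) => R.toHom (curveProd 𝒮.γ x.2) v)
      (ContinuousLinearMap.apply ℝ V v ∘L 𝒮.tangentRep R ∘L
        ContinuousLinearMap.snd ℝ (EuclideanSpace ℝ (Fin p)) (Fin l → ℝ)) 0 :=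
    (ContinuousLinearMap.apply ℝ V v).hasFDerivAt.comp _
      (HasFDerivAt.comp (0 : EuclideanSpace ℝ (Fin p) × (Fin l → ℝ)) (f := Prod.snd)
        (𝒮.hasFDerivAt_rep R) hasFDerivAt_snd)
  exact hfst.hasMFDerivAt.prodMk hsnd.hasMFDerivAt

variable [LieGroup 𝓘(ℝ, E) ∞ G] [Fact (Module.finrank ℝ V = m + 1)]

theorem contMDiff_mk :
    letI := (𝒮.atlas (m := m) R).chartedSpace
    ContMDiff (𝓘(ℝ, E).prod (𝓡 m)) (𝓡 (p + m)) ∞ (AssocSphere.mk R) :=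
  (𝒮.atlas (m := m) R).contMDiff_proj AssocSphere.continuous_mk

theorem contMDiffSMul :
    letI := (𝒮.atlas (m := m) R).chartedSpace
    ContMDiffSMul 𝓘(ℝ, E) (𝓡 (p + m)) ∞ G (AssocSphere R) := by
  let _ := (𝒮.atlas (m := m) R).chartedSpace
  refine ⟨fun y => ?_⟩
  obtain ⟨s, hs, hmk⟩ := (𝒮.atlas (m := m) R).exists_section y.2
  have hs_snd : ContMDiffAt (𝓘(ℝ, E).prod (𝓡 (p + m))) (𝓘(ℝ, E).prod (𝓡 m)) ∞
      (fun x : G × AssocSphere R => s x.2) y := hs.comp y contMDiffAt_snd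
  have hlift : ContMDiffAt (𝓘(ℝ, E).prod (𝓡 (p + m))) (𝓘(ℝ, E).prod (𝓡 m)) ∞
      (fun x : G × AssocSphere R => (x.1 * (s x.2).1, (s x.2).2)) y :=
    (contMDiffAt_fst.mul (contMDiffAt_fst.comp y hs_snd)).prodMk (contMDiffAt_snd.comp y hs_snd)
  refine ((𝒮.contMDiff_mk (m := m) R).contMDiffAt.comp y hlift).congr_of_eventuallyEq ?_
  filter_upwards [continuous_snd.continuousAt.preimage_mem_nhds hmk] with x hx
  exact congrArg (x.1 • ·) (Eq.symm hx)

theorem contMDiffAt_param (g₀ : G) {y : EuclideanSpace ℝ (Fin p) × Metric.sphere (0 : V) 1}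
    (hy : y.1 ∈ 𝒮.B) :
    letI := (𝒮.atlas (m := m) R).chartedSpace
    ContMDiffAt (𝓘(ℝ, EuclideanSpace ℝ (Fin p)).prod (𝓡 m)) (𝓡 (p + m)) ∞ (𝒮.param R g₀) y := by
  let _ := (𝒮.atlas (m := m) R).chartedSpace
  have hfst : ContMDiffAt (𝓘(ℝ, EuclideanSpace ℝ (Fin p)).prod (𝓡 m)) 𝓘(ℝ, E) ∞
      (fun y : EuclideanSpace ℝ (Fin p) × Metric.sphere (0 : V) 1 => g₀ * 𝒮.σ y.1) y :=
    contMDiffAt_const.mul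
      ((𝒮.contMDiffOn_σ.contMDiffAt (𝒮.isOpen_B.mem_nhds hy)).comp y contMDiffAt_fst)
  exact (𝒮.contMDiff_mk (m := m) R).contMDiffAt.comp y (hfst.prodMk contMDiffAt_snd)

theorem contMDiffAt_paramHomeo_symm (g₀ : G) {x : AssocSphere R}
    (hx : x ∈ (𝒮.paramHomeo (m := m) R g₀).target) :
    letI := (𝒮.atlas (m := m) R).chartedSpace
    ContMDiffAt (𝓡 (p + m)) (𝓘(ℝ, EuclideanSpace ℝ (Fin p)).prod (𝓡 m)) ∞
      (𝒮.paramHomeo (m := m) R g₀).symm x := by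
  let _ := (𝒮.atlas (m := m) R).chartedSpace
  obtain ⟨s, hs, hmk⟩ := (𝒮.atlas (m := m) R).exists_section x
  have hsx : AssocSphere.mk R (s x) = x := hmk.self_of_nhds
  have hsymm := (𝒮.contMDiffOn_paramHomeo_symm_mk (m := m) R g₀).contMDiffAt
    (((𝒮.paramHomeo (m := m) R g₀).open_target.preimage AssocSphere.continuous_mk).mem_nhds
      (x := s x) (by rwa [mem_preimage, hsx]))
  refine (hsymm.comp x hs).congr_of_eventuallyEq ?_
  filter_upwards [hmk] with y hy
  simp only [Function.comp, hy]

theorem injective_mfderiv_paramHomeo_symm {g₀ : G} {x : AssocSphere R}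
    (hx : x ∈ (𝒮.paramHomeo (m := m) R g₀).target) :
    letI := (𝒮.atlas (m := m) R).chartedSpace
    Function.Injective (mfderiv (𝓡 (p + m)) (𝓘(ℝ, EuclideanSpace ℝ (Fin p)).prod (𝓡 m))
      (𝒮.paramHomeo (m := m) R g₀).symm x : EuclideanSpace ℝ (Fin (p + m)) →
        EuclideanSpace ℝ (Fin p) × EuclideanSpace ℝ (Fin m)) := by
  let _ := (𝒮.atlas (m := m) R).chartedSpace
  let Q := 𝒮.paramHomeo (m := m) R g₀
  have hparam : ContMDiffAt (𝓘(ℝ, EuclideanSpace ℝ (Fin p)).prod (𝓡 m)) (𝓡 (p + m)) ∞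
      (𝒮.param R g₀) (Q.symm x) := 𝒮.contMDiffAt_param (m := m) R g₀ (Q.map_target hx).1
  have hsymm := 𝒮.contMDiffAt_paramHomeo_symm (m := m) R g₀ hx
  refine Function.LeftInverse.injective fun v => mfderiv_comp_eq_id_of_eventually
    (hsymm.mdifferentiableAt (by simp)) (hparam.mdifferentiableAt (by simp)) ?_ v
  filter_upwards [Q.open_target.mem_nhds hx] with y hy
  exact Q.right_inv hy

/-- The coordinates of `G ×_L S(V)` inverse to the local parametrization at `g₀`, with values in
`ℝᵖ × V` instead of `ℝᵖ × S(V)`. -/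
noncomputable def ambientCoord (g₀ : G) (x : AssocSphere R) : EuclideanSpace ℝ (Fin p) × V :=
  Prod.map id Subtype.val ((𝒮.paramHomeo (m := m) R g₀).symm x)

theorem mdifferentiableAt_ambientCoord {g₀ : G} {x : AssocSphere R}
    (hx : x ∈ (𝒮.paramHomeo (m := m) R g₀).target) :
    letI := (𝒮.atlas (m := m) R).chartedSpace
    MDifferentiableAt (𝓡 (p + m)) (𝓘(ℝ, EuclideanSpace ℝ (Fin p)).prod 𝓘(ℝ, V))
      (𝒮.ambientCoord (m := m) R g₀) x :=
  letI := (𝒮.atlas (m := m) R).chartedSpace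
  MDifferentiableAt.comp x (mdifferentiableAt_prodMap_id_coe_sphere _)
    ((𝒮.contMDiffAt_paramHomeo_symm (m := m) R g₀ hx).mdifferentiableAt (by simp))

theorem injective_mfderiv_ambientCoord {g₀ : G} {x : AssocSphere R}
    (hx : x ∈ (𝒮.paramHomeo (m := m) R g₀).target) :
    letI := (𝒮.atlas (m := m) R).chartedSpace
    Function.Injective (mfderiv (𝓡 (p + m)) (𝓘(ℝ, EuclideanSpace ℝ (Fin p)).prod 𝓘(ℝ, V))
      (𝒮.ambientCoord (m := m) R g₀) x :
      EuclideanSpace ℝ (Fin (p + m)) → EuclideanSpace ℝ (Fin p) × V) := by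
  let _ := (𝒮.atlas (m := m) R).chartedSpace
  have chain_rule : mfderiv (𝓡 (p + m)) (𝓘(ℝ, EuclideanSpace ℝ (Fin p)).prod 𝓘(ℝ, V))
      (𝒮.ambientCoord (m := m) R g₀) x = _ :=
    mfderiv_comp x (mdifferentiableAt_prodMap_id_coe_sphere _)
    ((𝒮.contMDiffAt_paramHomeo_symm (m := m) R g₀ hx).mdifferentiableAt (by simp))
  rw [chain_rule]
  exact (injective_mfderiv_prodMap_id_coe_sphere _).comp
    (𝒮.injective_mfderiv_paramHomeo_symm (m := m) R hx)

theorem mdifferentiableAt_conj_Θ (g₀ : G) : MDifferentiableAt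
    𝓘(ℝ, EuclideanSpace ℝ (Fin p) × (Fin l → ℝ)) 𝓘(ℝ, E) (fun x => g₀ * 𝒮.Θ x * g₀⁻¹) 0 :=
  ((contMDiffAt_const.mul (𝒮.contMDiffOn_Θ.contMDiffAt (𝒮.Θ.open_source.mem_nhds
    𝒮.zero_mem_source))).mul contMDiffAt_const).mdifferentiableAt (by simp)

theorem surjective_mfderiv_conj_Θ (g₀ : G) : Function.Surjective
    (mfderiv 𝓘(ℝ, EuclideanSpace ℝ (Fin p) × (Fin l → ℝ)) 𝓘(ℝ, E)
      (fun x => g₀ * 𝒮.Θ x * g₀⁻¹) 0 : EuclideanSpace ℝ (Fin p) × (Fin l → ℝ) → E) := by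
  have : IsTopologicalGroup G := topologicalGroup_of_lieGroup 𝓘(ℝ, E) ∞
  let c' (g : G) : EuclideanSpace ℝ (Fin p) × (Fin l → ℝ) := 𝒮.Θ.symm (g₀⁻¹ * g * g₀)
  have hone : g₀⁻¹ * 1 * g₀ ∈ 𝒮.Θ.target := by simpa using 𝒮.one_mem_target
  have hc'_one : c' 1 = 0 := by simp [c', 𝒮.Θ_symm_one]
  have hc' : MDifferentiableAt 𝓘(ℝ, E) 𝓘(ℝ, EuclideanSpace ℝ (Fin p) × (Fin l → ℝ)) c' 1 :=
    (ContMDiffAt.comp (1 : G) (f := fun g : G => g₀⁻¹ * g * g₀)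
      (𝒮.contMDiffOn_Θ_symm.contMDiffAt (𝒮.Θ.open_target.mem_nhds hone))
      ((contMDiffAt_const.mul contMDiffAt_id).mul contMDiffAt_const)).mdifferentiableAt (by simp)
  have right_inverse : ∀ᶠ g in 𝓝 (1 : G), g₀ * 𝒮.Θ (c' g) * g₀⁻¹ = g := by
    have hdomain : IsOpen ((fun g : G => g₀⁻¹ * g * g₀) ⁻¹' 𝒮.Θ.target) :=
      𝒮.Θ.open_target.preimage ((continuous_const.mul continuous_id).mul continuous_const)
    filter_upwards [hdomain.mem_nhds hone] with g hg
    rw [𝒮.Θ.right_inv hg]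
    group
  intro v
  have hv := mfderiv_comp_eq_id_of_eventually hc'
    (by rw [hc'_one]; exact 𝒮.mdifferentiableAt_conj_Θ g₀) right_inverse v
  rw [hc'_one] at hv
  exact ⟨_, hv⟩

theorem eventually_ambientCoord_smul_eq (g₀ : G) (s : Metric.sphere (0 : V) 1) :
    ∀ᶠ x in 𝓝 (0 : EuclideanSpace ℝ (Fin p) × (Fin l → ℝ)),
      𝒮.ambientCoord (m := m) R g₀ ((g₀ * 𝒮.Θ x * g₀⁻¹) • AssocSphere.mk R (g₀, s)) =
        (x.1, R.toHom (curveProd 𝒮.γ x.2) s) := by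
  have hB : ∀ᶠ x : EuclideanSpace ℝ (Fin p) × (Fin l → ℝ) in 𝓝 0, x.1 ∈ 𝒮.B :=
    continuous_fst.continuousAt.preimage_mem_nhds (𝒮.isOpen_B.mem_nhds 𝒮.zero_mem_B)
  filter_upwards [hB, 𝒮.Θ.open_source.mem_nhds 𝒮.zero_mem_source] with x hxB hxΘ
  have hparam : (g₀ * 𝒮.Θ x * g₀⁻¹) • AssocSphere.mk R (g₀, s) =
      𝒮.paramHomeo (m := m) R g₀ (x.1, R.act (curveProd 𝒮.γ x.2) s) := by
    simp only [AssocSphere.smul_mk, coe_paramHomeo, param]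
    rw [inv_mul_cancel_right, 𝒮.Θ_apply x hxΘ, ← mul_assoc, AssocSphere.mk_mul_left]
  rw [hparam, ambientCoord, (𝒮.paramHomeo (m := m) R g₀).left_inv ⟨hxB, mem_univ _⟩]
  rfl

theorem finrank_range_mfderiv_smul [FiniteDimensional ℝ E] (g₀ : G)
    (s : Metric.sphere (0 : V) 1) :
    letI := (𝒮.atlas (m := m) R).chartedSpace
    Module.finrank ℝ (LinearMap.range (mfderiv 𝓘(ℝ, E) (𝓡 (p + m))
      (fun g : G => g • AssocSphere.mk R (g₀, s)) 1).toLinearMap) =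
    p + Module.finrank ℝ
      ((𝒮.tangentImage R).map (ContinuousLinearMap.apply ℝ V (s : V)).toLinearMap) := by
  let _ := (𝒮.atlas (m := m) R).chartedSpace
  have := (𝒮.atlas (m := m) R).isManifold
  have := 𝒮.contMDiffSMul (m := m) R
  have : FiniteDimensional ℝ V := .of_fact_finrank_eq_succ m
  let orbitMap (g : G) : AssocSphere R := g • AssocSphere.mk R (g₀, s)
  let conjΘ (x : EuclideanSpace ℝ (Fin p) × (Fin l → ℝ)) : G := g₀ * 𝒮.Θ x * g₀⁻¹
  have orbitMap_one : orbitMap 1 = AssocSphere.mk R (g₀, s) := one_smul _ _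
  have conjΘ_zero : conjΘ 0 = 1 := by simp [conjΘ, 𝒮.Θ_zero]
  have horbit : MDifferentiableAt 𝓘(ℝ, E) (𝓡 (p + m)) orbitMap 1 :=
    ContMDiffAt.mdifferentiableAt (n := ∞) (ContMDiffAt.smul (f := fun g : G => g)
      (g := fun _ => AssocSphere.mk R (g₀, s)) contMDiffAt_id contMDiffAt_const) (by simp)
  have htarget := (𝒮.mk_mem_paramHomeo_target (m := m) R g₀ s).1
  have hrank := finrank_range_mfderiv_eq conjΘ_zero orbitMap_one
    (𝒮.mdifferentiableAt_conj_Θ g₀) horbit (𝒮.mdifferentiableAt_ambientCoord R htarget)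
    (𝒮.surjective_mfderiv_conj_Θ g₀) (𝒮.injective_mfderiv_ambientCoord R htarget)
  rw [Filter.EventuallyEq.mfderiv_eq (𝒮.eventually_ambientCoord_smul_eq (m := m) R g₀ s),
    (𝒮.hasMFDerivAt_fst_rep_snd R s).mfderiv] at hrank
  have hprod := finrank_range_prodMap_id (P := EuclideanSpace ℝ (Fin p))
    ((ContinuousLinearMap.apply ℝ V (s : V)).toLinearMap ∘ₗ (𝒮.tangentRep R).toLinearMap)
  rw [finrank_euclideanSpace_fin] at hprod
  rw [tangentImage, ← LinearMap.range_comp]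
  exact hrank.trans hprod

end SubgroupSlice

theorem eq_one_of_map_add_of_hasDerivAt_zero {A : Type*} [NormedRing A] [NormedAlgebra ℝ A]
    {h : ℝ → A} (hzero : h 0 = 1) (hadd : ∀ s t, h (s + t) = h s * h t)
    (hderiv : HasDerivAt h 0 0) (t : ℝ) : h t = 1 := by
  have hderiv_all (t : ℝ) : HasDerivAt h 0 t := by
    have hmul : HasDerivAt (fun s => h t * h s) (h t * 0) (t - t) := by
      rw [sub_self]; exact hderiv.const_mul _
    have htranslate := hmul.comp_sub_const t t
    rw [mul_zero] at htranslate
    refine htranslate.congr_of_eventuallyEq (Eventually.of_forall fun s => ?_)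
    change h s = h t * h (s - t)
    rw [← hadd, add_sub_cancel]
  exact (is_const_of_deriv_eq_zero (fun t => (hderiv_all t).differentiableAt)
    (fun t => (hderiv_all t).deriv) t 0).trans hzero

namespace SubgroupSlice

variable {E : Type*} [NormedAddCommGroup E] [NormedSpace ℝ E]
  {G : Type*} [Group G] [TopologicalSpace G] [ChartedSpace E G]
  {L : Subgroup G} {V : Type*} [NormedAddCommGroup V] [InnerProductSpace ℝ V]
  {p l : ℕ} (𝒮 : SubgroupSlice (E := E) L p l) (R : OrthogonalRep L V)

theorem eventually_eq_curveProd :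
    ∀ᶠ g in 𝓝 (1 : G), ∀ h : g ∈ L, (⟨g, h⟩ : L) = curveProd 𝒮.γ (𝒮.Θ.symm g).2 := by
  have hB : ∀ᶠ g in 𝓝 (1 : G), (𝒮.Θ.symm g).1 ∈ 𝒮.B := by
    refine (continuous_fst.continuousAt.comp (𝒮.Θ.symm.continuousAt 𝒮.one_mem_target))
      |>.preimage_mem_nhds (𝒮.isOpen_B.mem_nhds ?_)
    simp [𝒮.Θ_symm_one, 𝒮.zero_mem_B]
  filter_upwards [hB, 𝒮.Θ.open_target.mem_nhds 𝒮.one_mem_target] with g hgB hg hgL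
  have factorization := 𝒮.Θ_apply _ (𝒮.Θ.map_target hg)
  rw [𝒮.Θ.right_inv hg] at factorization
  have hfst : (0 : EuclideanSpace ℝ (Fin p)) = (𝒮.Θ.symm g).1 := by
    refine 𝒮.eq_of_mem 0 𝒮.zero_mem_B _ hgB ?_
    rw [𝒮.σ_zero, inv_one, one_mul, eq_mul_inv_of_mul_eq factorization.symm]
    exact L.mul_mem hgL (L.inv_mem (Subtype.property _))
  rw [← hfst, 𝒮.σ_zero, one_mul] at factorization
  exact Subtype.ext factorization

theorem curveProd_γ_zero : curveProd 𝒮.γ 0 = 1 :=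
  curveProd_zero fun i => (𝒮.isOneParameterSubgroup i).map_zero

theorem exists_hasDerivAt_Θ_symm_snd {u : ℝ → G} (hu : ContMDiff 𝓘(ℝ, ℝ) 𝓘(ℝ, E) ∞ u)
    (hu_zero : u 0 = 1) : ∃ a, HasDerivAt (fun t => (𝒮.Θ.symm (u t)).2) a 0 := by
  have hΘu : ContMDiffAt 𝓘(ℝ, ℝ) 𝓘(ℝ, EuclideanSpace ℝ (Fin p) × (Fin l → ℝ)) ∞
      (fun t => 𝒮.Θ.symm (u t)) 0 := by
    refine ContMDiffAt.comp (0 : ℝ) (𝒮.contMDiffOn_Θ_symm.contMDiffAt ?_) hu.contMDiffAt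
    rw [hu_zero]
    exact 𝒮.Θ.open_target.mem_nhds 𝒮.one_mem_target
  exact ⟨_, ((contDiffAt_snd.comp (0 : ℝ)
    (contMDiffAt_iff_contDiffAt.1 hΘu)).differentiableAt (by simp)).hasDerivAt⟩

variable [FiniteDimensional ℝ V]

theorem hasDerivAt_rep_comp {α : ℝ → Fin l → ℝ} {a : Fin l → ℝ} (hα : HasDerivAt α a 0)
    (hα_zero : α 0 = 0) :
    HasDerivAt (fun t => R.toHom (curveProd 𝒮.γ (α t))) (𝒮.tangentRep R a) 0 := by
  have hrep := 𝒮.hasFDerivAt_rep R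
  rw [← hα_zero] at hrep
  exact hrep.comp_hasDerivAt (0 : ℝ) hα

theorem hasDerivAt_rep_line (a : Fin l → ℝ) :
    HasDerivAt (fun t : ℝ => R.toHom (curveProd 𝒮.γ (t • a))) (𝒮.tangentRep R a) 0 :=
  𝒮.hasDerivAt_rep_comp R (by simpa using (hasDerivAt_id (0 : ℝ)).smul_const a) (zero_smul _ _)

theorem exists_curve_of_mem_tangentImage {A : V →L[ℝ] V} (hA : A ∈ 𝒮.tangentImage R) :
    ∃ w : ℝ → L, w 0 = 1 ∧ HasDerivAt (fun t => R.toHom (w t)) A 0 := by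
  obtain ⟨a, rfl⟩ := hA
  exact ⟨fun t => curveProd 𝒮.γ (t • a), by simp [𝒮.curveProd_γ_zero],
    𝒮.hasDerivAt_rep_line R a⟩

theorem isOpen_ker_of_tangentImage_eq_bot [IsTopologicalGroup G] (hbot : 𝒮.tangentImage R = ⊥) :
    IsOpen (R.toHom.ker : Set L) := by
  have : CompleteSpace V := FiniteDimensional.complete ℝ V
  have rep_γ (i : Fin l) (t : ℝ) : R.toHom (𝒮.γ i t) = 1 := by
    refine eq_one_of_map_add_of_hasDerivAt_zero (h := fun t => R.toHom (𝒮.γ i t))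
      (by rw [(𝒮.isOneParameterSubgroup i).map_zero, map_one])
      (fun s t => by rw [(𝒮.isOneParameterSubgroup i).map_add, map_mul]) ?_ t
    have hderiv := 𝒮.hasDerivAt_rep_line R (Pi.single i 1)
    have hzero : 𝒮.tangentRep R (Pi.single i 1) = 0 := by
      rw [← Submodule.mem_bot ℝ, ← hbot]
      exact ⟨_, rfl⟩
    simpa only [hzero, ← Pi.single_smul, smul_eq_mul, mul_one,
      curveProd_single fun i => (𝒮.isOneParameterSubgroup i).map_zero] using hderiv
  have rep_curveProd (a : Fin l → ℝ) : R.toHom (curveProd 𝒮.γ a) = 1 := by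
    simp only [map_curveProd, rep_γ]
    exact curveProd_zero (γ := fun _ _ => (1 : V →L[ℝ] V)) fun _ => rfl
  refine Subgroup.isOpen_of_mem_nhds _ (g := 1) ?_
  filter_upwards [(continuous_subtype_val.tendsto' (1 : L) (1 : G) rfl).eventually
    𝒮.eventually_eq_curveProd] with k hk
  exact (congrArg R.toHom (hk k.2)).trans (rep_curveProd _)

theorem tangentImage_ne_bot [IsTopologicalGroup G] [CompactSpace L] [Infinite (L ⧸ R.toHom.ker)] :
    𝒮.tangentImage R ≠ ⊥ := fun hbot =>
  have : Finite (L ⧸ R.toHom.ker) :=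
    Subgroup.quotient_finite_of_isOpen _ (𝒮.isOpen_ker_of_tangentImage_eq_bot R hbot)
  not_finite (L ⧸ R.toHom.ker)

variable [LieGroup 𝓘(ℝ, E) ∞ G]

theorem contMDiff_conj_curveProd (k : L) (a : Fin l → ℝ) : ContMDiff 𝓘(ℝ, ℝ) 𝓘(ℝ, E) ∞
    fun t : ℝ => ((k * curveProd 𝒮.γ (t • a) * k⁻¹ : L) : G) := by
  have hline : ContMDiff 𝓘(ℝ, ℝ) 𝓘(ℝ, Fin l → ℝ) ∞ (fun t : ℝ => t • a) :=
    (contDiff_id.smul contDiff_const).contMDiff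
  exact (contMDiff_const.mul (𝒮.contMDiff_curveProd.comp hline)).mul contMDiff_const

theorem conj_mem_tangentImage {A : V →L[ℝ] V} (hA : A ∈ 𝒮.tangentImage R) (k : L) :
    R.toHom k * A * R.toHom k⁻¹ ∈ 𝒮.tangentImage R := by
  obtain ⟨a, rfl⟩ := hA
  have : CompleteSpace V := FiniteDimensional.complete ℝ V
  let u (t : ℝ) : L := k * curveProd 𝒮.γ (t • a) * k⁻¹
  have hu_zero : (u 0 : G) = 1 := by simp [u, 𝒮.curveProd_γ_zero]
  have hu : ContMDiff 𝓘(ℝ, ℝ) 𝓘(ℝ, E) ∞ fun t => (u t : G) := 𝒮.contMDiff_conj_curveProd k a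
  obtain ⟨α', hα'⟩ := 𝒮.exists_hasDerivAt_Θ_symm_snd hu hu_zero
  have hderiv_coord := 𝒮.hasDerivAt_rep_comp R hα' (by rw [hu_zero, 𝒮.Θ_symm_one]; rfl)
  have hderiv_conj : HasDerivAt
      (fun t : ℝ => R.toHom k * R.toHom (curveProd 𝒮.γ (t • a)) * R.toHom k⁻¹)
      (R.toHom k * 𝒮.tangentRep R a * R.toHom k⁻¹) 0 :=
    ((𝒮.hasDerivAt_rep_line R a).const_mul _).mul_const _
  have curves_eq : (fun t => R.toHom (curveProd 𝒮.γ (𝒮.Θ.symm (u t : G)).2)) =ᶠ[𝓝 0]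
      fun t : ℝ => R.toHom k * R.toHom (curveProd 𝒮.γ (t • a)) * R.toHom k⁻¹ := by
    filter_upwards [(hu.continuous.tendsto' 0 1 hu_zero).eventually 𝒮.eventually_eq_curveProd]
      with t ht
    rw [← ht (u t).2, ← map_mul, ← map_mul]
  exact ⟨α', (hderiv_coord.congr_of_eventuallyEq curves_eq.symm).unique hderiv_conj⟩

end SubgroupSlice

theorem conj_mem_of_forall_inv_conj_mem_of_isClosed {G : Type*} [Group G] [TopologicalSpace G]
    [IsTopologicalGroup G] [CompactSpace G] {K : Subgroup G} (hK : IsClosed (K : Set G)) {u : G}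
    (hu : ∀ x ∈ K, u⁻¹ * x * u ∈ K) {x : G} (hx : x ∈ K) : u * x * u⁻¹ ∈ K := by
  have inv_pow_conj_mem (n : ℕ) : (u ^ n)⁻¹ * x * u ^ n ∈ K := by
    induction n with
    | zero => simpa using hx
    | succ n ih => simpa [pow_succ, mul_assoc] using hu _ ih
  have hclosed : IsClosed ((fun y : G => y⁻¹ * x * y) ⁻¹' K) :=
    hK.preimage ((continuous_inv.mul continuous_const).mul continuous_id)
  -- In a compact group `u⁻¹` is a limit of positive powers of `u`.
  have inv_mem_closure : u⁻¹ ∈ _root_.closure (range (u ^ · : ℕ → G)) :=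
    ((mapClusterPt_atTop_pow_tfae u⁻¹ u).out 0 2).1
      (by simpa using mapClusterPt_self_zpow_atTop_pow u (-1))
  have : u⁻¹ ∈ (fun y : G => y⁻¹ * x * y) ⁻¹' K :=
    closure_minimal (by rintro _ ⟨n, rfl⟩; exact inv_pow_conj_mem n) hclosed inv_mem_closure
  simpa using this

namespace OrthogonalRep

variable {H V : Type*} [Group H] [TopologicalSpace H] [NormedAddCommGroup V]
  [InnerProductSpace ℝ V] (R : OrthogonalRep H V)

/-- The isotropy group at `s` is no larger than the kernel of the representation, that is, the image
of the representation acts freely at `s`. -/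
def IsFreeAt (s : Metric.sphere (0 : V) 1) : Prop := ∀ h, R.act h s = s → R.toHom h = 1

/-- `A` is the velocity at the identity of a curve of group elements; velocities stand in for the
image of the Lie algebra of the group under the differential of the representation. -/
def IsVelocity (A : V →L[ℝ] V) : Prop :=
  ∃ w : ℝ → H, w 0 = 1 ∧ HasDerivAt (fun t => R.toHom (w t)) A 0

/-- An orthogonal representation on a space of dimension `m + 1` whose image acts freely on the unit
sphere outside a single non-free orbit, with orbit space of dimension `c`. In the field
`finrank_add`, which computes the dimension of the free orbits, `𝔯` is the image of the Lie algebra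
of the group. -/
structure IsSphereModel (m c : ℕ) : Prop where
  one_le : 1 ≤ m
  exists_isFreeAt : ∃ s, R.IsFreeAt s
  exists_not_isFreeAt : ∃ s, ¬ R.IsFreeAt s
  transitive : ∀ s s', ¬ R.IsFreeAt s → ¬ R.IsFreeAt s' → ∃ h, R.act h s = s'
  finrank_add : ∀ 𝔯 : Submodule ℝ (V →L[ℝ] V), 𝔯 ≠ ⊥ →
    (∀ h, ∀ A ∈ 𝔯, R.toHom h * A * R.toHom h⁻¹ ∈ 𝔯) →
    (∀ A ∈ 𝔯, R.IsVelocity A) → ∀ s, R.IsFreeAt s → Module.finrank ℝ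
      (𝔯.map (ContinuousLinearMap.apply ℝ V (s : V)).toLinearMap) + c = m

variable {R}

theorem IsSphereModel.comp {m c : ℕ} (hR : R.IsSphereModel m c) {H' : Type*} [Group H']
    [TopologicalSpace H'] {f : H' →* H} (hf : Continuous f) (hsurj : Function.Surjective f) :
    (R.comp f hf).IsSphereModel m c := by
  have isFreeAt_comp (s) : (R.comp f hf).IsFreeAt s ↔ R.IsFreeAt s :=
    (hsurj.forall (p := fun h => R.act h s = s → R.toHom h = 1)).symm
  refine ⟨hR.one_le, by simpa only [isFreeAt_comp] using hR.exists_isFreeAt,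
    by simpa only [isFreeAt_comp] using hR.exists_not_isFreeAt, fun s s' hs hs' => ?_,
    fun 𝔯 hne hconj hcurve s hs => hR.finrank_add 𝔯 hne ?_ ?_ s ((isFreeAt_comp s).1 hs)⟩
  · rw [isFreeAt_comp] at hs hs'
    exact hsurj.exists.1 (hR.transitive s s' hs hs')
  · refine hsurj.forall.2 fun k A hA => ?_
    rw [← map_inv f]
    exact hconj k A hA
  · intro A hA
    obtain ⟨w, hw_zero, hw⟩ := hcurve A hA
    exact ⟨fun t => f (w t), (congrArg f hw_zero).trans (map_one f), hw⟩

end OrthogonalRep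

namespace AssocSphere

variable {G : Type*} [Group G] [TopologicalSpace G] {L : Subgroup G}
  {V : Type*} [NormedAddCommGroup V] [InnerProductSpace ℝ V] {R : OrthogonalRep L V}

theorem mem_stabilizer_mk {g h : G} {s : Metric.sphere (0 : V) 1} :
    h ∈ MulAction.stabilizer G (mk R (g, s)) ↔ ∃ k : L, h = g * k * g⁻¹ ∧ R.act k s = s := by
  rw [MulAction.mem_stabilizer_iff, smul_mk, mk_eq_mk]
  exact exists_congr fun k => and_congr (by rw [eq_mul_inv_iff_mul_eq]) eq_comm

theorem mem_stabilizer_of_conj_mem {g h : G} (s : Metric.sphere (0 : V) 1)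
    (hh : g⁻¹ * h * g ∈ R.toHom.ker.map L.subtype) :
    h ∈ MulAction.stabilizer G (mk R (g, s)) := by
  obtain ⟨k, hk, hkh⟩ := hh
  refine mem_stabilizer_mk.2 ⟨k, ?_, Subtype.ext ?_⟩
  · rw [← L.subtype_apply, hkh]
    group
  · simp [MonoidHom.mem_ker.1 hk]

theorem mem_stabilizer_iff_of_isFreeAt {g h : G} {s : Metric.sphere (0 : V) 1}
    (hs : R.IsFreeAt s) :
    h ∈ MulAction.stabilizer G (mk R (g, s)) ↔ g⁻¹ * h * g ∈ R.toHom.ker.map L.subtype := by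
  refine ⟨fun hh => ?_, mem_stabilizer_of_conj_mem s⟩
  obtain ⟨k, rfl, hk⟩ := mem_stabilizer_mk.1 hh
  exact ⟨k, hs k hk, by simp [mul_assoc]⟩

variable (R) in
/-- The orbit of `G ×_L S(V)` through the class of `(1, s)`; every orbit is of this form. -/
def sphereOrbit (s : Metric.sphere (0 : V) 1) : MulAction.orbitRel.Quotient G (AssocSphere R) :=
  Quotient.mk'' (mk R (1, s))

theorem mem_orbit_sphereOrbit {s : Metric.sphere (0 : V) 1} {x : AssocSphere R} :
    x ∈ (sphereOrbit R s).orbit ↔ ∃ g, mk R (g, s) = x := by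
  rw [sphereOrbit, MulAction.orbitRel.Quotient.orbit_mk]
  simp [MulAction.mem_orbit_iff, smul_mk]

theorem sphereOrbit_eq_mk (g : G) (s : Metric.sphere (0 : V) 1) :
    sphereOrbit R s = Quotient.mk'' (mk R (g, s)) :=
  (MulAction.orbitRel.Quotient.mem_orbit.1 (mem_orbit_sphereOrbit.2 ⟨g, rfl⟩)).symm

theorem sphereOrbit_surjective : Function.Surjective (sphereOrbit R) := fun O => by
  induction O using Quotient.inductionOn' with
  | h x =>
    obtain ⟨⟨g, s⟩, rfl⟩ := mk_surjective x
    exact ⟨s, sphereOrbit_eq_mk g s⟩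

theorem sphereOrbit_act (k : L) (s : Metric.sphere (0 : V) 1) :
    sphereOrbit R (R.act k s) = sphereOrbit R s := by
  rw [sphereOrbit_eq_mk (k : G) s, ← one_mul (k : G), mk_mul_left, sphereOrbit]

theorem connectedSpace_orbitRel_quotient (hV : 1 < Module.rank ℝ V) :
    ConnectedSpace (MulAction.orbitRel.Quotient G (AssocSphere R)) := by
  have : ConnectedSpace (Metric.sphere (0 : V) 1) :=
    isConnected_iff_connectedSpace.1 (isConnected_sphere hV 0 zero_le_one)
  exact sphereOrbit_surjective.connectedSpace
    (continuous_quotient_mk'.comp (continuous_mk.comp (continuous_const.prodMk continuous_id)))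

theorem isPrincipalOrbit_sphereOrbit {s : Metric.sphere (0 : V) 1} (hs : R.IsFreeAt s) :
    IsPrincipalOrbit (sphereOrbit R s) := by
  intro x hx y
  obtain ⟨g, rfl⟩ := mem_orbit_sphereOrbit.1 hx
  obtain ⟨⟨g', s'⟩, rfl⟩ := mk_surjective y
  refine ⟨g * g'⁻¹, fun h hh => ?_⟩
  rw [mem_stabilizer_iff_of_isFreeAt hs] at hh
  exact mem_stabilizer_of_conj_mem s' (by simpa using hh)

theorem isPrincipalIsotropy {s : Metric.sphere (0 : V) 1} (hs : R.IsFreeAt s) :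
    IsPrincipalIsotropy (AssocSphere R) (R.toHom.ker.map L.subtype) := by
  refine ⟨sphereOrbit R s, isPrincipalOrbit_sphereOrbit hs, mk R (1, s),
    mem_orbit_sphereOrbit.2 ⟨1, rfl⟩, ?_⟩
  ext h
  simp only [mem_stabilizer_iff_of_isFreeAt hs, inv_one, one_mul, mul_one]

theorem ker_toPermHom {s : Metric.sphere (0 : V) 1} (hs : R.IsFreeAt s) :
    (MulAction.toPermHom G (AssocSphere R)).ker = (R.toHom.ker.map L.subtype).normalCore := by
  ext h
  rw [MonoidHom.mem_ker]
  constructor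
  · intro hh b
    have hstab : h ∈ MulAction.stabilizer G (mk R (b⁻¹, s)) :=
      DFunLike.congr_fun hh (mk R (b⁻¹, s))
    simpa using (mem_stabilizer_iff_of_isFreeAt hs).1 hstab
  · intro hh
    ext x
    obtain ⟨⟨g, s'⟩, rfl⟩ := mk_surjective x
    exact mem_stabilizer_of_conj_mem s' (by simpa using hh g⁻¹)

variable [IsTopologicalGroup G] [CompactSpace G] (hL : IsClosed (L : Set G))
include hL

theorem not_isPrincipalOrbit_sphereOrbit {s₀ s : Metric.sphere (0 : V) 1} (hs₀ : R.IsFreeAt s₀)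
    (hs : ¬ R.IsFreeAt s) : ¬ IsPrincipalOrbit (sphereOrbit R s) := by
  intro hprincipal
  have hker : IsClosed (R.toHom.ker.map L.subtype : Set G) :=
    hL.isClosedEmbedding_subtypeVal.isClosedMap _ (isClosed_singleton.preimage R.continuous)
  obtain ⟨u, hu⟩ := hprincipal _ (mem_orbit_sphereOrbit.2 ⟨1, rfl⟩) (mk R (1, s₀))
  have conj_mem_ker {x : G} (hx : x ∈ MulAction.stabilizer G (mk R (1, s))) :
      u⁻¹ * x * u ∈ R.toHom.ker.map L.subtype := by
    simpa using (mem_stabilizer_iff_of_isFreeAt hs₀).1 (hu hx)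
  obtain ⟨k, hks, hk⟩ : ∃ k, R.act k s = s ∧ R.toHom k ≠ 1 := by
    simpa [OrthogonalRep.IsFreeAt] using hs
  have hk_ker := conj_mem_of_forall_inv_conj_mem_of_isClosed hker (u := u)
    (fun x hx => conj_mem_ker (mem_stabilizer_of_conj_mem s (by simpa using hx)))
    (conj_mem_ker (x := k) (mem_stabilizer_mk.2 ⟨k, by simp, hks⟩))
  obtain ⟨k', hk', hkk'⟩ := hk_ker
  have : k' = k := Subtype.ext (by simpa [mul_assoc] using hkk')
  exact hk (this ▸ hk')

theorem isPrincipalOrbit_sphereOrbit_iff {s₀ s : Metric.sphere (0 : V) 1} (hs₀ : R.IsFreeAt s₀) :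
    IsPrincipalOrbit (sphereOrbit R s) ↔ R.IsFreeAt s :=
  ⟨fun h => by_contra fun hs => not_isPrincipalOrbit_sphereOrbit hL hs₀ hs h,
    isPrincipalOrbit_sphereOrbit⟩

theorem existsUnique_not_isPrincipalOrbit {m c : ℕ} (hR : R.IsSphereModel m c) :
    ∃! O : MulAction.orbitRel.Quotient G (AssocSphere R), ¬ IsPrincipalOrbit O := by
  obtain ⟨s₀, hs₀⟩ := hR.exists_isFreeAt
  obtain ⟨s₁, hs₁⟩ := hR.exists_not_isFreeAt
  refine ⟨sphereOrbit R s₁, not_isPrincipalOrbit_sphereOrbit hL hs₀ hs₁,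
    sphereOrbit_surjective.forall.2 fun s hs => ?_⟩
  obtain ⟨k, rfl⟩ := hR.transitive s s₁ (mt isPrincipalOrbit_sphereOrbit hs) hs₁
  exact (sphereOrbit_act k s).symm

end AssocSphere

section Manifold

variable {d : ℕ} {G : Type*} [Group G] [TopologicalSpace G] [CompactSpace G]
  [ChartedSpace (EuclideanSpace ℝ (Fin d)) G] [LieGroup (𝓡 d) ∞ G] {L : Subgroup G}
  (hL : IsClosed (L : Set G)) {V : Type*} [NormedAddCommGroup V] [InnerProductSpace ℝ V]
  {R : OrthogonalRep L V} [Infinite (L ⧸ R.toHom.ker)] {m c : ℕ} (hR : R.IsSphereModel m c)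
include hL hR

theorem SubgroupSlice.hasCohomogeneity [Fact (Module.finrank ℝ V = m + 1)] {p l : ℕ}
    (𝒮 : SubgroupSlice (E := EuclideanSpace ℝ (Fin d)) L p l) :
    letI := (𝒮.atlas (m := m) R).chartedSpace
    HasCohomogeneity d (p + m) G (AssocSphere R) c := by
  let _ := (𝒮.atlas (m := m) R).chartedSpace
  have : IsTopologicalGroup G := topologicalGroup_of_lieGroup (𝓡 d) ∞
  have : FiniteDimensional ℝ V := .of_fact_finrank_eq_succ m
  have : CompactSpace L := isCompact_iff_compactSpace.1 hL.isCompact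
  obtain ⟨s₀, hs₀⟩ := hR.exists_isFreeAt
  refine ⟨⟨_, AssocSphere.isPrincipalOrbit_sphereOrbit hs₀⟩,
    AssocSphere.sphereOrbit_surjective.forall.2 fun s hs x hx => ?_⟩
  obtain ⟨g, rfl⟩ := AssocSphere.mem_orbit_sphereOrbit.1 hx
  rw [AssocSphere.isPrincipalOrbit_sphereOrbit_iff hL hs₀] at hs
  have orbitDim_eq : orbitDim d (p + m) G (AssocSphere.mk R (g, s)) = _ :=
    𝒮.finrank_range_mfderiv_smul (m := m) R g s
  rw [orbitDim_eq, add_assoc, hR.finrank_add _ (𝒮.tangentImage_ne_bot R)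
    (fun k A hA => 𝒮.conj_mem_tangentImage R hA k)
    (fun A hA => 𝒮.exists_curve_of_mem_tangentImage R hA) s hs]

end Manifold

/-- The existence of a compact manifold with a smooth action of `G` of cohomogeneity `c` that has
connected orbit space, principal isotropy group `K`, the smallest possible kernel, and exactly one
non-principal orbit. -/
def ActsWithUniqueNonprincipalOrbit (d : ℕ) {G : Type u} [Group G] [TopologicalSpace G]
    [ChartedSpace (EuclideanSpace ℝ (Fin d)) G] (K : Subgroup G) (c : ℕ) : Prop :=
  ∃ (n : ℕ) (M : Type u) (_ : TopologicalSpace M)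
    (_ : ChartedSpace (EuclideanSpace ℝ (Fin n)) M) (_ : MulAction G M),
    IsManifold (𝓡 n) ∞ M ∧ T2Space M ∧ CompactSpace M ∧
    ContMDiffSMul (𝓡 d) (𝓡 n) ∞ G M ∧
    (MulAction.toPermHom G M).ker = K.normalCore ∧
    ConnectedSpace (MulAction.orbitRel.Quotient G M) ∧
    IsPrincipalIsotropy M K ∧
    HasCohomogeneity d n G M c ∧
    ∃! O : MulAction.orbitRel.Quotient G M, ¬ IsPrincipalOrbit O

theorem OrthogonalRep.IsSphereModel.actsWithUniqueNonprincipalOrbit {d : ℕ} {G : Type u} [Group G]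
    [TopologicalSpace G] [CompactSpace G] [T2Space G] [ChartedSpace (EuclideanSpace ℝ (Fin d)) G]
    [LieGroup (𝓡 d) ∞ G] {L : Subgroup G} (hL : IsClosed (L : Set G))
    {V : Type} [NormedAddCommGroup V] [InnerProductSpace ℝ V] {R : OrthogonalRep L V}
    [Infinite (L ⧸ R.toHom.ker)] {m c : ℕ} (hR : R.IsSphereModel m c)
    (hV : Module.finrank ℝ V = m + 1) :
    ActsWithUniqueNonprincipalOrbit d (R.toHom.ker.map L.subtype) c := by
  have : IsTopologicalGroup G := topologicalGroup_of_lieGroup (𝓡 d) ∞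
  have : Fact (Module.finrank ℝ V = m + 1) := ⟨hV⟩
  have : FiniteDimensional ℝ V := .of_fact_finrank_eq_succ m
  have one_lt_rank : 1 < Module.rank ℝ V := by
    rw [← Module.finrank_eq_rank, hV]
    exact_mod_cast Nat.lt_add_of_pos_left hR.one_le
  obtain ⟨p, l, ⟨𝒮⟩⟩ := exists_subgroupSlice (E := EuclideanSpace ℝ (Fin d)) hL
  obtain ⟨s₀, hs₀⟩ := hR.exists_isFreeAt
  exact ⟨p + m, AssocSphere R, inferInstance, (𝒮.atlas (m := m) R).chartedSpace, inferInstance,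
    (𝒮.atlas (m := m) R).isManifold, AssocSphere.t2Space hL, inferInstance,
    𝒮.contMDiffSMul (m := m) R, AssocSphere.ker_toPermHom hs₀,
    AssocSphere.connectedSpace_orbitRel_quotient one_lt_rank, AssocSphere.isPrincipalIsotropy hs₀,
    𝒮.hasCohomogeneity hL hR, AssocSphere.existsUnique_not_isPrincipalOrbit hL hR⟩

theorem finrank_map_of_disjoint_ker {R M N : Type*} [Ring R] [AddCommGroup M] [Module R M]
    [AddCommGroup N] [Module R N] {f : M →ₗ[R] N} {U : Submodule R M} (h : Disjoint U f.ker) :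
    Module.finrank R (U.map f) = Module.finrank R U := by
  rw [← LinearMap.range_domRestrict]
  exact LinearMap.finrank_range_of_inj
    (injOn_iff_injective.1 (LinearMap.injOn_of_disjoint_ker subset_rfl h))

theorem finrank_withLp_piLp_prod {F U T : Type*} [Field F] [AddCommGroup U] [Module F U]
    [FiniteDimensional F U] [AddCommGroup T] [Module F T] [FiniteDimensional F T]
    {p q : ENNReal} (k : ℕ) :
    Module.finrank F (WithLp p (PiLp q (fun _ : Fin k => U) × T)) =
      k * Module.finrank F U + Module.finrank F T := by
  rw [(WithLp.linearEquiv p F (PiLp q (fun _ : Fin k => U) × T)).finrank_eq, Module.finrank_prod,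
    (WithLp.linearEquiv q F (Fin k → U)).finrank_eq, Module.finrank_pi_fintype]
  simp

/-- An orthogonal representation from a pointwise continuous family of linear isometries. -/
noncomputable def OrthogonalRep.ofLinear {W V : Type*} [Group W] [TopologicalSpace W]
    [NormedAddCommGroup V] [InnerProductSpace ℝ V] [FiniteDimensional ℝ V] (f : W → V →ₗ[ℝ] V)
    (map_one : f 1 = 1) (map_mul : ∀ w w', f (w * w') = f w * f w')
    (norm_map : ∀ w x, ‖f w x‖ = ‖x‖) (continuous : ∀ x, Continuous fun w => f w x) :
    OrthogonalRep W V where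
  toHom :=
    { toFun := fun w => (f w).toContinuousLinearMap
      map_one' := by ext x; simp [map_one]
      map_mul' := fun w w' => by ext x; simp [map_mul] }
  continuous := continuous_clm_apply.2 continuous
  norm_map := norm_map

theorem OrthogonalRep.hasDerivAt_toHom_apply {W V : Type*} [Group W] [TopologicalSpace W]
    [NormedAddCommGroup V] [InnerProductSpace ℝ V] {R : OrthogonalRep W V} {A : V →L[ℝ] V}
    {w : ℝ → W} (hw : HasDerivAt (fun t => R.toHom (w t)) A 0) (x : V) :
    HasDerivAt (fun t => R.toHom (w t) x) (A x) 0 := by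
  simpa using hw.clm_apply (hasDerivAt_const (0 : ℝ) x)

theorem norm_snd_of_fst_eq_zero {p : ENNReal} [Fact (1 ≤ p)] {U T : Type*}
    [SeminormedAddCommGroup U] [SeminormedAddCommGroup T] {x : WithLp p (U × T)}
    (hx : x.fst = 0) : ‖x.snd‖ = ‖x‖ := by
  rw [← WithLp.norm_toLp_snd p U, ← hx]
  rfl

section BaseVector

variable {D T : Type*} [NormedDivisionRing D] [NormedAddCommGroup T] {k : ℕ} [NeZero k]

variable (D T k) in
/-- The first standard basis vector of `Dᵏ`, as an element of `Dᵏ ⊕ T`. -/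
noncomputable def baseVector : WithLp 2 (PiLp 2 (fun _ : Fin k => D) × T) :=
  WithLp.toLp 2 (PiLp.single 2 0 1, 0)

@[simp] theorem baseVector_fst_zero : (baseVector D T k).fst 0 = 1 := by simp [baseVector]

theorem baseVector_fst_ne_zero : (baseVector D T k).fst ≠ 0 := fun h => by
  simpa [h] using baseVector_fst_zero (D := D) (T := T) (k := k)

theorem norm_baseVector : ‖baseVector D T k‖ = 1 := by
  rw [baseVector, WithLp.norm_toLp_fst, PiLp.norm_single, norm_one]

end BaseVector

theorem neg_one_ne_one_unitSphere {D : Type*} [NormedDivisionRing D] [NormedSpace ℝ D] :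
    (-1 : Metric.sphere (0 : D) 1) ≠ 1 := by
  have : IsAddTorsionFree D := .of_isTorsionFree ℝ D
  exact fun h => neg_ne_self.2 (one_ne_zero (α := D)) (congrArg Subtype.val h)

section UnitSphere

variable {D : Type*} [NormedDivisionRing D] [InnerProductSpace ℝ D]

theorem infinite_unitSphere (hD : 1 < Module.rank ℝ D) : Infinite (Metric.sphere (0 : D) 1) := by
  rw [infinite_coe_iff]
  exact (isPreconnected_sphere hD 0 1).infinite_of_nontrivial ⟨_, (-1 : Metric.sphere (0 : D) 1).2,
    _, (1 : Metric.sphere (0 : D) 1).2, fun h => neg_one_ne_one_unitSphere (Subtype.ext h)⟩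

variable [FiniteDimensional ℝ D] {T : Type*} [NormedAddCommGroup T] [InnerProductSpace ℝ T]
  [FiniteDimensional ℝ T]

namespace OrthogonalRep

section DivisionAlgebra

variable [SMulCommClass ℝ D D]

/-- The diagonal action of the unit sphere of a division algebra `D`, by left multiplication on `Dᵏ`
and by the representation `S` on `T`. -/
noncomputable def prodUnitSphere (k : ℕ) (S : OrthogonalRep (Metric.sphere (0 : D) 1) T) :
    OrthogonalRep (Metric.sphere (0 : D) 1) (WithLp 2 (PiLp 2 (fun _ : Fin k => D) × T)) :=
  .ofLinear
    (fun w =>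
      { toFun := fun x => WithLp.toLp 2 (WithLp.toLp 2 fun i => w * x.fst i, S.toHom w x.snd)
        map_add' := fun x y => WithLp.ofLp_injective 2 (Prod.ext (by ext; simp [mul_add]) (by simp))
        map_smul' := fun r x => WithLp.ofLp_injective 2
          (Prod.ext (by ext; simp [mul_smul_comm]) (by simp)) })
    (LinearMap.ext fun x => WithLp.ofLp_injective 2 (Prod.ext (by ext; simp) (by simp)))
    (fun w w' => LinearMap.ext fun x => WithLp.ofLp_injective 2
      (Prod.ext (by ext; simp [mul_assoc]) (by simp)))
    (fun w x => by
      rw [← sq_eq_sq₀ (norm_nonneg _) (norm_nonneg _), WithLp.prod_norm_sq_eq_of_L2,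
        WithLp.prod_norm_sq_eq_of_L2]
      simp [PiLp.norm_sq_eq_of_L2, S.norm_map])
    (fun x => (WithLp.prod_continuous_toLp 2 _ _).comp
      (.prodMk ((PiLp.continuous_toLp 2 _).comp
          (continuous_pi fun _ => continuous_subtype_val.mul continuous_const))
        (S.continuous.clm_apply continuous_const)))

variable {k : ℕ} (S : OrthogonalRep (Metric.sphere (0 : D) 1) T)

theorem prodUnitSphere_fst (w : Metric.sphere (0 : D) 1)
    (x : WithLp 2 (PiLp 2 (fun _ : Fin k => D) × T)) (i : Fin k) :
    ((S.prodUnitSphere k).toHom w x).fst i = w * x.fst i := rfl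

theorem eq_one_of_prodUnitSphere_apply_eq {w : Metric.sphere (0 : D) 1}
    {x : WithLp 2 (PiLp 2 (fun _ : Fin k => D) × T)} (hx : x.fst ≠ 0)
    (hw : (S.prodUnitSphere k).toHom w x = x) : w = 1 := by
  obtain ⟨i, hi⟩ : ∃ i, x.fst i ≠ 0 := by
    by_contra! hzero
    exact hx (by ext i; exact hzero i)
  have hwi := S.prodUnitSphere_fst w x i
  rw [hw] at hwi
  exact Subtype.ext (mul_eq_right₀ hi |>.1 hwi.symm)

theorem prodUnitSphere_apply_of_fst_eq_zero {w : Metric.sphere (0 : D) 1}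
    {x x' : WithLp 2 (PiLp 2 (fun _ : Fin k => D) × T)} (hx : x.fst = 0) (hx' : x'.fst = 0)
    (hw : S.toHom w x.snd = x'.snd) : (S.prodUnitSphere k).toHom w x = x' := by
  refine WithLp.ofLp_injective 2 (Prod.ext ?_ hw)
  ext i
  change w * x.fst i = x'.fst i
  rw [hx, hx']
  exact mul_zero _

variable [NeZero k]

theorem injective_prodUnitSphere : Function.Injective (S.prodUnitSphere k).toHom :=
  (injective_iff_map_eq_one _).2 fun w hw =>
    S.eq_one_of_prodUnitSphere_apply_eq (x := baseVector D T k) baseVector_fst_ne_zero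
      (by simp [hw])

variable {S} in
theorem isFreeAt_prodUnitSphere_iff (hS : ¬ Function.Injective S.toHom)
    {s : Metric.sphere (0 : WithLp 2 (PiLp 2 (fun _ : Fin k => D) × T)) 1} :
    (S.prodUnitSphere k).IsFreeAt s ↔ s.1.fst ≠ 0 := by
  refine ⟨fun hfree hs => hS ((injective_iff_map_eq_one _).2 fun w hw => ?_), fun hs w hw => ?_⟩
  · refine (injective_iff_map_eq_one _).1 S.injective_prodUnitSphere w (hfree w (Subtype.ext ?_))
    exact S.prodUnitSphere_apply_of_fst_eq_zero hs hs (by simp [hw])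
  · rw [S.eq_one_of_prodUnitSphere_apply_eq hs (congrArg Subtype.val hw), map_one]

variable (D T k) in
/-- The first coordinate of the image of `baseVector`; on the infinitesimal action of `X ∈ D` it
takes the value `X`. -/
noncomputable def evalBase :
    (WithLp 2 (PiLp 2 (fun _ : Fin k => D) × T) →L[ℝ] WithLp 2 (PiLp 2 (fun _ : Fin k => D) × T))
      →ₗ[ℝ] D where
  toFun A := (A (baseVector D T k)).fst 0
  map_add' _ _ := rfl
  map_smul' _ _ := rfl

variable {S} {A : WithLp 2 (PiLp 2 (fun _ : Fin k => D) × T) →L[ℝ]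
    WithLp 2 (PiLp 2 (fun _ : Fin k => D) × T)}

theorem hasDerivAt_evalBase {w : ℝ → Metric.sphere (0 : D) 1}
    (hw : HasDerivAt (fun t => (S.prodUnitSphere k).toHom (w t)) A 0) :
    HasDerivAt (fun t => (w t : D)) (evalBase D T k A) 0 := by
  have hasDerivAt_fst := ((PiLp.proj (𝕜 := ℝ) 2 (fun _ : Fin k => D) 0).comp
    (WithLp.fstL 2 ℝ _ T)).hasFDerivAt.comp_hasDerivAt (0 : ℝ)
      (hasDerivAt_toHom_apply hw (baseVector D T k))
  refine hasDerivAt_fst.congr_of_eventuallyEq (Eventually.of_forall fun t => ?_)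
  change (w t : D) = w t * (baseVector D T k).fst 0
  rw [baseVector_fst_zero, mul_one]

theorem IsVelocity.inner_one_evalBase (hA : (S.prodUnitSphere k).IsVelocity A) :
    inner ℝ (1 : D) (evalBase D T k A) = 0 := by
  obtain ⟨w, hw_zero, hw⟩ := hA
  have hasDerivAt_norm_sq := (hasDerivAt_evalBase hw).norm_sq
  have norm_sq_eq_one : (fun t => ‖(w t : D)‖ ^ 2) = fun _ => 1 := by ext t; simp
  rw [norm_sq_eq_one] at hasDerivAt_norm_sq
  simpa [hw_zero] using hasDerivAt_norm_sq.unique (hasDerivAt_const (0 : ℝ) (1 : ℝ))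

variable [IsScalarTower ℝ D D]

namespace IsVelocity

theorem fst_apply (hA : (S.prodUnitSphere k).IsVelocity A)
    (x : WithLp 2 (PiLp 2 (fun _ : Fin k => D) × T)) (i : Fin k) :
    (A x).fst i = evalBase D T k A * x.fst i := by
  obtain ⟨w, -, hw⟩ := hA
  have hasDerivAt_fst := ((PiLp.proj (𝕜 := ℝ) 2 (fun _ : Fin k => D) i).comp
    (WithLp.fstL 2 ℝ _ T)).hasFDerivAt.comp_hasDerivAt (0 : ℝ) (hasDerivAt_toHom_apply hw x)
  exact hasDerivAt_fst.unique ((LinearMap.mulRight ℝ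
    (x.fst i)).toContinuousLinearMap.hasFDerivAt.comp_hasDerivAt (0 : ℝ) (hasDerivAt_evalBase hw))

theorem evalBase_conj (hA : (S.prodUnitSphere k).IsVelocity A) (w : Metric.sphere (0 : D) 1) :
    evalBase D T k ((S.prodUnitSphere k).toHom w * A * (S.prodUnitSphere k).toHom w⁻¹) =
      w * evalBase D T k A * (w : D)⁻¹ := by
  change w * (A ((S.prodUnitSphere k).toHom w⁻¹ (baseVector D T k))).fst 0 = _
  rw [hA.fst_apply, prodUnitSphere_fst, baseVector_fst_zero]
  simp [mul_assoc]

theorem eq_zero_of_evalBase_eq_zero (hA : (S.prodUnitSphere k).IsVelocity A)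
    (hS : ∀ w : ℝ → Metric.sphere (0 : D) 1, w 0 = 1 →
      HasDerivAt (fun t => (w t : D)) 0 0 → ∀ y, HasDerivAt (fun t => S.toHom (w t) y) 0 0)
    (hA_eval : evalBase D T k A = 0) : A = 0 := by
  refine ContinuousLinearMap.ext fun x => WithLp.ofLp_injective 2 (Prod.ext ?_ ?_)
  · ext i
    exact (hA.fst_apply x i).trans (by rw [hA_eval, zero_mul]; rfl)
  · obtain ⟨w, hw_zero, hw⟩ := hA
    have hasDerivAt_zero := hasDerivAt_evalBase hw
    rw [hA_eval] at hasDerivAt_zero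
    exact ((WithLp.sndL 2 ℝ (PiLp 2 fun _ : Fin k => D) T).hasFDerivAt.comp_hasDerivAt (0 : ℝ)
      (hasDerivAt_toHom_apply hw x)).unique
        (hS w hw_zero hasDerivAt_zero x.snd)

end IsVelocity

theorem finrank_map_apply_prodUnitSphere {𝔯 : Submodule ℝ
      (WithLp 2 (PiLp 2 (fun _ : Fin k => D) × T) →L[ℝ]
        WithLp 2 (PiLp 2 (fun _ : Fin k => D) × T))}
    (h𝔯 : ∀ A ∈ 𝔯, (S.prodUnitSphere k).IsVelocity A)
    (hdisjoint : Disjoint 𝔯 (evalBase D T k).ker)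
    {x : WithLp 2 (PiLp 2 (fun _ : Fin k => D) × T)} (hx : x.fst ≠ 0) :
    Module.finrank ℝ (𝔯.map (ContinuousLinearMap.apply ℝ _ x).toLinearMap) =
      Module.finrank ℝ (𝔯.map (evalBase D T k)) := by
  rw [finrank_map_of_disjoint_ker hdisjoint]
  refine finrank_map_of_disjoint_ker (LinearMap.disjoint_ker.2 fun A hA hAx => ?_)
  obtain ⟨i, hi⟩ : ∃ i, x.fst i ≠ 0 := by
    by_contra! hzero
    exact hx (by ext i; exact hzero i)
  have hAxi := (h𝔯 A hA).fst_apply x i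
  rw [show A x = 0 from hAx] at hAxi
  exact LinearMap.disjoint_ker.1 hdisjoint A hA
    ((mul_eq_zero.1 hAxi.symm).resolve_right hi)

theorem isSphereModel_prodUnitSphere {r c m : ℕ} (hm : 1 ≤ m) (hc : r + c = m)
    (htrans : ∀ y y' : T, ‖y‖ = 1 → ‖y'‖ = 1 → ∃ w, S.toHom w y = y')
    (hne : ∃ y : T, ‖y‖ = 1) (hS : ¬ Function.Injective S.toHom)
    (hderiv : ∀ w : ℝ → Metric.sphere (0 : D) 1, w 0 = 1 →
      HasDerivAt (fun t => (w t : D)) 0 0 → ∀ y, HasDerivAt (fun t => S.toHom (w t) y) 0 0)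
    (hrank : ∀ U : Submodule ℝ D, U ≠ ⊥ → (∀ X ∈ U, inner ℝ (1 : D) X = 0) →
      (∀ w : Metric.sphere (0 : D) 1, ∀ X ∈ U, (w : D) * X * (w : D)⁻¹ ∈ U) →
      Module.finrank ℝ U = r) :
    (S.prodUnitSphere k).IsSphereModel m c := by
  refine ⟨hm, ?_, ?_, fun s s' hs hs' => ?_, fun 𝔯 hbot hconj h𝔯 s hs => ?_⟩
  · exact ⟨⟨baseVector D T k, by simp [norm_baseVector]⟩,
      (isFreeAt_prodUnitSphere_iff hS).2 baseVector_fst_ne_zero⟩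
  · obtain ⟨y, hy⟩ := hne
    exact ⟨⟨WithLp.toLp 2 (0, y), by rw [mem_sphere_zero_iff_norm, WithLp.norm_toLp_snd, hy]⟩,
      (isFreeAt_prodUnitSphere_iff hS).not.2 (not_not.2 rfl)⟩
  · rw [isFreeAt_prodUnitSphere_iff hS, not_not] at hs hs'
    obtain ⟨w, hw⟩ := htrans s.1.snd s'.1.snd (by simp [norm_snd_of_fst_eq_zero hs])
      (by simp [norm_snd_of_fst_eq_zero hs'])
    exact ⟨w, Subtype.ext (S.prodUnitSphere_apply_of_fst_eq_zero hs hs' hw)⟩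
  · have hdisjoint : Disjoint 𝔯 (evalBase D T k).ker :=
      LinearMap.disjoint_ker.2 fun A hA => (h𝔯 A hA).eq_zero_of_evalBase_eq_zero hderiv
    rw [finrank_map_apply_prodUnitSphere h𝔯 hdisjoint ((isFreeAt_prodUnitSphere_iff hS).1 hs),
      hrank _ ?_ ?_ ?_, hc]
    · exact fun hmap => hbot (hdisjoint.eq_bot_of_le (LinearMap.le_ker_iff_map.2 hmap))
    · rintro _ ⟨A, hA, rfl⟩
      exact (h𝔯 A hA).inner_one_evalBase
    · rintro w _ ⟨A, hA, rfl⟩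
      exact ⟨_, hconj w A hA, (h𝔯 A hA).evalBase_conj w⟩

end DivisionAlgebra

end OrthogonalRep

end UnitSphere

section WeylGroup

variable {G W : Type*} [Group G] [TopologicalSpace G] [IsTopologicalGroup G] [Group W]
  [TopologicalSpace W]

theorem isClosed_normalizer_of_isClosed {K : Subgroup G} (hK : IsClosed (K : Set G)) :
    IsClosed (Subgroup.normalizer (K : Set G) : Set G) := by
  have normalizer_eq : (Subgroup.normalizer (K : Set G) : Set G) =
      ⋂ n ∈ K, ((fun g => g * n * g⁻¹) ⁻¹' K ∩ (fun g => g⁻¹ * n * g) ⁻¹' K) := by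
    ext g
    simp only [SetLike.mem_coe, mem_iInter, mem_inter_iff, mem_preimage]
    refine ⟨fun hg n hn => ⟨(Subgroup.mem_normalizer_iff.1 hg n).1 hn,
      (Subgroup.mem_normalizer_iff''.1 hg n).1 hn⟩, fun hg => ?_⟩
    refine Subgroup.mem_normalizer_iff.2 fun n => ⟨fun hn => (hg n hn).1, fun hn => ?_⟩
    simpa [mul_assoc] using (hg _ hn).2
  rw [normalizer_eq]
  exact isClosed_biInter fun n _ => (hK.preimage (by fun_prop)).inter (hK.preimage (by fun_prop))

theorem exists_continuous_comp_eq_of_range_le {H Q : Type*} [Group H] [TopologicalSpace H]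
    [Group Q] [TopologicalSpace Q] {φ : W →* Q} (hφ : IsEmbedding φ) {p : H →* Q}
    (hp : Continuous p) (hle : p.range ≤ φ.range) :
    ∃ π : H →* W, Continuous π ∧ ∀ x, φ (π x) = p x := by
  let e := MonoidHom.ofInjective hφ.injective
  let π : H →* W := e.symm.toMonoidHom.comp (p.codRestrict φ.range fun x => hle ⟨x, rfl⟩)
  have hπ (x : H) : φ (π x) = p x := congrArg Subtype.val (e.apply_symm_apply _)
  exact ⟨π, hφ.continuous_iff.2 (hp.congr fun x => (hπ x).symm), hπ⟩

theorem EmbedsIn.exists_ker_map_eq [CompactSpace W] {K : Subgroup G} (hK : IsClosed (K : Set G))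
    (h : EmbedsIn W (WeylGroup K)) :
    ∃ (L : Subgroup G) (π : L →* W), IsClosed (L : Set G) ∧ Continuous π ∧
      Function.Surjective π ∧ π.ker.map L.subtype = K := by
  obtain ⟨φ, hφ_cont, hφ_inj⟩ := h
  let N := Subgroup.normalizer (K : Set G)
  have : IsClosed (K.subgroupOf N : Set N) := hK.preimage continuous_subtype_val
  have hφ : IsClosedEmbedding φ := hφ_cont.isClosedEmbedding hφ_inj
  let p : N →* WeylGroup K := QuotientGroup.mk' _
  have hp : Continuous p := QuotientGroup.continuous_mk
  have hp_eq_one {n : N} : p n = 1 ↔ (n : G) ∈ K :=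
    (QuotientGroup.eq_one_iff _).trans Subgroup.mem_subgroupOf
  let L : Subgroup G := (φ.range.comap p).map N.subtype
  have hLN : L ≤ N := Subgroup.map_subtype_le _
  have hKL {x : G} (hx : x ∈ K) : x ∈ L :=
    ⟨⟨x, Subgroup.le_normalizer hx⟩, ⟨1, (map_one φ).trans (hp_eq_one.2 hx).symm⟩, rfl⟩
  obtain ⟨π, hπ_cont, hπ⟩ := exists_continuous_comp_eq_of_range_le hφ.isEmbedding
    (p := p.comp (Subgroup.inclusion hLN)) (hp.comp (continuous_inclusion hLN)) (by
      rintro _ ⟨⟨_, n, hn, rfl⟩, rfl⟩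
      exact hn)
  have hπ_eq_one {l : L} : π l = 1 ↔ (l : G) ∈ K := by
    rw [← map_eq_one_iff φ hφ_inj, hπ]
    exact hp_eq_one
  refine ⟨L, π, ?_, hπ_cont, fun w => ?_, ?_⟩
  · exact (isClosed_normalizer_of_isClosed hK).isClosedEmbedding_subtypeVal.isClosedMap _
      (hφ.isClosed_range.preimage hp)
  · obtain ⟨n, hn⟩ := QuotientGroup.mk'_surjective (K.subgroupOf N) (φ w)
    exact ⟨⟨n, n, ⟨w, hn.symm⟩, rfl⟩, hφ_inj ((hπ _).trans hn)⟩
  · ext x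
    exact ⟨fun ⟨l, hl, hlx⟩ => hlx ▸ hπ_eq_one.1 hl, fun hx => ⟨⟨x, hKL hx⟩, hπ_eq_one.2 hx, rfl⟩⟩

end WeylGroup

theorem EmbedsIn.trans {A B C : Type*} [Group A] [TopologicalSpace A] [Group B]
    [TopologicalSpace B] [Group C] [TopologicalSpace C] (h : EmbedsIn A B) (h' : EmbedsIn B C) :
    EmbedsIn A C := by
  obtain ⟨f, hf_cont, hf_inj⟩ := h
  obtain ⟨g, hg_cont, hg_inj⟩ := h'
  exact ⟨g.comp f, hg_cont.comp hf_cont, hg_inj.comp hf_inj⟩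

theorem OrthogonalRep.IsSphereModel.actsWithUniqueNonprincipalOrbit_of_embedsIn {d : ℕ}
    {G : Type u} [Group G] [TopologicalSpace G] [CompactSpace G] [T2Space G]
    [ChartedSpace (EuclideanSpace ℝ (Fin d)) G]
    [LieGroup (𝓡 d) ∞ G] {K : Subgroup G} (hK : IsClosed (K : Set G))
    {W : Type*} [Group W] [TopologicalSpace W] [CompactSpace W] [Infinite W]
    (hW : EmbedsIn W (WeylGroup K)) {V : Type} [NormedAddCommGroup V] [InnerProductSpace ℝ V]
    {R : OrthogonalRep W V} (hR_inj : Function.Injective R.toHom) {m c : ℕ}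
    (hR : R.IsSphereModel m c) (hV : Module.finrank ℝ V = m + 1) :
    ActsWithUniqueNonprincipalOrbit d K c := by
  have : IsTopologicalGroup G := topologicalGroup_of_lieGroup (𝓡 d) ∞
  obtain ⟨L, π, hL, hπ, hsurj, rfl⟩ := hW.exists_ker_map_eq hK
  have ker_comp : (R.comp π hπ).toHom.ker = π.ker := by
    ext l
    exact map_eq_one_iff R.toHom hR_inj
  have : Infinite (L ⧸ (R.comp π hπ).toHom.ker) := by
    rw [ker_comp]
    exact (QuotientGroup.quotientKerEquivOfSurjective π hsurj).toEquiv.infinite_iff.2 ‹_›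
  rw [← ker_comp]
  exact (hR.comp hπ hsurj).actsWithUniqueNonprincipalOrbit hL hV

section Complex

theorem embedsIn_circle : EmbedsIn (Metric.sphere (0 : ℂ) 1) Circle :=
  ⟨{ toFun := fun w => (⟨w, w.2⟩ : Circle)
     map_one' := rfl
     map_mul' := fun _ _ => rfl },
    continuous_subtype_val.subtype_mk _,
    fun _ _ h => Subtype.ext (congrArg (fun z : Circle => (z : ℂ)) h)⟩

/-- The representation of the circle group on `ℂ` of weight two. -/
noncomputable def OrthogonalRep.complexSq : OrthogonalRep (Metric.sphere (0 : ℂ) 1) ℂ :=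
  .ofLinear (fun w => LinearMap.mulLeft ℝ ((w : ℂ) ^ 2))
    (by ext; simp) (fun w w' => by ext; simp [mul_pow])
    (fun w x => by simp) (fun x => (continuous_subtype_val.pow 2).mul continuous_const)

theorem OrthogonalRep.complexSq_apply (w : Metric.sphere (0 : ℂ) 1) (x : ℂ) :
    OrthogonalRep.complexSq.toHom w x = (w : ℂ) ^ 2 * x := rfl

theorem exists_complexSq_apply_eq {x y : ℂ} (hx : ‖x‖ = 1) (hy : ‖y‖ = 1) :
    ∃ w, OrthogonalRep.complexSq.toHom w x = y := by
  obtain ⟨z, hz⟩ := IsAlgClosed.exists_pow_nat_eq (y / x) two_pos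
  have hx_ne_zero : x ≠ 0 := norm_ne_zero_iff.1 (by simp [hx])
  have norm_sq_eq_one : ‖z‖ ^ 2 = 1 := by rw [← norm_pow, hz, norm_div, hx, hy, div_one]
  refine ⟨⟨z, mem_sphere_zero_iff_norm.2 ?_⟩, ?_⟩
  · exact (pow_eq_one_iff_of_nonneg (norm_nonneg _) two_ne_zero).1 norm_sq_eq_one
  · rw [OrthogonalRep.complexSq_apply, hz, div_mul_cancel₀ _ hx_ne_zero]

theorem finrank_eq_one_of_le_orthogonal_one {U : Submodule ℝ ℂ} (hU : U ≠ ⊥)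
    (hU_le : U ≤ (Submodule.span ℝ {(1 : ℂ)})ᗮ) : Module.finrank ℝ U = 1 := by
  have : Fact (Module.finrank ℝ ℂ = 1 + 1) := ⟨Complex.finrank_real_complex⟩
  refine le_antisymm ?_ (Submodule.one_le_finrank_iff.2 hU)
  exact (Submodule.finrank_mono hU_le).trans_eq
    (Submodule.finrank_orthogonal_span_singleton one_ne_zero)

theorem isSphereModel_complexSq {k : ℕ} [NeZero k] :
    (OrthogonalRep.complexSq.prodUnitSphere k).IsSphereModel (2 * k + 1) (2 * k) := by
  refine OrthogonalRep.isSphereModel_prodUnitSphere (r := 1) (by omega) (by omega)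
    (fun y y' => exists_complexSq_apply_eq) ⟨1, norm_one⟩ (fun hinj => ?_)
    (fun w _ hw y => ?_) fun U hU hU_one _ => ?_
  · refine neg_one_ne_one_unitSphere (hinj (ContinuousLinearMap.ext fun y => ?_))
    simp [OrthogonalRep.complexSq_apply]
  · simpa [OrthogonalRep.complexSq_apply] using (hw.pow 2).mul_const y
  · exact finrank_eq_one_of_le_orthogonal_one hU fun X hX =>
      Submodule.mem_orthogonal_singleton_iff_inner_right.2 (hU_one X hX)

end Complex

section Quaternion

open scoped Quaternion

theorem inv_eq_star_of_norm_eq_one {q : ℍ[ℝ]} (hq : ‖q‖ = 1) : q⁻¹ = star q :=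
  inv_eq_of_mul_eq_one_right (by
    rw [Quaternion.self_mul_star, Quaternion.normSq_eq_norm_mul_self, hq, one_mul,
      Quaternion.coe_one])

/-- The right multiplications of `ℍ = ℂ ⊕ ℂj` as complex matrices, acting on row vectors of
coordinates with respect to the basis `1, j`. -/
def quaternionToMatrix : ℍ[ℝ] →* Matrix (Fin 2) (Fin 2) ℂ where
  toFun q := !![⟨q.re, q.imI⟩, ⟨q.imJ, q.imK⟩; ⟨-q.imJ, q.imK⟩, ⟨q.re, -q.imI⟩]
  map_one' := by
    ext i j
    fin_cases i <;> fin_cases j <;> simp [Complex.ext_iff]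
  map_mul' p q := by
    ext i j
    fin_cases i <;> fin_cases j <;>
      simp [Complex.ext_iff, Matrix.mul_apply, Fin.sum_univ_two] <;> constructor <;> ring

theorem quaternionToMatrix_apply (q : ℍ[ℝ]) :
    quaternionToMatrix q =
      !![⟨q.re, q.imI⟩, ⟨q.imJ, q.imK⟩; ⟨-q.imJ, q.imK⟩, ⟨q.re, -q.imI⟩] := rfl

theorem quaternionToMatrix_star (q : ℍ[ℝ]) :
    quaternionToMatrix (star q) = star (quaternionToMatrix q) := by
  ext i j
  fin_cases i <;> fin_cases j <;>
    simp [quaternionToMatrix_apply, Complex.ext_iff, Matrix.star_apply]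

theorem det_quaternionToMatrix (q : ℍ[ℝ]) :
    (quaternionToMatrix q).det = (Quaternion.normSq q : ℝ) := by
  rw [quaternionToMatrix_apply, Matrix.det_fin_two_of, Quaternion.normSq_def', Complex.ext_iff]
  constructor <;> simp [sq] <;> ring

theorem injective_quaternionToMatrix : Function.Injective quaternionToMatrix := fun p q h => by
  simp only [quaternionToMatrix_apply, EmbeddingLike.apply_eq_iff_eq, Matrix.vecCons_inj,
    Complex.mk.injEq] at h
  exact Quaternion.ext _ _ h.1.1.1 h.1.1.2 h.1.2.1.1 h.1.2.1.2

theorem continuous_quaternionToMatrix : Continuous quaternionToMatrix := by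
  have continuous_mk {a b : ℍ[ℝ] → ℝ} (ha : Continuous a) (hb : Continuous b) :
      Continuous fun q => (⟨a q, b q⟩ : ℂ) :=
    Complex.equivRealProdCLM.symm.continuous.comp (ha.prodMk hb)
  refine continuous_matrix fun i j => ?_
  fin_cases i <;> fin_cases j
  · exact continuous_mk Quaternion.continuous_re Quaternion.continuous_imI
  · exact continuous_mk Quaternion.continuous_imJ Quaternion.continuous_imK
  · exact continuous_mk Quaternion.continuous_imJ.neg Quaternion.continuous_imK
  · exact continuous_mk Quaternion.continuous_re Quaternion.continuous_imI.neg

theorem quaternionToMatrix_mem_specialUnitaryGroup {q : ℍ[ℝ]} (hq : ‖q‖ = 1) :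
    quaternionToMatrix q ∈ Matrix.specialUnitaryGroup (Fin 2) ℂ := by
  have hq_ne_zero : q ≠ 0 := norm_ne_zero_iff.1 (by simp [hq])
  refine Matrix.mem_specialUnitaryGroup_iff.2 ⟨Matrix.mem_unitaryGroup_iff.2 ?_, ?_⟩
  · rw [← quaternionToMatrix_star, ← map_mul, ← inv_eq_star_of_norm_eq_one hq,
      mul_inv_cancel₀ hq_ne_zero, map_one]
  · rw [det_quaternionToMatrix, Quaternion.normSq_eq_norm_mul_self, hq, one_mul,
      Complex.ofReal_one]

theorem embedsIn_specialUnitaryGroup :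
    EmbedsIn (Metric.sphere (0 : ℍ[ℝ]) 1) (Matrix.specialUnitaryGroup (Fin 2) ℂ) :=
  ⟨{ toFun := fun q => ⟨quaternionToMatrix q,
      quaternionToMatrix_mem_specialUnitaryGroup (norm_eq_of_mem_sphere q)⟩
     map_one' := Subtype.ext (map_one _)
     map_mul' := fun _ _ => Subtype.ext (map_mul _ _ _) },
    (continuous_quaternionToMatrix.comp continuous_subtype_val).subtype_mk _,
    fun _ _ h => Subtype.ext (injective_quaternionToMatrix (congrArg Subtype.val h))⟩

/-- The space of purely imaginary quaternions. -/
noncomputable abbrev imQuaternion : Submodule ℝ ℍ[ℝ] := (Submodule.span ℝ {1})ᗮ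

theorem mem_imQuaternion {x : ℍ[ℝ]} : x ∈ imQuaternion ↔ x.re = 0 := by
  rw [Submodule.mem_orthogonal_singleton_iff_inner_right, Quaternion.inner_def, one_mul,
    Quaternion.re_star]

theorem finrank_imQuaternion : Module.finrank ℝ imQuaternion = 3 := by
  have : Fact (Module.finrank ℝ ℍ[ℝ] = 3 + 1) := ⟨Quaternion.finrank_eq_four⟩
  exact Submodule.finrank_orthogonal_span_singleton one_ne_zero

theorem conj_mem_imQuaternion {w x : ℍ[ℝ]} (hw : ‖w‖ = 1) (hx : x ∈ imQuaternion) :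
    w * x * w⁻¹ ∈ imQuaternion := by
  rw [mem_imQuaternion] at hx ⊢
  rw [inv_eq_star_of_norm_eq_one hw]
  simp [hx]
  ring

theorem exists_mem_imQuaternion_ne_ne_neg (p : ℍ[ℝ]) :
    ∃ u ∈ imQuaternion, ‖u‖ = 1 ∧ u ≠ p ∧ u ≠ -p := by
  have norm_eq_one {u : ℍ[ℝ]} (hu : u.re ^ 2 + u.imI ^ 2 + u.imJ ^ 2 + u.imK ^ 2 = 1) :
      ‖u‖ = 1 := by
    rwa [← Quaternion.normSq_def', Quaternion.normSq_eq_norm_mul_self, ← sq,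
      pow_eq_one_iff_of_nonneg (norm_nonneg _) two_ne_zero] at hu
  by_cases hp : p.imI = 0
  · refine ⟨⟨0, 1, 0, 0⟩, mem_imQuaternion.2 rfl, norm_eq_one (by simp), fun h => ?_, fun h => ?_⟩
    all_goals simpa [hp] using congrArg (·.imI) h
  · refine ⟨⟨0, 0, 1, 0⟩, mem_imQuaternion.2 rfl, norm_eq_one (by simp), fun h => hp ?_,
      fun h => hp ?_⟩
    all_goals simpa [eq_comm] using congrArg (·.imI) h

/-- The representation of the unit quaternions on the imaginary quaternions by conjugation. -/
noncomputable def OrthogonalRep.quaternionConj :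
    OrthogonalRep (Metric.sphere (0 : ℍ[ℝ]) 1) imQuaternion :=
  .ofLinear
    (fun w => (LinearMap.mulLeft ℝ (w : ℍ[ℝ]) ∘ₗ LinearMap.mulRight ℝ (w : ℍ[ℝ])⁻¹).restrict
      fun x hx => by
        simpa [mul_assoc] using conj_mem_imQuaternion (norm_eq_of_mem_sphere w) hx)
    (by ext x : 2; simp)
    (fun w w' => by ext x : 2; simp [mul_assoc])
    (fun w x => by simp [Submodule.coe_norm])
    (fun x => .subtype_mk (continuous_subtype_val.mul (continuous_const.mul
      (continuous_subtype_val.inv₀ fun w => ne_zero_of_mem_unit_sphere w))) _)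

theorem OrthogonalRep.coe_quaternionConj (w : Metric.sphere (0 : ℍ[ℝ]) 1) (x : imQuaternion) :
    (OrthogonalRep.quaternionConj.toHom w x : ℍ[ℝ]) = w * x * (w : ℍ[ℝ])⁻¹ :=
  (mul_assoc _ _ _).symm

theorem mul_self_eq_neg_one_of_mem_imQuaternion {x : ℍ[ℝ]} (hx : x ∈ imQuaternion)
    (hx_norm : ‖x‖ = 1) : x * x = -1 := by
  rw [← sq, Quaternion.sq_eq_neg_normSq.2 (mem_imQuaternion.1 hx),
    Quaternion.normSq_eq_norm_mul_self, hx_norm, one_mul, Quaternion.coe_one]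

section Transitive

variable {p q : ℍ[ℝ]} (hp : p ∈ imQuaternion) (hq : q ∈ imQuaternion) (hp_norm : ‖p‖ = 1)
  (hq_norm : ‖q‖ = 1)

include hp hq hp_norm hq_norm

theorem exists_conj_eq_of_ne_neg (hpq : q ≠ -p) :
    ∃ w : Metric.sphere (0 : ℍ[ℝ]) 1, (w : ℍ[ℝ]) * p * (w : ℍ[ℝ])⁻¹ = q := by
  have hpp := mul_self_eq_neg_one_of_mem_imQuaternion hp hp_norm
  have hqq := mul_self_eq_neg_one_of_mem_imQuaternion hq hq_norm
  have ne_zero : 1 - q * p ≠ 0 := fun h => hpq <| by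
    rw [← mul_one q, ← neg_eq_iff_eq_neg, ← mul_neg, ← hpp, ← mul_assoc, ← sub_eq_zero.1 h,
      one_mul]
  have intertwines : (1 - q * p) * p = q * (1 - q * p) := by
    rw [sub_mul, mul_sub, mul_assoc, hpp, ← mul_assoc, hqq]
    simp [add_comm]
  refine ⟨⟨‖1 - q * p‖⁻¹ • (1 - q * p), by simp [norm_smul, ne_zero]⟩, ?_⟩
  rw [mul_inv_eq_iff_eq_mul₀ (smul_ne_zero (inv_ne_zero (norm_ne_zero_iff.2 ne_zero)) ne_zero),
    smul_mul_assoc, intertwines, mul_smul_comm]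

theorem exists_conj_eq :
    ∃ w : Metric.sphere (0 : ℍ[ℝ]) 1, (w : ℍ[ℝ]) * p * (w : ℍ[ℝ])⁻¹ = q := by
  by_cases hpq : q = -p
  · obtain ⟨u, hu, hu_norm, hu_ne, hu_ne_neg⟩ := exists_mem_imQuaternion_ne_ne_neg p
    obtain ⟨w, hw⟩ := exists_conj_eq_of_ne_neg hp hu hp_norm hu_norm hu_ne_neg
    obtain ⟨w', hw'⟩ := exists_conj_eq_of_ne_neg hu hq hu_norm hq_norm
      fun h => hu_ne (neg_injective (h.symm.trans hpq))
    exact ⟨w' * w, by rw [← hw', ← hw]; simp [mul_assoc]⟩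
  · exact exists_conj_eq_of_ne_neg hp hq hp_norm hq_norm hpq

end Transitive

theorem eq_imQuaternion_of_conj_mem {U : Submodule ℝ ℍ[ℝ]} (hU : U ≠ ⊥) (hle : U ≤ imQuaternion)
    (hconj : ∀ w : Metric.sphere (0 : ℍ[ℝ]) 1, ∀ X ∈ U, (w : ℍ[ℝ]) * X * (w : ℍ[ℝ])⁻¹ ∈ U) :
    U = imQuaternion := by
  obtain ⟨X, hX, hX_ne_zero⟩ := (Submodule.ne_bot_iff U).1 hU
  refine le_antisymm hle fun Y hY => ?_
  rcases eq_or_ne Y 0 with rfl | hY_ne_zero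
  · exact U.zero_mem
  obtain ⟨w, hw⟩ := exists_conj_eq (imQuaternion.smul_mem ‖X‖⁻¹ (hle hX))
    (imQuaternion.smul_mem ‖Y‖⁻¹ hY) (norm_smul_inv_norm hX_ne_zero)
    (norm_smul_inv_norm hY_ne_zero)
  rw [← U.smul_mem_iff (inv_ne_zero (norm_ne_zero_iff.2 hY_ne_zero)), ← hw]
  exact hconj w _ (U.smul_mem _ hX)

theorem hasDerivAt_quaternionConj {w : ℝ → Metric.sphere (0 : ℍ[ℝ]) 1}
    (hw : HasDerivAt (fun t => (w t : ℍ[ℝ])) 0 0) (y : imQuaternion) :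
    HasDerivAt (fun t => OrthogonalRep.quaternionConj.toHom (w t) y) 0 0 := by
  have hasDerivAt_inv :=
    (hasFDerivAt_inv' (𝕜 := ℝ) (ne_zero_of_mem_unit_sphere (w 0))).comp_hasDerivAt (0 : ℝ) hw
  have hasDerivAt_conj := (hw.mul_const (y : ℍ[ℝ])).mul hasDerivAt_inv
  rw [map_zero, zero_mul, zero_mul, mul_zero, add_zero] at hasDerivAt_conj
  have hasDerivAt_proj :=
    imQuaternion.orthogonalProjectionOnto.hasFDerivAt.comp_hasDerivAt (0 : ℝ) hasDerivAt_conj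
  rw [map_zero] at hasDerivAt_proj
  refine hasDerivAt_proj.congr_of_eventuallyEq (Eventually.of_forall fun t => ?_)
  exact (imQuaternion.orthogonalProjectionOnto_mem_subspace_eq_self _).symm.trans
    (congrArg _ (OrthogonalRep.coe_quaternionConj (w t) y))

theorem isSphereModel_quaternionConj {k : ℕ} [NeZero k] :
    (OrthogonalRep.quaternionConj.prodUnitSphere k).IsSphereModel (4 * k + 2) (4 * k - 1) := by
  have k_pos := NeZero.pos k
  refine OrthogonalRep.isSphereModel_prodUnitSphere (r := 3) (by omega) (by omega)
    (fun y y' hy hy' => ?_) ?_ (fun hinj => ?_) (fun w _ => hasDerivAt_quaternionConj)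
    fun U hU hU_one hconj => ?_
  · obtain ⟨w, hw⟩ := exists_conj_eq y.2 y'.2 hy hy'
    exact ⟨w, Subtype.ext ((OrthogonalRep.coe_quaternionConj w y).trans hw)⟩
  · obtain ⟨u, hu, hu_norm, -⟩ := exists_mem_imQuaternion_ne_ne_neg 0
    exact ⟨⟨u, hu⟩, hu_norm⟩
  · refine neg_one_ne_one_unitSphere (hinj (ContinuousLinearMap.ext fun y => Subtype.ext ?_))
    simp [OrthogonalRep.coe_quaternionConj]
  · rw [eq_imQuaternion_of_conj_mem hU (fun X hX =>
      Submodule.mem_orthogonal_singleton_iff_inner_right.2 (hU_one X hX)) hconj]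
    exact finrank_imQuaternion

end Quaternion

theorem mainTheorem7 {d : ℕ} {G : Type u} [Group G] [TopologicalSpace G] [CompactSpace G] [T2Space G]
    [ChartedSpace (EuclideanSpace ℝ (Fin d)) G] [LieGroup (𝓡 d) ∞ G]
    (K : Subgroup G) (hK : IsClosed (K : Set G)) (k c : ℕ) (hk : 1 ≤ k)
    (hW : (EmbedsIn Circle (WeylGroup K) ∧ c = 2 * k) ∨
      (EmbedsIn (Matrix.specialUnitaryGroup (Fin 2) ℂ) (WeylGroup K) ∧ c = 4 * k - 1)) :
    ∃ (n : ℕ) (M : Type u) (_ : TopologicalSpace M)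
      (_ : ChartedSpace (EuclideanSpace ℝ (Fin n)) M) (_ : MulAction G M),
      IsManifold (𝓡 n) ∞ M ∧ T2Space M ∧ CompactSpace M ∧
      ContMDiffSMul (𝓡 d) (𝓡 n) ∞ G M ∧
      (MulAction.toPermHom G M).ker = K.normalCore ∧
      ConnectedSpace (MulAction.orbitRel.Quotient G M) ∧
      IsPrincipalIsotropy M K ∧
      HasCohomogeneity d n G M c ∧
      ∃! O : MulAction.orbitRel.Quotient G M, ¬ IsPrincipalOrbit O := by
  have : NeZero k := ⟨by omega⟩
  rcases hW with ⟨hW, rfl⟩ | ⟨hW, rfl⟩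
  · have := infinite_unitSphere (D := ℂ) (by rw [Complex.rank_real_complex]; norm_num)
    refine isSphereModel_complexSq.actsWithUniqueNonprincipalOrbit_of_embedsIn hK
      (embedsIn_circle.trans hW) (OrthogonalRep.injective_prodUnitSphere _) ?_
    rw [finrank_withLp_piLp_prod, Complex.finrank_real_complex]
    ring
  · have := infinite_unitSphere (D := Quaternion ℝ) (by rw [Quaternion.rank_eq_four]; norm_num)
    refine isSphereModel_quaternionConj.actsWithUniqueNonprincipalOrbit_of_embedsIn hK
      (embedsIn_specialUnitaryGroup.trans hW) (OrthogonalRep.injective_prodUnitSphere _) ?_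
    rw [finrank_withLp_piLp_prod, Quaternion.finrank_eq_four, finrank_imQuaternion]
    ring
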